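/- **Setting.** For couplings $\mathbf t=(t_1,t_2,\dots)$ let $\rho(z;\mathbf t)=\exp\big(-\tfrac{z^2}{2}+\sum_{k\ge1}t_kz^k\big)$. Call $\mathbf t$ admissible if the series converges for every real $z$ and all the functions $z^j\rho(z;\mathbf t)$, $j\ge 0$, are integrable on $\mathbb R$. The skew-symmetric product of the orthogonal ensemble is $$\langle f,g\rangle_{\mathbf t}=\tfrac12\int_{\mathbb R^2}f(x)\,g(y)\,\mathrm{sgn}(y-x)\,\rho(x;\mathbf t)\,\rho(y;\mathbf t)\,dx\,dy ,$$ with semi-infinite moment matrix $m_\infty(\mathbf t)=(\langle x^i,y^j\rangle_{\mathbf t})_{i,j\ge0}$. Let $J$ be the block diagonal semi-infinite matrix with diagonal blocks $\begin{pmatrix}0&1\\-1&0\end{pmatrix}$, and let $\Lambda=(\delta_{i+1,j})$ be the shift matrix. Factorise $m_\infty(\mathbf t)=S^{-1}J(S^{-1})^{\top}$ with $S=S(\mathbf t)$ lower triangular and the $2\times2$ blocks on its diagonal positive multiples of the identity. The Pfaff Lax matrix is $L(\mathbf t)=S\Lambda S^{-1}$. For a semi-infinite matrix $A$ write $A=A_-+A_0+A_+$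 for its parts below, in, and above the $2\times2$ diagonal blocks, and put $A_{\mathfrak t}=A_--J(A_+)^{\top}J+\tfrac12\big(A_0-J(A_0)^{\top}J\big)$. Numbering rows and columns from $1$, a matrix $L$ is said to be of the *reduced form* with entries $w^\ell_n$ ($\ell\in\mathbb Z$, $n\ge1$) if $$L_{2n-1,2n}=1,\quad L_{2n,2n+1}=w^0_n,\quad L_{2n+2k-2,\,2n-1}=w^{-k}_n,\quad L_{2n+2k-1,\,2n}=w^{k}_n\qquad(n,k\ge1)$$ and all its other entries vanish. Put $w^\ell_0=0$. **Theorem.** Suppose that all odd couplings vanish, $\mathbf t=(0,t_2,0,t_4,\dots)$, and that $\mathbf t$ is admissible. Then the factorisation above exists and is unique, and $L(\mathbf t)$ is of the reduced form; denote its entries by $w^\ell_n(\mathbf t)$. Moreover: (i) At every such $\mathbf t$ that stays admissible under small changes of $t_2$, the entries of $L$ are differentiable in $t_2$ and satisfy the Lax equation $$\frac{\partial L}{\partial t_2}=\big[-(L^2)_{\mathfrak t},\,L\big],$$ and the $w^\ell_n(\mathbf t)$ satisfy, for all $n\ge1$, the double infinite chain $$\begin{aligned} \partial_{t_2}w^{-k}_n&=\tfrac{w^{-k}_n}{2}\big(w^0_nw^1_n-w^0_{n-1}w^1_{n-1}+w^0_{n+k-1}w^1_{n+k-1}-w^0_{n+k-2}w^1_{n+k-2}\big)\\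 &\quad+w^{-k+1}_{n+1}w^0_n-w^{-k+1}_nw^0_{n+k-2}+w^{-k-1}_nw^0_{n+k-1}-w^{-k-1}_{n-1}w^0_{n-1}\qquad(k\ge2),\\ \partial_{t_2}w^{-1}_n&=w^{-1}_n\big(w^0_nw^1_n-w^0_{n-1}w^1_{n-1}\big)+w^0_n\big(w^0_n+w^{-2}_n\big)-w^0_{n-1}\big(w^0_{n-1}+w^{-2}_{n-1}\big),\\ \partial_{t_2}w^0_n&=\tfrac{w^0_n}{2}\big(w^0_{n+1}w^1_{n+1}-w^0_{n-1}w^1_{n-1}\big)+w^0_n\big(w^{-1}_{n+1}-w^{-1}_n\big),\\ \partial_{t_2}w^1_n&=\tfrac{w^1_n}{2}\big(w^0_{n-1}w^1_{n-1}-w^0_{n+1}w^1_{n+1}\big)+w^0_{n+1}w^2_n-w^0_{n-1}w^2_{n-1},\\ \partial_{t_2}w^k_n&=\tfrac{w^k_n}{2}\big(w^0_{n-1}w^1_{n-1}-w^0_nw^1_n+w^0_{n+k-1}w^1_{n+k-1}-w^0_{n+k}w^1_{n+k}\big)\\ &\quad+w^{k+1}_nw^0_{n+k}-w^{k+1}_{n-1}w^0_{n-1}+w^{k-1}_{n+1}w^0_n-w^{k-1}_nw^0_{n+k-1}\qquad(k\ge2).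 \end{aligned}$$ More generally, for any functions $w^\ell_n$ of a real variable $t_2$ (with $w^0_0=0$) and $L$ the matrix of the reduced form with these entries, the Lax equation for $L$ is equivalent to this chain, at each value of $t_2$. (ii) At $\mathbf t=\mathbf 0$ (the GOE), for all $n\ge1$, $$w^{-k}_n(\mathbf 0)=0\ (k>2),\quad w^{-2}_n(\mathbf 0)=-\tfrac12\sqrt{2n(2n-1)},\quad w^{-1}_n(\mathbf 0)=\tfrac12,\quad w^0_n(\mathbf 0)=\tfrac12\sqrt{2n(2n-1)},$$ $$w^k_n(\mathbf 0)=2^{k+1}\,\frac{(k+n-1)!}{(n-1)!}\left(\frac{(2n-2)!}{(2k+2n-2)!}\right)^{1/2}\qquad(k>0).$$ -/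

import Mathlib

open Filter Topology MeasureTheory

noncomputable section

namespace PfaffLattice

/-! ### The orthogonal ensemble with couplings `t = (t₁, t₂, …)` -/

/-- The weight `ρ(z; t) = exp(-z²/2 + ∑_{k ≥ 1} t_k z^k)`. -/
def weight (t : ℕ+ → ℝ) (z : ℝ) : ℝ :=
  Real.exp (-z ^ 2 / 2 + ∑' k : ℕ+, t k * z ^ (k : ℕ))

/-- The couplings for which the weight makes sense and has finite moments of every order. -/
def Admissible (t : ℕ+ → ℝ) : Prop :=
  (∀ z : ℝ, Summable fun k : ℕ+ => t k * z ^ (k : ℕ)) ∧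
    ∀ j : ℕ, Integrable fun z : ℝ => z ^ j * weight t z

/-- All odd couplings vanish: `t = (0, t₂, 0, t₄, …)`. -/
def EvenCouplings (t : ℕ+ → ℝ) : Prop :=
  ∀ k : ℕ+, Odd (k : ℕ) → t k = 0

/-- The skew-symmetric product
`⟨f, g⟩_t = ½ ∫_{ℝ²} f(x) g(y) sgn(y - x) ρ(x; t) ρ(y; t) dx dy`. -/
def skewProd (t : ℕ+ → ℝ) (f g : ℝ → ℝ) : ℝ :=
  (1 / 2) * ∫ p : ℝ × ℝ,
    f p.1 * g p.2 * Real.sign (p.2 - p.1) * weight t p.1 * weight t p.2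

/-- The semi-infinite moment matrix `m_∞(t)`. -/
def skewMoments (t : ℕ+ → ℝ) : Matrix ℕ ℕ ℝ :=
  Matrix.of fun i j => skewProd t (fun x => x ^ i) (fun y => y ^ j)

/-! ### Semi-infinite matrices (rows and columns numbered from `0`) -/

/-- The product of semi-infinite matrices; every product below has finite sums as entries. -/
def semiMul (A B : Matrix ℕ ℕ ℝ) : Matrix ℕ ℕ ℝ :=
  Matrix.of fun i j => ∑ᶠ p : ℕ, A i p * B p j

infixl:70 " ⬝∞ " => semiMul

/-- The commutator `[A, B]`. -/
def comm (A B : Matrix ℕ ℕ ℝ) : Matrix ℕ ℕ ℝ := A ⬝∞ B - B ⬝∞ A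

/-- The shift matrix. -/
def shift : Matrix ℕ ℕ ℝ :=
  Matrix.of fun i j => if j = i + 1 then 1 else 0

/-- The block diagonal matrix `J` with diagonal blocks `(0, 1; -1, 0)`. -/
def J : Matrix ℕ ℕ ℝ :=
  Matrix.of fun i j =>
    if Even i ∧ j = i + 1 then 1 else if Even j ∧ i = j + 1 then -1 else 0

/-- The part of `A` in the `2 × 2` blocks along the diagonal. -/
def blockDiag (A : Matrix ℕ ℕ ℝ) : Matrix ℕ ℕ ℝ :=
  Matrix.of fun i j => if i / 2 = j / 2 then A i j else 0

/-- The part of `A` strictly above the `2 × 2` diagonal blocks. -/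
def blockUpper (A : Matrix ℕ ℕ ℝ) : Matrix ℕ ℕ ℝ :=
  Matrix.of fun i j => if i / 2 < j / 2 then A i j else 0

/-- The part of `A` strictly below the `2 × 2` diagonal blocks. -/
def blockLower (A : Matrix ℕ ℕ ℝ) : Matrix ℕ ℕ ℝ :=
  Matrix.of fun i j => if j / 2 < i / 2 then A i j else 0

/-- The projection `A_𝔱 = A₋ - J (A₊)ᵀ J + ½ (A₀ - J (A₀)ᵀ J)`. -/
def projT (A : Matrix ℕ ℕ ℝ) : Matrix ℕ ℕ ℝ :=
  blockLower A - J ⬝∞ (blockUpper A).transpose ⬝∞ J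
    + (1 / 2 : ℝ) • (blockDiag A - J ⬝∞ (blockDiag A).transpose ⬝∞ J)

/-- The inverse of a lower triangular semi-infinite matrix with nonzero diagonal: its entries are
those of the inverses of the finite upper left corners. -/
def triInv (S : Matrix ℕ ℕ ℝ) : Matrix ℕ ℕ ℝ :=
  Matrix.of fun i j =>
    (Matrix.of fun a b : Fin (max i j + 1) => S a b)⁻¹
      ⟨i, Nat.lt_succ_of_le (le_max_left i j)⟩ ⟨j, Nat.lt_succ_of_le (le_max_right i j)⟩

/-! ### The Pfaff Lax matrix -/

/-- `S` is the lower triangular factor in `m = S⁻¹ J (S⁻¹)ᵀ`, normalised so that its `2 × 2`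
diagonal blocks are positive multiples of the identity. -/
structure IsPfaffFactor (m S : Matrix ℕ ℕ ℝ) : Prop where
  lower : ∀ i j, i < j → S i j = 0
  block_off : ∀ n, S (2 * n + 1) (2 * n) = 0
  block_diag : ∀ n, S (2 * n + 1) (2 * n + 1) = S (2 * n) (2 * n)
  pos : ∀ n, 0 < S (2 * n) (2 * n)
  factor : m = triInv S ⬝∞ J ⬝∞ (triInv S).transpose

/-- The factor `S` of `m` (an arbitrary matrix if there is none). -/
def pfaffFactor (m : Matrix ℕ ℕ ℝ) : Matrix ℕ ℕ ℝ :=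
  Classical.epsilon (IsPfaffFactor m)

/-- The Lax matrix `L(t) = S(t) Λ S(t)⁻¹` of the orthogonal ensemble. -/
def pfaffLax (t : ℕ+ → ℝ) : Matrix ℕ ℕ ℝ :=
  pfaffFactor (skewMoments t) ⬝∞ shift ⬝∞ triInv (pfaffFactor (skewMoments t))

/-- The entry `w^ℓ_n`, `n ≥ 1`, of a matrix `L`. With rows and columns numbered from `1` these are
`w^0_n = L_{2n, 2n+1}`, `w^{-k}_n = L_{2n+2k-2, 2n-1}` and `w^k_n = L_{2n+2k-1, 2n}` for `k ≥ 1`.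
By convention `w^ℓ_0 = 0`. -/
def laxEntry (L : Matrix ℕ ℕ ℝ) (l : ℤ) (n : ℕ) : ℝ :=
  if n = 0 then 0
  else if l = 0 then L (2 * n - 1) (2 * n)
  else if l < 0 then L (2 * (n + l.natAbs) - 3) (2 * n - 2)
  else L (2 * (n + l.natAbs) - 2) (2 * n - 1)

/-- The entries `w^ℓ_n(t)` of the Lax matrix of the orthogonal ensemble. -/
def latticeVar (t : ℕ+ → ℝ) (l : ℤ) (n : ℕ) : ℝ := laxEntry (pfaffLax t) l n

/-- The sparse matrix with the entries `w^ℓ_n`, `n ≥ 1`: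
```
  0        1       0       0    0      0   …
  w^{-1}_1 0       w^0_1   0    0      0   …
  0        w^1_1   0       1    0      0   …
  w^{-2}_1 0       w^{-1}_2 0   w^0_2  0   …
  0        w^2_1   0      w^1_2 0      1   …
```
-/
def reducedLax (w : ℤ → ℕ → ℝ) : Matrix ℕ ℕ ℝ :=
  Matrix.of fun i j =>
    if Even i ∧ Odd j then
      if j = i + 1 then 1
      else if j < i then w (((i - j + 1) / 2 : ℕ) : ℤ) ((j + 1) / 2)
      else 0
    else if Odd i ∧ Even j then
      if j = i + 1 then w 0 (j / 2)
      else if j < i then w (-(((i - j + 1) / 2 : ℕ) : ℤ)) (j / 2 + 1)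
      else 0
    else 0

/-! ### The first even flow -/

/-- At the time `s` the curve `L` of matrices satisfies `dL/dt₂ = [-(L²)_𝔱, L]`. -/
def SolvesLaxAt (L : ℝ → Matrix ℕ ℕ ℝ) (s : ℝ) : Prop :=
  ∀ i j, HasDerivAt (fun r => L r i j) (comm (-projT (L s ⬝∞ L s)) (L s) i j) s

/-- At the time `s` the variables `w r ℓ n = w^ℓ_n(r)`, `n ≥ 1`, satisfy the double infinite chain
(the value `w^0_0`, which it mentions at `n = 1`, is `0` in all uses). -/
structure SolvesChainAt (w : ℝ → ℤ → ℕ → ℝ) (s : ℝ) : Prop where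
  neg : ∀ k n : ℕ, 2 ≤ k → 1 ≤ n →
    HasDerivAt (fun r => w r (-k) n)
      (w s (-k) n / 2 *
          (w s 0 n * w s 1 n - w s 0 (n - 1) * w s 1 (n - 1)
            + w s 0 (n + k - 1) * w s 1 (n + k - 1) - w s 0 (n + k - 2) * w s 1 (n + k - 2))
        + w s (-k + 1) (n + 1) * w s 0 n - w s (-k + 1) n * w s 0 (n + k - 2)
        + w s (-k - 1) n * w s 0 (n + k - 1) - w s (-k - 1) (n - 1) * w s 0 (n - 1)) s
  neg_one : ∀ n : ℕ, 1 ≤ n →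
    HasDerivAt (fun r => w r (-1) n)
      (w s (-1) n * (w s 0 n * w s 1 n - w s 0 (n - 1) * w s 1 (n - 1))
        + w s 0 n * (w s 0 n + w s (-2) n)
        - w s 0 (n - 1) * (w s 0 (n - 1) + w s (-2) (n - 1))) s
  zero : ∀ n : ℕ, 1 ≤ n →
    HasDerivAt (fun r => w r 0 n)
      (w s 0 n / 2 * (w s 0 (n + 1) * w s 1 (n + 1) - w s 0 (n - 1) * w s 1 (n - 1))
        + w s 0 n * (w s (-1) (n + 1) - w s (-1) n)) s
  one : ∀ n : ℕ, 1 ≤ n →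
    HasDerivAt (fun r => w r 1 n)
      (w s 1 n / 2 * (w s 0 (n - 1) * w s 1 (n - 1) - w s 0 (n + 1) * w s 1 (n + 1))
        + w s 0 (n + 1) * w s 2 n - w s 0 (n - 1) * w s 2 (n - 1)) s
  pos : ∀ k n : ℕ, 2 ≤ k → 1 ≤ n →
    HasDerivAt (fun r => w r k n)
      (w s k n / 2 *
          (w s 0 (n - 1) * w s 1 (n - 1) - w s 0 n * w s 1 n
            + w s 0 (n + k - 1) * w s 1 (n + k - 1) - w s 0 (n + k) * w s 1 (n + k))
        + w s (k + 1) n * w s 0 (n + k) - w s (k + 1) (n - 1) * w s 0 (n - 1)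
        + w s (k - 1) (n + 1) * w s 0 n - w s (k - 1) n * w s 0 (n + k - 1)) s

end PfaffLattice

end

/-! Existence. If the odd couplings vanish, the reflection (x,y) ↦ (-x,-y) kills all moments with
i+j even. By skew symmetry the moment matrix is then determined by B = (⟨x^{2i}, x^{2j+1}⟩), and the
Pfaff factorisation becomes an LDU factorisation of B with positive D: the even rows of S come from
the unipotent P that makes P B upper triangular, the odd rows from its analogue for Bᵀ, all divided
by √D (`paritySkewFactor_isPfaffFactor`). Nonzero corner minors and D > 0 both follow from
`exists_skewProd_pos`. For monic p the primitive F(y) = ∫₀^y p(x²)ρ(x)dx is odd and, by Rolle, has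
at most deg p positive zeros. So an odd polynomial of degree at most 2 deg p + 1 can copy the sign
changes of F, and its skew product with p(x²) is the integral of a nonnegative, nonzero function.

Uniqueness. Two factors differ by a matrix T of the same shape with T J Tᵀ = J. Then T J is block
lower triangular and equals the block upper triangular J T⁻ᵀ, which forces T = 1. As S does not mix
parities, L = SΛS⁻¹ has the reduced form.

Lax equation. In t₂ the moments satisfy m' = Λ²m + m(Λ²)ᵀ. With A = S'S⁻¹, differentiating S m Sᵀ =
J says that A + L² is fixed by X ↦ J Xᵀ J. Since A is lower triangular with scalar diagonal blocks,
this determines A = -(L²)_𝔱 (`eq_neg_projT`), and L' = [A, L] follows from L S = S Λ.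

Chain. L² commutes with L, so the right hand side is [X, L] with X = L² - (L²)_𝔱. For the reduced
form X has only three nonzero diagonals (`projT_sq_reducedLax`), whence each entry of [X, L] is a
short explicit expression.

GOE. With ρ = exp(-x²/2), the odd partner of H_{2n} is x H_{2n} - H_{2n}', because this times ρ is
-(H_{2n}ρ)'. Integration by parts turns the skew product into Hermite orthogonality for ρ². The
entries of L are then read off from the expansion of x times each skew-orthonormal polynomial. -/

namespace PfaffLattice

/-! ### Algebra of banded semi-infinite matrices -/

/-- The entries of `A` vanish above the `b`-th superdiagonal. -/
def Band (b : ℕ) (A : Matrix ℕ ℕ ℝ) : Prop := ∀ i j, i + b < j → A i j = 0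

theorem Band.mono {a b : ℕ} {A : Matrix ℕ ℕ ℝ} (hA : Band a A) (h : a ≤ b) : Band b A :=
  fun i j hij => hA i j (by omega)

/-- A `finsum` with infinite support is 0 by default, so identities for `⬝∞` need a reason for
finiteness. Once past the support the bound `N` is free, which lets different products share a
range. -/
theorem semiMul_apply_of_le {A : Matrix ℕ ℕ ℝ} {B : Matrix ℕ ℕ ℝ} {i j N : ℕ}
    (h : ∀ p, N ≤ p → A i p * B p j = 0) :
    (A ⬝∞ B) i j = ∑ p ∈ Finset.range N, A i p * B p j := by
  simp only [semiMul, Matrix.of_apply]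
  apply finsum_eq_sum_of_support_subset
  intro p hp
  simp only [Finset.coe_range, Set.mem_Iio]
  by_contra hN
  exact hp (h p (by omega))

theorem Band.semiMul_apply {b : ℕ} {A : Matrix ℕ ℕ ℝ} (hA : Band b A) (B : Matrix ℕ ℕ ℝ)
    {i N : ℕ} (hN : i + b < N) (j : ℕ) :
    (A ⬝∞ B) i j = ∑ p ∈ Finset.range N, A i p * B p j :=
  semiMul_apply_of_le fun p hp => by rw [hA i p (by omega), zero_mul]

theorem Band.semiMul_apply_right {b : ℕ} {B : Matrix ℕ ℕ ℝ} (hB : Band b B.transpose)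
    (A : Matrix ℕ ℕ ℝ) (i : ℕ) {j N : ℕ} (hN : j + b < N) :
    (A ⬝∞ B) i j = ∑ p ∈ Finset.range N, A i p * B p j :=
  semiMul_apply_of_le fun p hp => by
    rw [show B p j = 0 from hB j p (by omega), mul_zero]

theorem transpose_semiMul (A B : Matrix ℕ ℕ ℝ) :
    (A ⬝∞ B).transpose = B.transpose ⬝∞ A.transpose := by
  ext i j
  simp [semiMul, Matrix.transpose_apply, mul_comm]

theorem Band.semiMul {a b : ℕ} {A B : Matrix ℕ ℕ ℝ} (hA : Band a A) (hB : Band b B) :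
    Band (a + b) (A ⬝∞ B) := by
  intro i j hij
  rw [hA.semiMul_apply B (Nat.lt_succ_self (i + a))]
  refine Finset.sum_eq_zero fun p hp => ?_
  rw [Finset.mem_range] at hp
  rw [hB p j (by omega), mul_zero]

theorem Band.add {a : ℕ} {A B : Matrix ℕ ℕ ℝ} (hA : Band a A) (hB : Band a B) :
    Band a (A + B) := fun i j hij => by simp [hA i j hij, hB i j hij]

theorem Band.neg {a : ℕ} {A : Matrix ℕ ℕ ℝ} (hA : Band a A) : Band a (-A) :=
  fun i j hij => by simp [hA i j hij]

theorem Band.sub {a : ℕ} {A B : Matrix ℕ ℕ ℝ} (hA : Band a A) (hB : Band a B) :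
    Band a (A - B) := fun i j hij => by simp [hA i j hij, hB i j hij]

theorem band_one : Band 0 (1 : Matrix ℕ ℕ ℝ) := fun i j hij =>
  Matrix.one_apply_ne (by omega)

theorem band_shift : Band 1 shift := fun i j hij => by
  simp only [shift, Matrix.of_apply]; rw [if_neg (by omega)]

theorem band_J : Band 1 J := fun i j hij => by
  simp only [J, Matrix.of_apply]; rw [if_neg (by omega), if_neg (by omega)]

theorem transpose_J : J.transpose = -J := by
  ext i j
  simp only [J, Matrix.transpose_apply, Matrix.of_apply, Matrix.neg_apply]
  split_ifs <;> first | omega | simp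

/-- Associativity can fail for semi-infinite matrices. It holds whenever the double sum is finite,
and three cases are needed: the two left factors have finite rows, the two right factors have finite
columns (`semiMul_assoc_right`), or the outer factors confine the sum and the middle one is
arbitrary (`semiMul_assoc_mid`). The last case serves the moment matrix, which is not banded. -/
theorem semiMul_assoc_left {a b : ℕ} {A B : Matrix ℕ ℕ ℝ} (hA : Band a A) (hB : Band b B)
    (C : Matrix ℕ ℕ ℝ) : A ⬝∞ B ⬝∞ C = A ⬝∞ (B ⬝∞ C) := by
  ext i j
  rw [(hA.semiMul hB).semiMul_apply C (N := i + (a + b) + 1) (by omega),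
    hA.semiMul_apply _ (N := i + a + 1) (by omega)]
  have h1 : ∀ p ∈ Finset.range (i + (a + b) + 1), (A ⬝∞ B) i p * C p j =
      ∑ q ∈ Finset.range (i + a + 1), A i q * B q p * C p j := fun p _ => by
    rw [hA.semiMul_apply B (N := i + a + 1) (by omega), Finset.sum_mul]
  rw [Finset.sum_congr rfl h1, Finset.sum_comm]
  refine Finset.sum_congr rfl fun q hq => ?_
  rw [Finset.mem_range] at hq
  rw [hB.semiMul_apply C (N := i + (a + b) + 1) (by omega), Finset.mul_sum]
  exact Finset.sum_congr rfl fun p _ => mul_assoc _ _ _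

theorem semiMul_assoc_right {b c : ℕ} (A : Matrix ℕ ℕ ℝ) {B C : Matrix ℕ ℕ ℝ}
    (hB : Band b B.transpose) (hC : Band c C.transpose) :
    A ⬝∞ B ⬝∞ C = A ⬝∞ (B ⬝∞ C) := by
  apply Matrix.transpose_injective
  simp only [transpose_semiMul]
  exact (semiMul_assoc_left hC hB _).symm

theorem semiMul_assoc_mid {a c : ℕ} {A C : Matrix ℕ ℕ ℝ} (hA : Band a A) (B : Matrix ℕ ℕ ℝ)
    (hC : Band c C.transpose) : A ⬝∞ B ⬝∞ C = A ⬝∞ (B ⬝∞ C) := by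
  ext i j
  rw [hC.semiMul_apply_right _ _ (N := j + c + 1) (by omega),
    hA.semiMul_apply _ (N := i + a + 1) (by omega)]
  have h1 : ∀ p ∈ Finset.range (j + c + 1), (A ⬝∞ B) i p * C p j =
      ∑ q ∈ Finset.range (i + a + 1), A i q * B q p * C p j := fun p _ => by
    rw [hA.semiMul_apply B (N := i + a + 1) (by omega), Finset.sum_mul]
  rw [Finset.sum_congr rfl h1, Finset.sum_comm]
  refine Finset.sum_congr rfl fun q _ => ?_
  rw [hC.semiMul_apply_right _ _ (N := j + c + 1) (by omega), Finset.mul_sum]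
  exact Finset.sum_congr rfl fun p _ => mul_assoc _ _ _

theorem one_semiMul (A : Matrix ℕ ℕ ℝ) : 1 ⬝∞ A = A := by
  ext i j
  rw [band_one.semiMul_apply A (N := i + 1) (by omega),
    Finset.sum_eq_single i (fun p _ hp => by rw [Matrix.one_apply_ne hp.symm, zero_mul])
      (fun h => by simp at h)]
  simp

theorem semiMul_one (A : Matrix ℕ ℕ ℝ) : A ⬝∞ 1 = A := by
  apply Matrix.transpose_injective
  rw [transpose_semiMul, Matrix.transpose_one, one_semiMul]

/-- Additivity also requires finite supports, here supplied by a common band width. Negation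
preserves supports and needs no such condition. -/
theorem add_semiMul {a : ℕ} {A B : Matrix ℕ ℕ ℝ} (hA : Band a A) (hB : Band a B)
    (C : Matrix ℕ ℕ ℝ) : (A + B) ⬝∞ C = A ⬝∞ C + B ⬝∞ C := by
  ext i j
  rw [Matrix.add_apply, hA.semiMul_apply C (Nat.lt_succ_self _),
    hB.semiMul_apply C (Nat.lt_succ_self _), (hA.add hB).semiMul_apply C (Nat.lt_succ_self _),
    ← Finset.sum_add_distrib]
  exact Finset.sum_congr rfl fun p _ => by simp [add_mul]

theorem semiMul_add_of_band {a : ℕ} {A : Matrix ℕ ℕ ℝ} (hA : Band a A) (B C : Matrix ℕ ℕ ℝ) :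
    A ⬝∞ (B + C) = A ⬝∞ B + A ⬝∞ C := by
  ext i j
  rw [Matrix.add_apply]
  simp only [hA.semiMul_apply _ (Nat.lt_succ_self _)]
  rw [← Finset.sum_add_distrib]
  exact Finset.sum_congr rfl fun p _ => by simp [mul_add]

theorem neg_semiMul (A B : Matrix ℕ ℕ ℝ) : (-A) ⬝∞ B = -(A ⬝∞ B) := by
  ext i j
  simp [semiMul, finsum_neg_distrib]

theorem semiMul_neg (A B : Matrix ℕ ℕ ℝ) : A ⬝∞ (-B) = -(A ⬝∞ B) := by
  ext i j
  simp [semiMul, finsum_neg_distrib]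

theorem sub_semiMul {a : ℕ} {A B : Matrix ℕ ℕ ℝ} (hA : Band a A) (hB : Band a B)
    (C : Matrix ℕ ℕ ℝ) : (A - B) ⬝∞ C = A ⬝∞ C - B ⬝∞ C := by
  rw [sub_eq_add_neg, add_semiMul hA hB.neg, neg_semiMul, sub_eq_add_neg]

theorem semiMul_sub_of_band {a : ℕ} {A : Matrix ℕ ℕ ℝ} (hA : Band a A) (B C : Matrix ℕ ℕ ℝ) :
    A ⬝∞ (B - C) = A ⬝∞ B - A ⬝∞ C := by
  rw [sub_eq_add_neg, semiMul_add_of_band hA, semiMul_neg, sub_eq_add_neg]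

/-- Multiplication by `J` on the left. -/
theorem J_semiMul_apply (A : Matrix ℕ ℕ ℝ) (i j : ℕ) :
    (J ⬝∞ A) i j = if Even i then A (i + 1) j else -A (i - 1) j := by
  rw [band_J.semiMul_apply A (Nat.lt_succ_self _)]
  split_ifs with h
  · rw [Finset.sum_eq_single (i + 1)]
    · simp [J, h]
    · intro p _ hp
      have : ¬ (Even i ∧ p = i + 1) := by tauto
      have : ¬ (Even p ∧ i = p + 1) := by grind
      simp [J, *]
    · intro h; simp at h
  · rw [Finset.sum_eq_single (i - 1)]
    · have h1 : Even (i - 1) ∧ i = i - 1 + 1 := by grind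
      have h2 : ¬ (Even i ∧ i - 1 = i + 1) := by tauto
      simp only [J, Matrix.of_apply]
      rw [if_neg h2, if_pos h1]; ring
    · intro p _ hp
      have : ¬ (Even i ∧ p = i + 1) := by tauto
      have : ¬ (Even p ∧ i = p + 1) := by grind
      simp [J, *]
    · intro h; simp at h; omega

/-- Multiplication by `J` on the right. -/
theorem semiMul_J_apply (A : Matrix ℕ ℕ ℝ) (i j : ℕ) :
    (A ⬝∞ J) i j = if Even j then -A i (j + 1) else A i (j - 1) := by
  have h : A ⬝∞ J = (-(J ⬝∞ A.transpose)).transpose := by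
    rw [← neg_semiMul, ← transpose_J, transpose_semiMul, Matrix.transpose_transpose,
      Matrix.transpose_transpose]
  rw [h, Matrix.transpose_apply, Matrix.neg_apply, J_semiMul_apply]
  split_ifs <;> simp

theorem J_semiMul_J : J ⬝∞ J = -1 := by
  ext i j
  rw [J_semiMul_apply]
  simp only [J, Matrix.of_apply, Matrix.neg_apply, Matrix.one_apply]
  split_ifs <;> grind

/-! ### Inverses of lower triangular matrices -/

section Inverse

variable {S : Matrix ℕ ℕ ℝ}

/-- The upper left corner of size `n`. -/
def corner (A : Matrix ℕ ℕ ℝ) (n : ℕ) : Matrix (Fin n) (Fin n) ℝ := Matrix.of fun a b => A a b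

theorem corner_det_ne_zero (hS : Band 0 S) (hd : ∀ i, S i i ≠ 0) (n : ℕ) :
    (corner S n).det ≠ 0 := by
  rw [Matrix.det_of_isLowerTriangular]
  · exact Finset.prod_ne_zero_iff.2 fun i _ => hd i
  · intro i j hij
    exact hS i j (by simpa using hij)

theorem corner_inv_lower (hS : Band 0 S) (hd : ∀ i, S i i ≠ 0) (n : ℕ) (i j : Fin n)
    (hij : i < j) : (corner S n)⁻¹ i j = 0 := by
  have := (corner S n).invertibleOfIsUnitDet (corner_det_ne_zero hS hd n).isUnit
  refine Matrix.blockTriangular_inv_of_blockTriangular (b := OrderDual.toDual)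
    (M := corner S n) (fun a b hab => hS a b (by simpa using hab)) ?_
  simpa using hij

/-- In the identity for the large corner, rows below `m` see only columns below `m` because `S` is
lower triangular. Hence the inverses of the corners are nested and `triInv` is consistent. -/
theorem corner_inv_apply (hS : Band 0 S) (hd : ∀ i, S i i ≠ 0) {m n : ℕ} (hmn : m ≤ n)
    (i j : Fin m) :
    (corner S n)⁻¹ (Fin.castLE hmn i) (Fin.castLE hmn j) = (corner S m)⁻¹ i j := by
  suffices h : (corner S m)⁻¹ = (corner S n)⁻¹.submatrix (Fin.castLE hmn) (Fin.castLE hmn) by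
    rw [h]; rfl
  apply Matrix.inv_eq_right_inv
  ext a b
  have h1 := congrFun (congrFun (Matrix.mul_nonsing_inv (corner S n)
    (corner_det_ne_zero hS hd n).isUnit) (Fin.castLE hmn a)) (Fin.castLE hmn b)
  rw [Matrix.mul_apply] at h1 ⊢
  rw [Matrix.one_apply] at h1 ⊢
  simp only [Fin.castLE_inj] at h1
  rw [← h1]
  refine (Finset.sum_map Finset.univ (Fin.castLEEmb hmn)
    (fun p => corner S n (Fin.castLE hmn a) p * (corner S n)⁻¹ p (Fin.castLE hmn b))).symm.trans ?_
  apply Finset.sum_subset (Finset.subset_univ _)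
  intro p _ hp
  have hp' : m ≤ (p : ℕ) := by
    by_contra hlt
    exact hp (Finset.mem_map.2 ⟨⟨p, by omega⟩, Finset.mem_univ _, by ext; simp⟩)
  have : corner S n (Fin.castLE hmn a) p = 0 := hS _ _ (by simp; omega)
  rw [this, zero_mul]

theorem triInv_apply (hS : Band 0 S) (hd : ∀ i, S i i ≠ 0) {n i j : ℕ} (hi : i < n)
    (hj : j < n) : triInv S i j = (corner S n)⁻¹ ⟨i, hi⟩ ⟨j, hj⟩ :=
  (corner_inv_apply hS hd (show max i j + 1 ≤ n by omega)
    ⟨i, Nat.lt_succ_of_le (le_max_left i j)⟩ ⟨j, Nat.lt_succ_of_le (le_max_right i j)⟩).symm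

theorem band_triInv (hS : Band 0 S) (hd : ∀ i, S i i ≠ 0) : Band 0 (triInv S) := by
  intro i j hij
  rw [triInv_apply hS hd (n := j + 1) (by omega) (by omega)]
  exact corner_inv_lower hS hd _ _ _ (by simpa using hij)

theorem semiMul_triInv (hS : Band 0 S) (hd : ∀ i, S i i ≠ 0) : S ⬝∞ triInv S = 1 := by
  ext i j
  rw [hS.semiMul_apply _ (N := max i j + 1) (by omega), ← Fin.sum_univ_eq_sum_range
    (fun p => S i p * triInv S p j)]
  have h1 := congrFun (congrFun (Matrix.mul_nonsing_inv (corner S (max i j + 1))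
    (corner_det_ne_zero hS hd _).isUnit) ⟨i, by omega⟩) ⟨j, by omega⟩
  rw [Matrix.mul_apply] at h1
  rw [Matrix.one_apply] at h1 ⊢
  simp only [Fin.mk.injEq] at h1
  rw [← h1]
  refine Finset.sum_congr rfl fun p _ => ?_
  rw [triInv_apply hS hd p.2 (show j < max i j + 1 by omega)]
  rfl

theorem triInv_semiMul (hS : Band 0 S) (hd : ∀ i, S i i ≠ 0) : triInv S ⬝∞ S = 1 := by
  ext i j
  rw [(band_triInv hS hd).semiMul_apply _ (N := max i j + 1) (by omega),
    ← Fin.sum_univ_eq_sum_range (fun p => triInv S i p * S p j)]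
  have h1 := congrFun (congrFun (Matrix.nonsing_inv_mul (corner S (max i j + 1))
    (corner_det_ne_zero hS hd _).isUnit) ⟨i, by omega⟩) ⟨j, by omega⟩
  rw [Matrix.mul_apply] at h1
  rw [Matrix.one_apply] at h1 ⊢
  simp only [Fin.mk.injEq] at h1
  rw [← h1]
  refine Finset.sum_congr rfl fun p _ => ?_
  rw [triInv_apply hS hd (show i < max i j + 1 by omega) p.2]
  rfl

end Inverse

/-! ### The reduced form and the double infinite chain -/

/-- The entries of `A` at positions of even index sum vanish. -/
def OddParity (A : Matrix ℕ ℕ ℝ) : Prop := ∀ i j, Even (i + j) → A i j = 0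

theorem band_reducedLax (w : ℤ → ℕ → ℝ) : Band 1 (reducedLax w) := by
  intro i j hij
  simp only [reducedLax, Matrix.of_apply]
  split_ifs <;> first | rfl | omega

theorem oddParity_reducedLax (w : ℤ → ℕ → ℝ) : OddParity (reducedLax w) := by
  intro i j hij
  simp only [reducedLax, Matrix.of_apply]
  split_ifs <;> first | rfl | grind

theorem reducedLax_even_succ (w : ℤ → ℕ → ℝ) (a : ℕ) : reducedLax w (2 * a) (2 * a + 1) = 1 := by
  simp [reducedLax]

theorem reducedLax_odd_succ (w : ℤ → ℕ → ℝ) (a : ℕ) :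
    reducedLax w (2 * a + 1) (2 * a + 2) = w 0 (a + 1) := by
  have h1 : ¬ (Even (2 * a + 1) ∧ Odd (2 * a + 2)) := by grind
  have h2 : Odd (2 * a + 1) ∧ Even (2 * a + 2) := by grind
  simp only [reducedLax, Matrix.of_apply]
  rw [if_neg h1, if_pos h2, if_pos trivial]
  congr 1; omega

/-- The coordinates n = b + 1, k = d + 1 remove the truncated subtractions and halvings from
`reducedLax`; the entry computations below are all made in them. -/
theorem reducedLax_odd_even (w : ℤ → ℕ → ℝ) (b d : ℕ) :
    reducedLax w (2 * (b + d) + 1) (2 * b) = w (-(d + 1 : ℕ)) (b + 1) := by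
  have h1 : ¬ (Even (2 * (b + d) + 1) ∧ Odd (2 * b)) := by grind
  have h2 : Odd (2 * (b + d) + 1) ∧ Even (2 * b) := by grind
  simp only [reducedLax, Matrix.of_apply]
  rw [if_neg h1, if_pos h2, if_neg (by omega), if_pos (by omega)]
  congr 2
  · congr 1; omega
  · omega

theorem reducedLax_even_odd (w : ℤ → ℕ → ℝ) (b d : ℕ) :
    reducedLax w (2 * (b + d) + 2) (2 * b + 1) = w (d + 1 : ℕ) (b + 1) := by
  have h1 : Even (2 * (b + d) + 2) ∧ Odd (2 * b + 1) := by grind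
  simp only [reducedLax, Matrix.of_apply]
  rw [if_pos h1, if_neg (by omega), if_pos (by omega)]
  congr 2 <;> omega

/-! ### The entries of the square of a matrix with the reduced form -/

section Square

variable {M : Matrix ℕ ℕ ℝ}

theorem OddParity.sq_apply_of_odd (hM : Band 1 M) (hp : OddParity M) {i j : ℕ}
    (hij : Odd (i + j)) : (M ⬝∞ M) i j = 0 := by
  rw [hM.semiMul_apply M (Nat.lt_succ_self _)]
  refine Finset.sum_eq_zero fun p _ => ?_
  rcases Nat.even_or_odd (i + p) with h | h
  · rw [hp i p h, zero_mul]
  · rw [hp p j (by grind), mul_zero]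

theorem Band.sq_apply_add_two (hM : Band 1 M) (i : ℕ) :
    (M ⬝∞ M) i (i + 2) = M i (i + 1) * M (i + 1) (i + 2) := by
  rw [hM.semiMul_apply M (Nat.lt_succ_self _), Finset.sum_eq_single (i + 1)]
  · intro p hp hne
    rw [hM p (i + 2) (by simp at hp; omega), mul_zero]
  · intro h; simp at h

theorem OddParity.sq_apply_zero (hM : Band 1 M) (hp : OddParity M) :
    (M ⬝∞ M) 0 0 = M 0 1 * M 1 0 := by
  rw [hM.semiMul_apply M (Nat.lt_succ_self _)]
  simp [Finset.sum_range_succ, hp 0 0 (by simp)]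

theorem OddParity.sq_apply_succ (hM : Band 1 M) (hp : OddParity M) (i : ℕ) :
    (M ⬝∞ M) (i + 1) (i + 1) = M (i + 1) (i + 2) * M (i + 2) (i + 1)
      + M (i + 1) i * M i (i + 1) := by
  rw [hM.semiMul_apply M (N := i + 3) (by omega), Finset.sum_range_succ, Finset.sum_range_succ,
    Finset.sum_range_succ, Finset.sum_eq_zero, hp (i + 1) (i + 1) (by grind)]
  · ring
  · intro p hp
    rw [hM p (i + 1) (by simp at hp; omega), mul_zero]

end Square

/-- The difference `L² - (L²)_𝔱` for a matrix `L` of the reduced form. -/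
noncomputable def flowMatrix (w : ℤ → ℕ → ℝ) : Matrix ℕ ℕ ℝ :=
  Matrix.of fun i j =>
    if j = i + 2 then w 0 (i / 2 + 1)
    else if i = j + 2 then -w 0 (j / 2 + 1)
    else if i = j then
      (-1) ^ (i + 1) * ((w 0 (i / 2 + 1) * w 1 (i / 2 + 1) - w 0 (i / 2) * w 1 (i / 2)) / 2)
    else 0

theorem band_flowMatrix (w : ℤ → ℕ → ℝ) : Band 2 (flowMatrix w) := by
  intro i j hij
  simp only [flowMatrix, Matrix.of_apply]
  rw [if_neg (by omega), if_neg (by omega), if_neg (by omega)]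

theorem J_semiMul_J_apply (A : Matrix ℕ ℕ ℝ) (i j : ℕ) :
    (J ⬝∞ A ⬝∞ J) i j =
      if Even i then (if Even j then -A (i + 1) (j + 1) else A (i + 1) (j - 1))
      else (if Even j then A (i - 1) (j + 1) else -A (i - 1) (j - 1)) := by
  rw [semiMul_J_apply, J_semiMul_apply, J_semiMul_apply]
  split_ifs <;> simp

theorem projT_apply (A : Matrix ℕ ℕ ℝ) (i j : ℕ) :
    projT A i j = (if j / 2 < i / 2 then A i j else 0) -
      (J ⬝∞ (blockUpper A).transpose ⬝∞ J) i j + (1 / 2) *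
      ((if i / 2 = j / 2 then A i j else 0) - (J ⬝∞ (blockDiag A).transpose ⬝∞ J) i j) := by
  simp [projT, blockLower, blockDiag]

/-- Below the blocks only the reflected upper part survives in Q - Q_𝔱, and on the blocks only (Q₀ +
J Q₀ᵀ J)/2. Above the blocks Q = L² has just its second superdiagonal, whose two entries joining
consecutive blocks coincide, so reflection yields the same value with opposite sign. On a diagonal
block the two diagonal entries of Q share `w (-1)`, and half their difference is all that remains.
-/
theorem projT_sq_reducedLax (w : ℤ → ℕ → ℝ) (h0 : w 0 0 = 0) :
    projT (reducedLax w ⬝∞ reducedLax w) = reducedLax w ⬝∞ reducedLax w - flowMatrix w := by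
  have hM := band_reducedLax w
  have hp := oddParity_reducedLax w
  have hB : Band 2 (reducedLax w ⬝∞ reducedLax w) := hM.semiMul hM
  have hodd := fun i j h => hp.sq_apply_of_odd hM (i := i) (j := j) h
  have hE : ∀ a, (reducedLax w ⬝∞ reducedLax w) (2 * a) (2 * a + 2) = w 0 (a + 1) := fun a => by
    rw [hM.sq_apply_add_two, reducedLax_even_succ, reducedLax_odd_succ, one_mul]
  have hO : ∀ a, (reducedLax w ⬝∞ reducedLax w) (2 * a + 1) (2 * a + 3) = w 0 (a + 1) :=
    fun a => by
    rw [hM.sq_apply_add_two, show 2 * a + 1 + 2 = 2 * (a + 1) + 1 by ring,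
      show 2 * a + 1 + 1 = 2 * a + 2 by ring, reducedLax_odd_succ,
      show 2 * a + 2 = 2 * (a + 1) by ring, reducedLax_even_succ, mul_one]
  have hDo : ∀ a, (reducedLax w ⬝∞ reducedLax w) (2 * a + 1) (2 * a + 1) =
      w 0 (a + 1) * w 1 (a + 1) + w (-1) (a + 1) := fun a => by
    have e1 := reducedLax_even_odd w a 0
    have e2 := reducedLax_odd_even w a 0
    simp at e1 e2
    rw [hp.sq_apply_succ hM, reducedLax_odd_succ, reducedLax_even_succ, e1, e2, mul_one]
  have hDe : ∀ a, (reducedLax w ⬝∞ reducedLax w) (2 * a) (2 * a) =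
      w (-1) (a + 1) + w 0 a * w 1 a := fun a => by
    have e2 := reducedLax_odd_even w a 0
    simp at e2
    rcases a with _ | a
    · have e3 := reducedLax_even_succ w 0
      simp at e2 e3
      rw [hp.sq_apply_zero hM, h0, e2, e3]; ring
    · have e1 := reducedLax_even_odd w a 0
      simp at e1
      have e3 := reducedLax_even_succ w (a + 1)
      rw [show 2 * (a + 1) = 2 * a + 1 + 1 by ring] at e2 e3 ⊢
      rw [hp.sq_apply_succ hM, e3, e2, e1, reducedLax_odd_succ]; ring
  generalize reducedLax w ⬝∞ reducedLax w = Q at *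
  ext i j
  rw [projT_apply, J_semiMul_J_apply, J_semiMul_J_apply]
  simp only [Matrix.transpose_apply, blockUpper, blockDiag, Matrix.of_apply, Matrix.sub_apply,
    flowMatrix]
  obtain ⟨a, rfl | rfl⟩ := i.even_or_odd' <;> obtain ⟨b, rfl | rfl⟩ := j.even_or_odd'
  · have q1 : (2 * a + 1) / 2 = a := by omega
    have q2 : (2 * b + 1) / 2 = b := by omega
    have q3 : 2 * a / 2 = a := by omega
    have q4 : 2 * b / 2 = b := by omega
    simp only [q1, q2, q3, q4, even_two_mul, if_true]
    rcases lt_trichotomy a b with h | h | h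
    · rcases Nat.lt_or_ge (a + 1) b with h' | h'
      · rw [if_neg (by omega), if_neg (by omega), if_neg (by omega), if_neg (by omega),
          if_neg (by omega), if_neg (by omega), if_neg (by omega), hB _ _ (by omega)]
        simp
      · obtain rfl : b = a + 1 := by omega
        rw [if_neg (by omega), if_neg (by omega), if_neg (by omega), if_neg (by omega),
          if_pos (by omega), mul_add, mul_one, hE]
        simp
    · subst h
      simp [hDe, hDo]
      rw [show (-1 : ℝ) ^ (2 * a + 1) = -1 by simp [pow_succ]]
      ring
    · rcases Nat.lt_or_ge (b + 1) a with h' | h'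
      · rw [if_pos (by omega), if_pos (by omega), if_neg (by omega), if_neg (by omega),
          if_neg (by omega), if_neg (by omega), if_neg (by omega), hB (2 * b + 1) _ (by omega)]
        simp
      · obtain rfl : a = b + 1 := by omega
        rw [if_pos (by omega), if_pos (by omega), if_neg (by omega), if_neg (by omega),
          if_neg (by omega), if_pos (by omega), show 2 * (b + 1) + 1 = 2 * b + 3 by ring, hO]
        simp
  · have q1 : (2 * a + 1) / 2 = a := by omega
    have q2 : (2 * b + 1) / 2 = b := by omega
    have q3 : 2 * a / 2 = a := by omega
    have q4 : 2 * b / 2 = b := by omega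
    rw [if_neg (show ¬ (2 * b + 1 = 2 * a + 2) by omega),
      if_neg (show ¬ (2 * a = 2 * b + 1 + 2) by omega),
      if_neg (show ¬ (2 * a = 2 * b + 1) by omega)]
    simp [hodd (2 * a) (2 * b + 1) (by grind), hodd (2 * b) (2 * a + 1) (by grind)]
  · have q1 : (2 * a + 1) / 2 = a := by omega
    have q2 : (2 * b + 1) / 2 = b := by omega
    have q3 : 2 * a / 2 = a := by omega
    have q4 : 2 * b / 2 = b := by omega
    rw [if_neg (show ¬ (2 * b = 2 * a + 1 + 2) by omega),
      if_neg (show ¬ (2 * a + 1 = 2 * b + 2) by omega),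
      if_neg (show ¬ (2 * a + 1 = 2 * b) by omega)]
    simp [hodd (2 * a + 1) (2 * b) (by grind), hodd (2 * b + 1) (2 * a) (by grind)]
  · have q1 : (2 * a + 1) / 2 = a := by omega
    have q2 : (2 * b + 1) / 2 = b := by omega
    have q3 : 2 * a / 2 = a := by omega
    have q4 : 2 * b / 2 = b := by omega
    have q5 : ∀ c : ℕ, ¬ Even (2 * c + 1) := fun c => by grind
    simp only [q1, q2, q3, q4, q5, if_false, Nat.add_sub_cancel]
    rcases lt_trichotomy a b with h | h | h
    · rcases Nat.lt_or_ge (a + 1) b with h' | h'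
      · rw [if_neg (by omega), if_neg (by omega), if_neg (by omega), if_neg (by omega),
          if_neg (by omega), if_neg (by omega), if_neg (by omega), hB _ _ (by omega)]
        simp
      · obtain rfl : b = a + 1 := by omega
        rw [if_neg (by omega), if_neg (by omega), if_neg (by omega), if_neg (by omega),
          if_pos (by omega), show 2 * (a + 1) + 1 = 2 * a + 3 by ring, hO]
        simp
    · subst h
      simp [hDe, hDo]
      rw [show (-1 : ℝ) ^ (2 * a + 1 + 1) = 1 by simp [pow_succ]]
      ring
    · rcases Nat.lt_or_ge (b + 1) a with h' | h'
      · rw [if_pos (by omega), if_pos (by omega), if_neg (by omega), if_neg (by omega),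
          if_neg (by omega), if_neg (by omega), if_neg (by omega), hB (2 * b) _ (by omega)]
        simp
      · obtain rfl : a = b + 1 := by omega
        rw [if_pos (by omega), if_pos (by omega), if_neg (by omega), if_neg (by omega),
          if_neg (by omega), if_pos (by omega), show 2 * (b + 1) = 2 * b + 2 by ring, hE]
        simp

/-- The square of `L` commutes with `L`, so only the correction `X` contributes. -/
theorem comm_neg_sub_sq {L X : Matrix ℕ ℕ ℝ} (hL : Band 1 L) (hX : Band 2 X) :
    comm (-(L ⬝∞ L - X)) L = X ⬝∞ L - L ⬝∞ X := by
  have hLL : Band 2 (L ⬝∞ L) := hL.semiMul hL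
  rw [comm, neg_semiMul, semiMul_neg, sub_semiMul hLL hX, semiMul_sub_of_band hL,
    semiMul_assoc_left hL hL]
  abel

/-- For i < 2 the truncated `i - 2` names a meaningless row; its coefficient is then `w 0 0 = 0`, so
one formula covers the boundary. The same device works for columns below. -/
theorem flowMatrix_semiMul_apply (w : ℤ → ℕ → ℝ) (h0 : w 0 0 = 0) (L : Matrix ℕ ℕ ℝ) (i j : ℕ) :
    (flowMatrix w ⬝∞ L) i j = flowMatrix w i i * L i j + w 0 (i / 2 + 1) * L (i + 2) j
      - w 0 (i / 2) * L (i - 2) j := by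
  have hzero : ∀ p, p ≠ i → p ≠ i + 2 → i ≠ p + 2 → flowMatrix w i p = 0 := fun p h1 h2 h3 => by
    simp only [flowMatrix, Matrix.of_apply]
    rw [if_neg h2, if_neg h3, if_neg (Ne.symm h1)]
  have h2 : flowMatrix w i (i + 2) = w 0 (i / 2 + 1) := by simp [flowMatrix]
  rw [(band_flowMatrix w).semiMul_apply L (N := i + 3) (by omega)]
  rw [Finset.sum_range_succ, Finset.sum_range_succ, Finset.sum_range_succ, h2,
    hzero (i + 1) (by omega) (by omega) (by omega)]
  rcases Nat.lt_or_ge i 2 with hi | hi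
  · rw [Finset.sum_eq_zero, show i / 2 = 0 by omega, h0]
    · ring
    · intro p hp
      simp at hp
      rw [hzero p (by omega) (by omega) (by omega), zero_mul]
  · obtain ⟨i, rfl⟩ := Nat.exists_eq_add_of_le' hi
    rw [Finset.sum_eq_single i]
    · have h3 : flowMatrix w (i + 2) i = -w 0 (i / 2 + 1) := by
        simp only [flowMatrix, Matrix.of_apply]
        rw [if_neg (by omega), if_pos trivial]
      rw [h3, show (i + 2) / 2 = i / 2 + 1 by omega]
      simp; ring
    · intro p hp hne
      simp at hp
      rw [hzero p (by omega) (by omega) (by omega), zero_mul]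
    · intro h; simp at h

theorem semiMul_flowMatrix_apply (w : ℤ → ℕ → ℝ) (h0 : w 0 0 = 0) (L : Matrix ℕ ℕ ℝ) (i j : ℕ) :
    (L ⬝∞ flowMatrix w) i j = L i j * flowMatrix w j j - L i (j + 2) * w 0 (j / 2 + 1)
      + L i (j - 2) * w 0 (j / 2) := by
  have hzero : ∀ p, p ≠ j → p ≠ j + 2 → j ≠ p + 2 → flowMatrix w p j = 0 := fun p h1 h2 h3 => by
    simp only [flowMatrix, Matrix.of_apply]
    rw [if_neg h3, if_neg h2, if_neg h1]
  have h2 : flowMatrix w (j + 2) j = -w 0 (j / 2 + 1) := by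
    simp only [flowMatrix, Matrix.of_apply]
    rw [if_neg (by omega), if_pos trivial]
  rw [semiMul_apply_of_le (N := j + 3) (fun p hp => by
    rw [hzero p (by omega) (by omega) (by omega), mul_zero])]
  rw [Finset.sum_range_succ, Finset.sum_range_succ, Finset.sum_range_succ, h2,
    hzero (j + 1) (by omega) (by omega) (by omega)]
  rcases Nat.lt_or_ge j 2 with hj | hj
  · rw [Finset.sum_eq_zero, show j / 2 = 0 by omega, h0]
    · ring
    · intro p hp
      simp at hp
      rw [hzero p (by omega) (by omega) (by omega), mul_zero]
  · obtain ⟨j, rfl⟩ := Nat.exists_eq_add_of_le' hj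
    rw [Finset.sum_eq_single j]
    · have h3 : flowMatrix w j (j + 2) = w 0 (j / 2 + 1) := by simp [flowMatrix]
      rw [h3, show (j + 2) / 2 = j / 2 + 1 by omega]
      simp; ring
    · intro p hp hne
      simp at hp
      rw [hzero p (by omega) (by omega) (by omega), mul_zero]
    · intro h; simp at h

/-- The right hand side of the Lax equation for a matrix of the reduced form. -/
noncomputable def laxRHS (w : ℤ → ℕ → ℝ) : Matrix ℕ ℕ ℝ :=
  comm (-projT (reducedLax w ⬝∞ reducedLax w)) (reducedLax w)

theorem laxRHS_apply (w : ℤ → ℕ → ℝ) (h0 : w 0 0 = 0) (i j : ℕ) :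
    laxRHS w i j = (flowMatrix w i i - flowMatrix w j j) * reducedLax w i j
      + w 0 (i / 2 + 1) * reducedLax w (i + 2) j - w 0 (i / 2) * reducedLax w (i - 2) j
      + w 0 (j / 2 + 1) * reducedLax w i (j + 2) - w 0 (j / 2) * reducedLax w i (j - 2) := by
  rw [laxRHS, projT_sq_reducedLax w h0, comm_neg_sub_sq (band_reducedLax w) (band_flowMatrix w),
    Matrix.sub_apply, flowMatrix_semiMul_apply w h0, semiMul_flowMatrix_apply w h0]
  ring

theorem flowMatrix_even (w : ℤ → ℕ → ℝ) (a : ℕ) : flowMatrix w (2 * a) (2 * a) =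
    -((w 0 (a + 1) * w 1 (a + 1) - w 0 a * w 1 a) / 2) := by
  simp only [flowMatrix, Matrix.of_apply]
  rw [if_neg (by omega), if_neg (by omega), if_pos trivial, show 2 * a / 2 = a by omega,
    Odd.neg_one_pow (by grind)]
  ring

theorem flowMatrix_odd (w : ℤ → ℕ → ℝ) (a : ℕ) : flowMatrix w (2 * a + 1) (2 * a + 1) =
    (w 0 (a + 1) * w 1 (a + 1) - w 0 a * w 1 a) / 2 := by
  simp only [flowMatrix, Matrix.of_apply]
  rw [if_neg (by omega), if_neg (by omega), if_pos trivial, show (2 * a + 1) / 2 = a by omega,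
    Even.neg_one_pow (by grind)]
  ring

/-! ### The right hand side of the Lax equation, entry by entry -/

section Entries

variable (w : ℤ → ℕ → ℝ) (h0 : w 0 0 = 0)
include h0

theorem laxRHS_parity {i j : ℕ} (hij : Even (i + j)) : laxRHS w i j = 0 := by
  have hp := oddParity_reducedLax w
  rw [laxRHS_apply w h0, hp i j hij, hp (i + 2) j (by grind), hp i (j + 2) (by grind)]
  rcases Nat.lt_or_ge i 2 with hi | hi <;> rcases Nat.lt_or_ge j 2 with hj | hj
  · rw [show i / 2 = 0 by omega, show j / 2 = 0 by omega, h0]; ring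
  · rw [show i / 2 = 0 by omega, h0, hp i (j - 2) (by grind)]; ring
  · rw [show j / 2 = 0 by omega, h0, hp (i - 2) j (by grind)]; ring
  · rw [hp (i - 2) j (by grind), hp i (j - 2) (by grind)]; ring

/-- The commutator could reach the third superdiagonal, but there its two terms are the same product
of superdiagonal entries and cancel. Together with parity and the next lemma this shows that the
flow is tangent to the reduced form. -/
theorem laxRHS_band : Band 1 (laxRHS w) := by
  intro i j hij
  rcases Nat.even_or_odd (i + j) with h | h
  · exact laxRHS_parity w h0 h
  have hB := band_reducedLax w
  rw [laxRHS_apply w h0, hB i j hij, hB i (j + 2) (by omega), hB (i - 2) j (by omega)]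
  rcases Nat.lt_or_ge (i + 3) j with h3 | h3
  · rw [hB (i + 2) j (by omega), hB i (j - 2) (by omega)]; ring
  obtain rfl : j = i + 3 := by grind
  obtain ⟨a, rfl | rfl⟩ := i.even_or_odd'
  · rw [show 2 * a + 2 = 2 * (a + 1) by ring, show 2 * a + 3 - 2 = 2 * a + 1 by omega,
      show 2 * a + 3 = 2 * (a + 1) + 1 by ring, reducedLax_even_succ, reducedLax_even_succ,
      show 2 * a / 2 = a by omega, show (2 * (a + 1) + 1) / 2 = a + 1 by omega]
    ring
  · rw [show 2 * a + 1 + 2 = 2 * (a + 1) + 1 by ring,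
      show 2 * a + 1 + 3 - 2 = 2 * a + 2 by omega,
      show 2 * a + 1 + 3 = 2 * (a + 1) + 2 by ring, reducedLax_odd_succ, reducedLax_odd_succ,
      show (2 * a + 1) / 2 = a by omega, show (2 * (a + 1) + 2) / 2 = a + 2 by omega]
    ring

/-- The diagonal of the flow matrix was halved so that its difference across a block cancels the two
products `w 0 * w 1` from the neighbours; this keeps the entries 1 constant. -/
theorem laxRHS_even_succ (a : ℕ) : laxRHS w (2 * a) (2 * a + 1) = 0 := by
  have e1 := reducedLax_even_odd w a 0
  simp at e1
  rw [laxRHS_apply w h0, flowMatrix_even, flowMatrix_odd, reducedLax_even_succ, e1,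
    band_reducedLax w (2 * a) (2 * a + 1 + 2) (by omega),
    show 2 * a / 2 = a by omega, show (2 * a + 1) / 2 = a by omega]
  rcases a with _ | a
  · rw [h0]; ring
  · have e2 := reducedLax_even_odd w a 0
    simp at e2
    rw [band_reducedLax w (2 * (a + 1) - 2) (2 * (a + 1) + 1) (by omega),
      show 2 * (a + 1) + 1 - 2 = 2 * a + 1 by omega, show 2 * (a + 1) = 2 * a + 2 by ring, e2]
    ring

theorem laxRHS_odd_succ (a : ℕ) : laxRHS w (2 * a + 1) (2 * a + 2) =
    w 0 (a + 1) / 2 * (w 0 (a + 2) * w 1 (a + 2) - w 0 a * w 1 a)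
        + w 0 (a + 1) * (w (-1) (a + 2) - w (-1) (a + 1)) := by
  have e1 := reducedLax_odd_even w (a + 1) 0
  have e2 := reducedLax_odd_even w a 0
  have e3 := flowMatrix_even w (a + 1)
  simp only [add_zero, zero_add, Nat.cast_one] at e1 e2
  rw [show 2 * (a + 1) = 2 * a + 2 by ring] at e1 e3
  rw [laxRHS_apply w h0, flowMatrix_odd, e3, reducedLax_odd_succ,
    show 2 * a + 1 + 2 = 2 * a + 2 + 1 by ring, e1, show 2 * a + 2 - 2 = 2 * a by omega, e2,
    band_reducedLax w (2 * a + 1) (2 * a + 2 + 2) (by omega),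
    band_reducedLax w (2 * a + 1 - 2) (2 * a + 2) (by omega), show (2 * a + 1) / 2 = a by omega,
    show (2 * a + 2) / 2 = a + 1 by omega]
  ring

theorem laxRHS_diag_neg (b : ℕ) : laxRHS w (2 * b + 1) (2 * b) =
    w (-1) (b + 1) * (w 0 (b + 1) * w 1 (b + 1) - w 0 b * w 1 b)
      + w 0 (b + 1) * (w 0 (b + 1) + w (-2) (b + 1)) - w 0 b * (w 0 b + w (-2) b) := by
  have e1 := reducedLax_odd_even w b 0
  have e2 := reducedLax_odd_even w b 1
  simp only [add_zero, zero_add, Nat.cast_one] at e1 e2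
  rw [laxRHS_apply w h0, flowMatrix_odd, flowMatrix_even, e1,
    show 2 * b + 1 + 2 = 2 * (b + 1) + 1 by ring, e2, reducedLax_odd_succ,
    show (2 * b + 1) / 2 = b by omega, show 2 * b / 2 = b by omega]
  rcases b with _ | b
  · rw [h0]; norm_num; ring_nf
  · have e3 := reducedLax_odd_even w b 1
    rw [show 2 * (b + 1) + 1 - 2 = 2 * b + 1 by omega,
      show 2 * (b + 1) - 2 = 2 * b by omega, e3, show 2 * (b + 1) = 2 * b + 2 by ring,
      reducedLax_odd_succ]
    norm_num; ring_nf

theorem laxRHS_neg (b d : ℕ) : laxRHS w (2 * (b + (d + 1)) + 1) (2 * b) =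
    w (-(d + 2 : ℕ)) (b + 1) / 2 *
        (w 0 (b + 1) * w 1 (b + 1) - w 0 b * w 1 b + w 0 (b + d + 2) * w 1 (b + d + 2)
          - w 0 (b + d + 1) * w 1 (b + d + 1))
      + w (-(d + 1 : ℕ)) (b + 2) * w 0 (b + 1) - w (-(d + 1 : ℕ)) (b + 1) * w 0 (b + d + 1)
      + w (-(d + 3 : ℕ)) (b + 1) * w 0 (b + d + 2) - w (-(d + 3 : ℕ)) b * w 0 b := by
  have e1 := reducedLax_odd_even w b (d + 1)
  have e2 := reducedLax_odd_even w b (d + 2)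
  have e3 := reducedLax_odd_even w (b + 1) d
  have e4 := reducedLax_odd_even w b d
  rw [show b + 1 + d = b + (d + 1) by ring, show 2 * (b + 1) = 2 * b + 2 by ring] at e3
  rw [laxRHS_apply w h0, flowMatrix_odd, flowMatrix_even, e1,
    show 2 * (b + (d + 1)) + 1 + 2 = 2 * (b + (d + 2)) + 1 by ring, e2, e3,
    show 2 * (b + (d + 1)) + 1 - 2 = 2 * (b + d) + 1 by omega, e4,
    show (2 * (b + (d + 1)) + 1) / 2 = b + d + 1 by omega, show 2 * b / 2 = b by omega]
  rcases b with _ | b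
  · rw [h0]
    simp only [show 0 + d + 1 + 1 = 0 + d + 2 by ring, show d + 1 + 1 = d + 2 by ring,
      show d + 2 + 1 = d + 3 by ring]
    ring_nf
  · have e5 := reducedLax_odd_even w b (d + 2)
    rw [show 2 * (b + 1) - 2 = 2 * b by omega, show b + 1 + (d + 1) = b + (d + 2) by ring, e5]
    simp only [show b + 1 + d + 1 + 1 = b + 1 + d + 2 by ring,
      show b + (d + 2) = b + 1 + d + 1 by ring]
    ring

theorem laxRHS_one (b : ℕ) : laxRHS w (2 * b + 2) (2 * b + 1) =
    w 1 (b + 1) / 2 * (w 0 b * w 1 b - w 0 (b + 2) * w 1 (b + 2))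
      + w 0 (b + 2) * w 2 (b + 1) - w 0 b * w 2 b := by
  have e1 := reducedLax_even_odd w b 0
  have e2 := reducedLax_even_odd w b 1
  have e3 := reducedLax_even_succ w (b + 1)
  have e4 := flowMatrix_even w (b + 1)
  simp only [add_zero, zero_add, Nat.cast_one] at e1 e2
  rw [show 2 * (b + 1) + 1 = 2 * b + 1 + 2 by ring] at e3
  rw [show 2 * (b + 1) = 2 * b + 2 by ring] at e2 e3 e4
  rw [laxRHS_apply w h0, flowMatrix_odd, e4, e1, e2, e3,
    show 2 * b + 2 - 2 = 2 * b by omega, reducedLax_even_succ,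
    show (2 * b + 1) / 2 = b by omega, show (2 * b + 2) / 2 = b + 1 by omega]
  rcases b with _ | b
  · rw [h0]; norm_num; ring_nf
  · have e5 := reducedLax_even_odd w b 1
    rw [show 2 * (b + 1) + 1 - 2 = 2 * b + 1 by omega, e5]
    norm_num; ring_nf

theorem laxRHS_pos (b d : ℕ) : laxRHS w (2 * (b + (d + 1)) + 2) (2 * b + 1) =
    w (d + 2 : ℕ) (b + 1) / 2 *
        (w 0 b * w 1 b - w 0 (b + 1) * w 1 (b + 1) + w 0 (b + d + 2) * w 1 (b + d + 2)
          - w 0 (b + d + 3) * w 1 (b + d + 3))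
      + w (d + 3 : ℕ) (b + 1) * w 0 (b + d + 3) - w (d + 3 : ℕ) b * w 0 b
      + w (d + 1 : ℕ) (b + 2) * w 0 (b + 1) - w (d + 1 : ℕ) (b + 1) * w 0 (b + d + 2) := by
  have e1 := reducedLax_even_odd w b (d + 1)
  have e2 := reducedLax_even_odd w b (d + 2)
  have e3 := reducedLax_even_odd w (b + 1) d
  have e4 := reducedLax_even_odd w b d
  have e6 := flowMatrix_even w (b + (d + 1) + 1)
  rw [show b + 1 + d = b + (d + 1) by ring, show 2 * (b + 1) + 1 = 2 * b + 1 + 2 by ring] at e3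
  rw [show 2 * (b + (d + 1) + 1) = 2 * (b + (d + 1)) + 2 by ring] at e6
  rw [laxRHS_apply w h0, flowMatrix_odd, e6, e1,
    show 2 * (b + (d + 1)) + 2 + 2 = 2 * (b + (d + 2)) + 2 by ring, e2, e3,
    show 2 * (b + (d + 1)) + 2 - 2 = 2 * (b + d) + 2 by omega, e4,
    show (2 * (b + (d + 1)) + 2) / 2 = b + d + 2 by omega, show (2 * b + 1) / 2 = b by omega]
  rcases b with _ | b
  · rw [h0]
    simp only [show 0 + (d + 1) + 1 = 0 + d + 2 by ring, show 0 + d + 2 + 1 = 0 + d + 3 by ring,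
      show d + 1 + 1 = d + 2 by ring, show d + 2 + 1 = d + 3 by ring]
    ring
  · have e5 := reducedLax_even_odd w b (d + 2)
    rw [show 2 * (b + 1) + 1 - 2 = 2 * b + 1 by omega, show b + 1 + (d + 1) = b + (d + 2) by ring,
      e5]
    simp only [show b + (d + 2) + 1 = b + 1 + d + 2 by ring,
      show b + 1 + d + 2 + 1 = b + 1 + d + 3 by ring]
    ring

end Entries

/-- At the frozen entries 0 and 1 both sides vanish identically. The remaining positions correspond
one to one to the variables of the chain, with the right hand sides computed above. -/
theorem solvesLaxAt_reducedLax_iff (w : ℝ → ℤ → ℕ → ℝ) (s : ℝ) (h0 : w s 0 0 = 0) :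
    SolvesLaxAt (fun r => reducedLax (w r)) s ↔ SolvesChainAt w s := by
  have hL : SolvesLaxAt (fun r => reducedLax (w r)) s ↔
      ∀ i j, HasDerivAt (fun r => reducedLax (w r) i j) (laxRHS (w s) i j) s := Iff.rfl
  rw [hL]
  have c1 : ∀ d : ℕ, -((d + 2 : ℕ) : ℤ) + 1 = -((d + 1 : ℕ) : ℤ) := fun d => by push_cast; ring
  have c2 : ∀ d : ℕ, -((d + 2 : ℕ) : ℤ) - 1 = -((d + 3 : ℕ) : ℤ) := fun d => by push_cast; ring
  have c3 : ∀ d : ℕ, ((d + 2 : ℕ) : ℤ) + 1 = ((d + 3 : ℕ) : ℤ) := fun d => by push_cast; ring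
  have c4 : ∀ d : ℕ, ((d + 2 : ℕ) : ℤ) - 1 = ((d + 1 : ℕ) : ℤ) := fun d => by push_cast; ring
  constructor
  · intro h
    refine ⟨?_, ?_, ?_, ?_, ?_⟩
    · intro k n hk hn
      obtain ⟨d, rfl⟩ := Nat.exists_eq_add_of_le' hk
      obtain ⟨b, rfl⟩ := Nat.exists_eq_add_of_le' hn
      have := h (2 * (b + (d + 1)) + 1) (2 * b)
      simp only [reducedLax_odd_even, laxRHS_neg _ h0] at this
      rw [c1, c2, show b + 1 + (d + 2) - 1 = b + d + 2 by omega,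
        show b + 1 + (d + 2) - 2 = b + d + 1 by omega, Nat.add_sub_cancel]
      exact this
    · intro n hn
      obtain ⟨b, rfl⟩ := Nat.exists_eq_add_of_le' hn
      have := h (2 * (b + 0) + 1) (2 * b)
      simp only [reducedLax_odd_even] at this
      simp only [add_zero, laxRHS_diag_neg _ h0] at this
      rw [Nat.add_sub_cancel]
      exact this
    · intro n hn
      obtain ⟨b, rfl⟩ := Nat.exists_eq_add_of_le' hn
      have := h (2 * b + 1) (2 * b + 2)
      simp only [reducedLax_odd_succ, laxRHS_odd_succ _ h0] at this
      rw [Nat.add_sub_cancel]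
      exact this
    · intro n hn
      obtain ⟨b, rfl⟩ := Nat.exists_eq_add_of_le' hn
      have := h (2 * (b + 0) + 2) (2 * b + 1)
      simp only [reducedLax_even_odd] at this
      simp only [add_zero, laxRHS_one _ h0] at this
      rw [Nat.add_sub_cancel]
      exact this
    · intro k n hk hn
      obtain ⟨d, rfl⟩ := Nat.exists_eq_add_of_le' hk
      obtain ⟨b, rfl⟩ := Nat.exists_eq_add_of_le' hn
      have := h (2 * (b + (d + 1)) + 2) (2 * b + 1)
      simp only [reducedLax_even_odd, laxRHS_pos _ h0] at this
      rw [c3, c4, show b + 1 + (d + 2) - 1 = b + d + 2 by omega,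
        show b + 1 + (d + 2) = b + d + 3 by omega, Nat.add_sub_cancel]
      exact this
  · intro h i j
    rcases Nat.even_or_odd (i + j) with hij | hij
    · rw [laxRHS_parity _ h0 hij]
      simp only [oddParity_reducedLax _ i j hij]
      exact hasDerivAt_const _ _
    rcases Nat.lt_or_ge (i + 1) j with hlt | hge
    · rw [laxRHS_band _ h0 i j hlt]
      simp only [band_reducedLax _ i j hlt]
      exact hasDerivAt_const _ _
    obtain ⟨a, rfl | rfl⟩ := i.even_or_odd' <;> obtain ⟨b, rfl | rfl⟩ := j.even_or_odd'
    · exact absurd hij (by grind)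
    · rcases Nat.lt_or_ge b a with hba | hba
      · obtain ⟨d, rfl⟩ := Nat.exists_eq_add_of_lt hba
        rw [show 2 * (b + d + 1) = 2 * (b + d) + 2 by ring]
        simp only [reducedLax_even_odd]
        rcases d with _ | d
        · simp only [add_zero, laxRHS_one _ h0]
          exact h.one (b + 1) (by omega)
        · have := h.pos (d + 2) (b + 1) (by omega) (by omega)
          rw [c3, c4, show b + 1 + (d + 2) - 1 = b + d + 2 by omega,
            show b + 1 + (d + 2) = b + d + 3 by omega, Nat.add_sub_cancel] at this
          simp only [laxRHS_pos _ h0]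
          exact this
      · obtain rfl : a = b := by omega
        rw [laxRHS_even_succ _ h0]
        simp only [reducedLax_even_succ]
        exact hasDerivAt_const _ _
    · rcases Nat.lt_or_ge a b with hba | hba
      · obtain rfl : b = a + 1 := by omega
        rw [show 2 * (a + 1) = 2 * a + 2 by ring]
        simp only [reducedLax_odd_succ, laxRHS_odd_succ _ h0]
        exact h.zero (a + 1) (by omega)
      · obtain ⟨d, rfl⟩ := Nat.exists_eq_add_of_le hba
        simp only [reducedLax_odd_even]
        rcases d with _ | d
        · simp only [add_zero, laxRHS_diag_neg _ h0]
          exact h.neg_one (b + 1) (by omega)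
        · have := h.neg (d + 2) (b + 1) (by omega) (by omega)
          rw [c1, c2, show b + 1 + (d + 2) - 1 = b + d + 2 by omega,
            show b + 1 + (d + 2) - 2 = b + d + 1 by omega, Nat.add_sub_cancel] at this
          simp only [laxRHS_neg _ h0]
          exact this
    · exact absurd hij (by grind)

/-! ### Uniqueness of the Pfaff factor -/

/-- Lower triangular matrices whose `2 × 2` diagonal blocks are positive multiples of `1`. -/
structure PfaffShape (S : Matrix ℕ ℕ ℝ) : Prop where
  lower : ∀ i j, i < j → S i j = 0
  block_off : ∀ n, S (2 * n + 1) (2 * n) = 0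
  block_diag : ∀ n, S (2 * n + 1) (2 * n + 1) = S (2 * n) (2 * n)
  pos : ∀ n, 0 < S (2 * n) (2 * n)

theorem Band.semiMul_apply_self {A B : Matrix ℕ ℕ ℝ} (hA : Band 0 A) (hB : Band 0 B) (i : ℕ) :
    (A ⬝∞ B) i i = A i i * B i i := by
  rw [hA.semiMul_apply B (N := i + 1) (by omega), Finset.sum_range_succ, Finset.sum_eq_zero,
    zero_add]
  intro p hp
  rw [hB p i (by simpa using hp), mul_zero]

theorem Band.semiMul_apply_succ_self {A B : Matrix ℕ ℕ ℝ} (hA : Band 0 A) (hB : Band 0 B) (i : ℕ) :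
    (A ⬝∞ B) (i + 1) i = A (i + 1) i * B i i + A (i + 1) (i + 1) * B (i + 1) i := by
  rw [hA.semiMul_apply B (N := i + 2) (by omega), Finset.sum_range_succ, Finset.sum_range_succ,
    Finset.sum_eq_zero, zero_add]
  intro p hp
  rw [hB p i (by simpa using hp), mul_zero]

namespace PfaffShape

variable {S T : Matrix ℕ ℕ ℝ}

theorem band (hS : PfaffShape S) : Band 0 S := fun i j h => hS.lower i j (by simpa using h)

theorem diag_pos (hS : PfaffShape S) (i : ℕ) : 0 < S i i := by
  obtain ⟨a, rfl | rfl⟩ := i.even_or_odd'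
  · exact hS.pos a
  · rw [hS.block_diag]; exact hS.pos a

theorem diag_ne_zero (hS : PfaffShape S) (i : ℕ) : S i i ≠ 0 := (hS.diag_pos i).ne'

theorem band_inv (hS : PfaffShape S) : Band 0 (triInv S) := band_triInv hS.band hS.diag_ne_zero

theorem mul_inv (hS : PfaffShape S) : S ⬝∞ triInv S = 1 := semiMul_triInv hS.band hS.diag_ne_zero

theorem inv_mul (hS : PfaffShape S) : triInv S ⬝∞ S = 1 := triInv_semiMul hS.band hS.diag_ne_zero

theorem inv_mul_cancel (hS : PfaffShape S) (A : Matrix ℕ ℕ ℝ) : triInv S ⬝∞ (S ⬝∞ A) = A := by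
  rw [← semiMul_assoc_left hS.band_inv hS.band, hS.inv_mul, one_semiMul]

theorem mul_inv_cancel (hS : PfaffShape S) (A : Matrix ℕ ℕ ℝ) : S ⬝∞ (triInv S ⬝∞ A) = A := by
  rw [← semiMul_assoc_left hS.band hS.band_inv, hS.mul_inv, one_semiMul]

theorem mul_mul_inv_cancel (hS : PfaffShape S) {b : ℕ} {A : Matrix ℕ ℕ ℝ} (hA : Band b A) :
    A ⬝∞ S ⬝∞ triInv S = A := by
  rw [semiMul_assoc_left hA hS.band, hS.mul_inv, semiMul_one]

theorem mul_inv_mul_cancel (hS : PfaffShape S) {b : ℕ} {A : Matrix ℕ ℕ ℝ} (hA : Band b A) :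
    A ⬝∞ triInv S ⬝∞ S = A := by
  rw [semiMul_assoc_left hA hS.band_inv, hS.inv_mul, semiMul_one]

theorem mul (hS : PfaffShape S) (hT : PfaffShape T) : PfaffShape (S ⬝∞ T) where
  lower i j h := (hS.band.semiMul hT.band) i j (by simpa using h)
  block_off n := by
    rw [hS.band.semiMul_apply_succ_self hT.band, hS.block_off, hT.block_off]; ring
  block_diag n := by
    rw [hS.band.semiMul_apply_self hT.band, hS.band.semiMul_apply_self hT.band, hS.block_diag,
      hT.block_diag]
  pos n := by
    rw [hS.band.semiMul_apply_self hT.band]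
    exact mul_pos (hS.pos n) (hT.pos n)

theorem inv_apply_self (hS : PfaffShape S) (i : ℕ) : triInv S i i = (S i i)⁻¹ := by
  have h := congrFun (congrFun hS.mul_inv i) i
  rw [hS.band.semiMul_apply_self hS.band_inv, Matrix.one_apply_eq] at h
  exact eq_inv_of_mul_eq_one_right h

theorem inv (hS : PfaffShape S) : PfaffShape (triInv S) where
  lower i j h := hS.band_inv i j (by simpa using h)
  block_off n := by
    have h := congrFun (congrFun hS.mul_inv (2 * n + 1)) (2 * n)
    rw [hS.band.semiMul_apply_succ_self hS.band_inv, hS.block_off, zero_mul, zero_add,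
      Matrix.one_apply_ne (by omega)] at h
    exact (mul_eq_zero.1 h).resolve_left (hS.diag_ne_zero _)
  block_diag n := by rw [hS.inv_apply_self, hS.inv_apply_self, hS.block_diag]
  pos n := by rw [hS.inv_apply_self]; exact inv_pos.2 (hS.pos n)

/-- The only matrix of this shape that preserves the skew form `J` is the identity. -/
theorem eq_one_of_preserves (hT : PfaffShape T) (h : T ⬝∞ J ⬝∞ T.transpose = J) : T = 1 := by
  have hU := hT.inv
  -- The left side is block lower triangular and the right side block upper triangular. On the
  -- diagonal it gives that each entry is its own inverse, hence 1 by positivity.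
  have hTJ : T ⬝∞ J = J ⬝∞ (triInv T).transpose := by
    have hb : Band 0 (triInv T) := hT.band_inv
    have h1 := congrArg (fun A => A ⬝∞ (triInv T).transpose) h
    rwa [semiMul_assoc_right _ (b := 0) (c := 0) (by simpa using hT.band) (by simpa using hb),
      ← transpose_semiMul, hT.inv_mul, Matrix.transpose_one, semiMul_one] at h1
  have he : ∀ i j, (T ⬝∞ J) i j = (J ⬝∞ (triInv T).transpose) i j := fun i j => by rw [hTJ]
  simp only [semiMul_J_apply, J_semiMul_apply, Matrix.transpose_apply] at he
  have ho : ∀ a, ¬ Even (2 * a + 1) := fun a => by grind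
  have hdiag : ∀ a, T (2 * a) (2 * a) = 1 := fun a => by
    have h1 := he (2 * a) (2 * a + 1)
    simp only [ho, if_false, even_two_mul, if_true, Nat.add_sub_cancel] at h1
    rw [hT.inv_apply_self, hT.block_diag] at h1
    have h2 : T (2 * a) (2 * a) * T (2 * a) (2 * a) = 1 := by
      nth_rewrite 2 [h1]; exact mul_inv_cancel₀ (hT.diag_ne_zero _)
    nlinarith [hT.pos a]
  ext i j
  rcases lt_trichotomy i j with hij | rfl | hij
  · rw [hT.lower i j hij, Matrix.one_apply_ne (by omega)]
  · rw [Matrix.one_apply_eq]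
    obtain ⟨a, rfl | rfl⟩ := i.even_or_odd'
    · exact hdiag a
    · rw [hT.block_diag, hdiag]
  · rw [Matrix.one_apply_ne (by omega)]
    obtain ⟨a, rfl | rfl⟩ := i.even_or_odd' <;> obtain ⟨b, rfl | rfl⟩ := j.even_or_odd'
    · have h1 := he (2 * a) (2 * b + 1)
      simp only [ho, if_false, even_two_mul, if_true, Nat.add_sub_cancel] at h1
      rw [h1, hU.lower _ _ (by omega)]
    · have h1 := he (2 * a) (2 * b)
      simp only [even_two_mul, if_true] at h1
      rw [hU.lower _ _ (by omega)] at h1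
      linarith
    · rcases Nat.lt_or_ge b a with hba | hba
      · have h1 := he (2 * a + 1) (2 * b + 1)
        simp only [ho, if_false, Nat.add_sub_cancel] at h1
        rw [h1, hU.lower _ _ (by omega), neg_zero]
      · obtain rfl : a = b := by omega
        exact hT.block_off a
    · have h1 := he (2 * a + 1) (2 * b)
      simp only [ho, if_false, even_two_mul, if_true, Nat.add_sub_cancel] at h1
      rw [hU.lower _ _ (by omega)] at h1
      linarith

end PfaffShape

variable {m S : Matrix ℕ ℕ ℝ}

theorem IsPfaffFactor.shape (h : IsPfaffFactor m S) : PfaffShape S :=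
  ⟨h.lower, h.block_off, h.block_diag, h.pos⟩

/-- The form S m Sᵀ = J contains no inverse, so it can be checked by pairing polynomials and can be
differentiated. The full matrix `m` stands between banded factors, which is where the middle
associativity law enters. -/
theorem IsPfaffFactor.conj_eq (h : IsPfaffFactor m S) : S ⬝∞ m ⬝∞ S.transpose = J := by
  have hS := h.shape
  have ht : Band 0 S.transpose.transpose := by simpa using hS.band
  have hti : Band 0 (triInv S).transpose.transpose := by simpa using hS.band_inv
  rw [h.factor, semiMul_assoc_mid hS.band _ ht, semiMul_assoc_right _ hti ht,
    ← transpose_semiMul, hS.mul_inv, Matrix.transpose_one, semiMul_one, hS.mul_inv_cancel]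

theorem PfaffShape.isPfaffFactor (hS : PfaffShape S) (h : S ⬝∞ m ⬝∞ S.transpose = J) :
    IsPfaffFactor m S where
  lower := hS.lower
  block_off := hS.block_off
  block_diag := hS.block_diag
  pos := hS.pos
  factor := by
    have ht : Band 0 S.transpose.transpose := by simpa using hS.band
    have hti : Band 0 (triInv S).transpose.transpose := by simpa using hS.band_inv
    rw [← h, semiMul_assoc_mid hS.band_inv _ hti, semiMul_assoc_right _ ht hti,
      ← transpose_semiMul, hS.inv_mul, Matrix.transpose_one, semiMul_one, hS.inv_mul_cancel]

/-- The quotient `S' ⬝∞ triInv S` has the Pfaff shape and preserves `J`, hence equals 1. -/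
theorem IsPfaffFactor.unique {S' : Matrix ℕ ℕ ℝ} (h : IsPfaffFactor m S)
    (h' : IsPfaffFactor m S') : S' = S := by
  have hS := h.shape
  have hS' := h'.shape
  have hT := hS'.mul hS.inv
  have ht : Band 0 S'.transpose.transpose := by simpa using hS'.band
  have hti : Band 0 (triInv S).transpose.transpose := by simpa using hS.band_inv
  have hone : S' ⬝∞ triInv S = 1 := by
    refine hT.eq_one_of_preserves ?_
    rw [transpose_semiMul, semiMul_assoc_left hS'.band hS.band_inv,
      ← semiMul_assoc_right _ hti ht, semiMul_assoc_left hS'.band (hS.band_inv.semiMul band_J),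
      ← h.factor]
    exact h'.conj_eq
  rw [← hS.mul_inv_mul_cancel hS'.band, hone, one_semiMul]

/-- Uniqueness makes the choice by `epsilon` harmless: any exhibited factor computes the Lax matrix,
the LDU factor for general couplings and the Hermite one at 0. -/
theorem IsPfaffFactor.pfaffFactor_eq (h : IsPfaffFactor m S) : pfaffFactor m = S :=
  h.unique (Classical.epsilon_spec ⟨S, h⟩)

/-! ### The weight and the skew product -/

section Weight

variable {t : ℕ+ → ℝ}

theorem weight_pos (t : ℕ+ → ℝ) (z : ℝ) : 0 < weight t z := Real.exp_pos _

theorem EvenCouplings.weight_neg (h : EvenCouplings t) (z : ℝ) : weight t (-z) = weight t z := by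
  unfold weight
  congr 2
  · ring
  · refine tsum_congr fun k => ?_
    rcases Nat.even_or_odd (k : ℕ) with hk | hk
    · rw [hk.neg_pow]
    · rw [h k hk]; ring

/-- Summability at the one point |x| + 1 is absolute and dominates the series on |z| ≤ |x| + 1, so
the Weierstrass test applies. -/
theorem Admissible.continuous_weight (h : Admissible t) : Continuous (weight t) := by
  unfold weight
  refine Real.continuous_exp.comp (Continuous.add (by fun_prop) ?_)
  rw [continuous_iff_continuousAt]
  intro x
  have hc : ContinuousOn (fun z : ℝ => ∑' k : ℕ+, t k * z ^ (k : ℕ))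
      (Set.Icc (-(|x| + 1)) (|x| + 1)) := by
    refine continuousOn_tsum (u := fun k : ℕ+ => |t k * (|x| + 1) ^ (k : ℕ)|)
      (fun k => by fun_prop) (h.1 (|x| + 1)).abs ?_
    intro k z hz
    rw [Real.norm_eq_abs, abs_mul, abs_mul, abs_pow, abs_pow]
    have h1 : |z| ≤ |x| + 1 := abs_le.2 hz
    have h2 : |z| ≤ |(|x| + 1)| := h1.trans (le_abs_self _)
    gcongr
  refine hc.continuousAt (Icc_mem_nhds ?_ ?_)
  · linarith [neg_abs_le x]
  · linarith [le_abs_self x]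

theorem Admissible.integrable_eval (h : Admissible t) (P : Polynomial ℝ) :
    Integrable fun z => P.eval z * weight t z := by
  simp only [Polynomial.eval_eq_sum_range, Finset.sum_mul, mul_assoc]
  exact integrable_finsetSum _ fun i _ => (h.2 i).const_mul _

theorem measurable_sign : Measurable Real.sign := by
  unfold Real.sign
  exact Measurable.ite measurableSet_Iio measurable_const
    (Measurable.ite measurableSet_Ioi measurable_const measurable_const)

theorem abs_sign_le (x : ℝ) : |Real.sign x| ≤ 1 := by
  rcases Real.sign_apply_eq x with h | h | h <;> simp [h]

theorem integrable_skew {f g : ℝ → ℝ} (hf : Integrable fun z => f z * weight t z)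
    (hg : Integrable fun z => g z * weight t z) :
    Integrable (fun p : ℝ × ℝ =>
      f p.1 * g p.2 * Real.sign (p.2 - p.1) * weight t p.1 * weight t p.2) := by
  have h1 := (hf.mul_prod hg).bdd_mul (c := 1)
    (f := fun p : ℝ × ℝ => Real.sign (p.2 - p.1))
    (measurable_sign.comp (by fun_prop)).aestronglyMeasurable
    (Eventually.of_forall fun p => abs_sign_le _)
  refine h1.congr (Eventually.of_forall fun p => ?_)
  simp only
  ring

theorem skewProd_swap (t : ℕ+ → ℝ) (f g : ℝ → ℝ) : skewProd t g f = -skewProd t f g := by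
  unfold skewProd
  rw [← mul_neg, ← integral_neg]
  congr 1
  rw [Measure.volume_eq_prod, ← integral_prod_swap]
  refine integral_congr_ae (Eventually.of_forall fun p => ?_)
  simp only [Prod.fst_swap, Prod.snd_swap]
  rw [show p.1 - p.2 = -(p.2 - p.1) by ring, Real.sign_neg]
  ring

/-- Under (x,y) ↦ (-x,-y) the sign factor changes sign and everything else is invariant. -/
theorem EvenCouplings.skewProd_eq_zero (h : EvenCouplings t) {f g : ℝ → ℝ}
    (hfg : ∀ x y, f (-x) * g (-y) = f x * g y) : skewProd t f g = 0 := by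
  have h1 : skewProd t f g = -skewProd t f g := by
    conv_lhs => unfold skewProd
    unfold skewProd
    rw [← mul_neg, ← integral_neg]
    congr 1
    rw [← integral_neg_eq_self]
    refine integral_congr_ae (Eventually.of_forall fun p => ?_)
    simp only [Prod.fst_neg, Prod.snd_neg, h.weight_neg, hfg]
    rw [show -p.2 - -p.1 = -(p.2 - p.1) by ring, Real.sign_neg]
    ring
  linarith

theorem skewMoments_parity (h : EvenCouplings t) {i j : ℕ} (hij : Even (i + j)) :
    skewMoments t i j = 0 := by
  simp only [skewMoments, Matrix.of_apply]
  refine h.skewProd_eq_zero fun x y => ?_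
  rcases Nat.even_or_odd i with hi | hi
  · have hj : Even j := by grind
    rw [hi.neg_pow, hj.neg_pow]
  · have hj : Odd j := by grind
    rw [hi.neg_pow, hj.neg_pow]; ring

theorem skewMoments_swap (t : ℕ+ → ℝ) (i j : ℕ) : skewMoments t j i = -skewMoments t i j :=
  skewProd_swap t _ _

theorem Admissible.skewProd_eval (h : Admissible t) (P Q : Polynomial ℝ) {m n : ℕ}
    (hm : P.natDegree < m) (hn : Q.natDegree < n) :
    skewProd t (fun x => P.eval x) (fun y => Q.eval y) =
      ∑ i ∈ Finset.range m, ∑ j ∈ Finset.range n, P.coeff i * skewMoments t i j * Q.coeff j := by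
  have hmon : ∀ i j : ℕ, Integrable (fun p : ℝ × ℝ =>
      p.1 ^ i * p.2 ^ j * Real.sign (p.2 - p.1) * weight t p.1 * weight t p.2) := fun i j =>
    integrable_skew (h.2 i) (h.2 j)
  have e : ∀ p : ℝ × ℝ, P.eval p.1 * Q.eval p.2 * Real.sign (p.2 - p.1) * weight t p.1 *
      weight t p.2 = ∑ i ∈ Finset.range m, ∑ j ∈ Finset.range n, P.coeff i * Q.coeff j *
        (p.1 ^ i * p.2 ^ j * Real.sign (p.2 - p.1) * weight t p.1 * weight t p.2) := fun p => by
    rw [Polynomial.eval_eq_sum_range' hm, Polynomial.eval_eq_sum_range' hn, Finset.sum_mul_sum]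
    simp only [Finset.sum_mul]
    refine Finset.sum_congr rfl fun i _ => Finset.sum_congr rfl fun j _ => by ring
  simp only [skewProd, e]
  rw [integral_finsetSum _ fun i _ => integrable_finsetSum _ fun j _ => (hmon i j).const_mul _,
    Finset.mul_sum]
  refine Finset.sum_congr rfl fun i _ => ?_
  rw [integral_finsetSum _ fun j _ => (hmon i j).const_mul _, Finset.mul_sum]
  refine Finset.sum_congr rfl fun j _ => ?_
  rw [integral_const_mul]
  simp only [skewMoments, Matrix.of_apply, skewProd]
  ring

/-- The integral is the mass of `k` left of `y` minus the mass right of it; by evenness the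
half-line masses cancel. -/
theorem integral_mul_sign_sub {k : ℝ → ℝ} (hk : Integrable k) (heven : ∀ x, k (-x) = k x) (y : ℝ) :
    ∫ x, k x * Real.sign (y - x) = 2 * ∫ x in (0 : ℝ)..y, k x := by
  have hks : Integrable fun x => k x * Real.sign (y - x) :=
    hk.mul_bdd (c := 1) (measurable_sign.comp (by fun_prop)).aestronglyMeasurable
      (Eventually.of_forall fun x => abs_sign_le _)
  rw [← integral_add_compl measurableSet_Iic hks (s := Set.Iic y), Set.compl_Iic]
  have h1 : ∫ x in Set.Iic y, k x * Real.sign (y - x) = ∫ x in Set.Iic y, k x := by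
    -- The sign is 0 at x = y, so this null point is removed first.
    rw [integral_Iic_eq_integral_Iio, integral_Iic_eq_integral_Iio]
    refine setIntegral_congr_fun measurableSet_Iio fun x hx => ?_
    rw [Real.sign_of_pos (sub_pos.2 hx), mul_one]
  have h2 : ∫ x in Set.Ioi y, k x * Real.sign (y - x) = -∫ x in Set.Ioi y, k x := by
    rw [← integral_neg]
    refine setIntegral_congr_fun measurableSet_Ioi fun x hx => ?_
    rw [Real.sign_of_neg (sub_neg.2 hx), mul_neg_one]
  have h3 := intervalIntegral.integral_Iic_sub_Iic (a := 0) (b := y) hk.integrableOn hk.integrableOn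
  have h4 := intervalIntegral.integral_Iic_add_Ioi (b := y) hk.integrableOn hk.integrableOn
  have h5 := intervalIntegral.integral_Iic_add_Ioi (b := 0) hk.integrableOn hk.integrableOn
  have h6 : ∫ x in Set.Ioi 0, k x = ∫ x in Set.Iic 0, k x := by
    have := integral_comp_neg_Iic 0 k
    simp only [heven, neg_zero] at this
    exact this.symm
  rw [h1, h2]
  linarith

/-- The skew product with an even function on the left as a single integral. -/
theorem EvenCouplings.skewProd_eq_integral (h : EvenCouplings t) {f g : ℝ → ℝ}
    (hfe : ∀ x, f (-x) = f x) (hf : Integrable fun z => f z * weight t z)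
    (hg : Integrable fun z => g z * weight t z) :
    skewProd t f g = ∫ y, (∫ x in (0 : ℝ)..y, f x * weight t x) * (g y * weight t y) := by
  unfold skewProd
  rw [Measure.volume_eq_prod, integral_prod_symm _ (integrable_skew hf hg), ← integral_const_mul]
  refine integral_congr_ae (Eventually.of_forall fun y => ?_)
  simp only
  have h1 : ∀ x, f x * g y * Real.sign (y - x) * weight t x * weight t y =
      (g y * weight t y) * (f x * weight t x * Real.sign (y - x)) := fun x => by ring
  simp only [h1]
  rw [integral_const_mul, integral_mul_sign_sub hf (fun x => by rw [hfe, h.weight_neg])]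
  ring

end Weight

/-! ### Positivity -/

theorem exists_sign_on_of_ne_zero {F : ℝ → ℝ} {s : Set ℝ} (hs : IsPreconnected s)
    (hF : ContinuousOn F s) (hne : ∀ y ∈ s, F y ≠ 0) :
    (∀ y ∈ s, 0 < F y) ∨ ∀ y ∈ s, F y < 0 := by
  by_contra! hcon
  obtain ⟨⟨a, ha, ha'⟩, b, hb, hb'⟩ := hcon
  obtain ⟨c, hc, hc'⟩ := hs.intermediate_value ha hb hF ⟨ha', hb'⟩
  exact hne c hc hc'

/-- A function with finitely many zeros has the sign of a product over some of its zeros. -/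
theorem exists_sign_prod {F : ℝ → ℝ} (hF : Continuous F) (Z : Finset ℝ) :
    ∀ a : ℝ, 0 ≤ a → (∀ z ∈ Z, a < z) → (∀ y, a < y → (F y = 0 ↔ y ∈ Z)) →
    ∃ σ : ℝ, (σ = 1 ∨ σ = -1) ∧ ∃ Z₀ ⊆ Z, ∀ y, a < y →
      0 ≤ σ * (∏ z ∈ Z₀, (y ^ 2 - z ^ 2)) * F y := by
  induction Z using Finset.induction_on_min with
  | empty =>
    intro a _ _ hZ
    rcases exists_sign_on_of_ne_zero isPreconnected_Ioi hF.continuousOn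
      (fun y hy => (hZ y hy).not.2 (by simp)) with h | h
    · exact ⟨1, Or.inl rfl, ∅, subset_rfl, fun y hy => by simpa using (h y hy).le⟩
    · exact ⟨-1, Or.inr rfl, ∅, subset_rfl, fun y hy => by simpa using (h y hy).le⟩
  | insert z Z hz ih =>
    intro a ha haZ hZ
    have haz : a < z := haZ z (by simp)
    obtain ⟨σ, hσ, Z₀, hZ₀, hpos⟩ := ih z (ha.trans haz.le) hz (fun y hy => by
      rw [hZ y (haz.trans hy), Finset.mem_insert]
      exact ⟨fun h => h.resolve_left hy.ne', Or.inr⟩)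
    have hzZ₀ : z ∉ Z₀ := fun h => (hz z (hZ₀ h)).false
    have hFz : F z = 0 := (hZ z haz).2 (by simp)
    have hcont : Continuous fun y => σ * (∏ z ∈ Z₀, (y ^ 2 - z ^ 2)) * F y := by fun_prop
    have hne : ∀ y ∈ Set.Ioo a z, σ * (∏ z ∈ Z₀, (y ^ 2 - z ^ 2)) * F y ≠ 0 := by
      intro y hy
      refine mul_ne_zero (mul_ne_zero (by rcases hσ with rfl | rfl <;> norm_num) ?_) ?_
      · refine Finset.prod_ne_zero_iff.2 fun w hw => ?_
        have := hz w (hZ₀ hw)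
        have h1 := hy.1
        have h2 := hy.2
        nlinarith
      · rw [Ne, hZ y hy.1, Finset.mem_insert, not_or]
        exact ⟨hy.2.ne, fun h => ((hz y h).trans hy.2).false⟩
    -- The smallest zero `z` is peeled off. To its right the induction hypothesis fixes the sign; if
    -- the sign on (a, z) is wrong, the factor y² - z² is included, which is negative exactly there
    -- because 0 ≤ a.
    rcases exists_sign_on_of_ne_zero isPreconnected_Ioo hcont.continuousOn hne with h | h
    · refine ⟨σ, hσ, Z₀, hZ₀.trans (Finset.subset_insert _ _), fun y hy => ?_⟩
      rcases lt_trichotomy y z with hyz | rfl | hyz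
      · exact (h y ⟨hy, hyz⟩).le
      · rw [hFz, mul_zero]
      · exact hpos y hyz
    · refine ⟨σ, hσ, insert z Z₀, Finset.insert_subset_insert _ hZ₀, fun y hy => ?_⟩
      rw [Finset.prod_insert hzZ₀, show ∀ A B : ℝ, σ * (A * B) * F y = A * (σ * B * F y) by
        intros; ring]
      rcases lt_trichotomy y z with hyz | rfl | hyz
      · refine mul_nonneg_of_nonpos_of_nonpos ?_ (h y ⟨hy, hyz⟩).le
        nlinarith
      · rw [hFz]; simp
      · exact mul_nonneg (by nlinarith) (hpos y hyz)

/-- Iterated Rolle: between the zeros of `F` lie zeros of its derivative. -/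
theorem exists_finset_deriv_zeros {F F' : ℝ → ℝ} (hF : ∀ x, HasDerivAt F (F' x) x)
    (Z : Finset ℝ) (hZ : ∀ z ∈ Z, 0 < z ∧ F z = 0) (h0 : F 0 = 0) :
    ∃ R : Finset ℝ, R.card = Z.card ∧ ∀ r ∈ R, 0 < r ∧ F' r = 0 ∧ ∃ z ∈ Z, r < z := by
  induction Z using Finset.induction_on_max with
  | empty => exact ⟨∅, rfl, by simp⟩
  | insert z Z hz ih =>
    obtain ⟨R, hR, hR'⟩ := ih fun w hw => hZ w (Finset.mem_insert_of_mem hw)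
    -- `b` is the previous zero, or 0 if there is none. The critical points found so far lie below
    -- `b`, so Rolle on (b, z) gives a new one.
    obtain ⟨b, hb0, hbz, hFb, hRb⟩ : ∃ b, 0 ≤ b ∧ b < z ∧ F b = 0 ∧ ∀ r ∈ R, r < b := by
      rcases Z.eq_empty_or_nonempty with rfl | hne
      · refine ⟨0, le_rfl, (hZ z (by simp)).1, h0, fun r hr => ?_⟩
        obtain ⟨_, _, w, hw, _⟩ := hR' r hr
        simp at hw
      · have hm := Z.max'_mem hne
        refine ⟨Z.max' hne, (hZ _ (Finset.mem_insert_of_mem hm)).1.le, hz _ hm,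
          (hZ _ (Finset.mem_insert_of_mem hm)).2, fun r hr => ?_⟩
        obtain ⟨_, _, w, hw, hrw⟩ := hR' r hr
        exact hrw.trans_le (Z.le_max' w hw)
    obtain ⟨c, hc, hc0⟩ := exists_hasDerivAt_eq_zero hbz
      (fun x _ => (hF x).continuousAt.continuousWithinAt)
      (hFb.trans (hZ z (by simp)).2.symm) fun x _ => hF x
    have hcR : c ∉ R := fun h => ((hRb c h).trans hc.1).false
    have hzZ : z ∉ Z := fun h => (hz z h).false
    refine ⟨insert c R, ?_, ?_⟩
    · rw [Finset.card_insert_of_notMem hcR, Finset.card_insert_of_notMem hzZ, hR]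
    · intro r hr
      rcases Finset.mem_insert.1 hr with rfl | hr
      · exact ⟨hb0.trans_lt hc.1, hc0, z, by simp, hc.2⟩
      · obtain ⟨h1, h2, w, hw, h3⟩ := hR' r hr
        exact ⟨h1, h2, w, Finset.mem_insert_of_mem hw, h3⟩

-- The squares of `R` are as many distinct roots as the degree of `p`, so `p` is the product of the
-- factors X - r², all positive at y² for y beyond the roots.
open Polynomial in
theorem monic_eval_sq_pos {p : ℝ[X]} (hp : p.Monic) {R : Finset ℝ} {M : ℝ}
    (hcard : R.card = p.natDegree) (hR : ∀ r ∈ R, 0 < r ∧ p.eval (r ^ 2) = 0 ∧ r < M) {y : ℝ}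
    (hy : M < y) : 0 < p.eval (y ^ 2) := by
  have hinj : Set.InjOn (fun r : ℝ => r ^ 2) R := fun a ha b hb hab =>
    (pow_left_inj₀ (hR a ha).1.le (hR b hb).1.le two_ne_zero).1 hab
  have hdvd : ((R.image fun r => r ^ 2).val.map fun a => X - C a).prod ∣ p := by
    refine (Multiset.prod_X_sub_C_dvd_iff_le_roots hp.ne_zero _).2 ?_
    rw [Multiset.le_iff_subset (Finset.nodup _)]
    intro a ha
    rw [Finset.mem_val, Finset.mem_image] at ha
    obtain ⟨r, hr, rfl⟩ := ha
    exact (mem_roots hp.ne_zero).2 (hR r hr).2.1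
  have heq : p = ∏ a ∈ R.image fun r => r ^ 2, (X - C a) := by
    refine eq_of_monic_of_dvd_of_natDegree_le (monic_prod_of_monic _ _ fun a _ => monic_X_sub_C a)
      hp hdvd ?_
    rw [natDegree_prod_of_monic _ _ fun a _ => monic_X_sub_C a]
    simp [Finset.card_image_of_injOn hinj, hcard]
  rw [heq, eval_prod, Finset.prod_image hinj]
  refine Finset.prod_pos fun r hr => ?_
  have := hR r hr
  simp only [eval_sub, eval_X, eval_C]
  nlinarith

theorem abs_intervalIntegral_le {k : ℝ → ℝ} (hk : Integrable k) (y : ℝ) :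
    |∫ x in (0 : ℝ)..y, k x| ≤ ∫ x, |k x| :=
  (intervalIntegral.norm_integral_le_integral_norm_uIoc).trans
    (setIntegral_le_integral hk.norm (Eventually.of_forall fun _ => norm_nonneg _))

theorem intervalIntegral_neg_of_even {k : ℝ → ℝ} (heven : ∀ x, k (-x) = k x) (y : ℝ) :
    ∫ x in (0 : ℝ)..(-y), k x = -∫ x in (0 : ℝ)..y, k x := by
  have h := intervalIntegral.integral_comp_neg (a := 0) (b := y) k
  simp only [heven, neg_zero] at h
  rw [intervalIntegral.integral_symm, ← h]

open Polynomial in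
/-- The skew product pairs every even polynomial with some odd polynomial of the next degree. -/
theorem exists_skewProd_pos {t : ℕ+ → ℝ} (he : EvenCouplings t) (ha : Admissible t) {p : ℝ[X]}
    (hp : p.Monic) : ∃ q : ℝ[X], q.natDegree ≤ p.natDegree ∧ 0 ≤ q.coeff p.natDegree ∧
      0 < skewProd t (fun x => (expand ℝ 2 p).eval x) (fun y => (X * expand ℝ 2 q).eval y) := by
  have hρ := ha.continuous_weight
  set k : ℝ → ℝ := fun x => (expand ℝ 2 p).eval x * weight t x with hk
  have hkc : Continuous k := by fun_prop
  have hki : Integrable k := ha.integrable_eval _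
  have hke : ∀ x, k (-x) = k x := fun x => by
    simp only [hk, expand_eval, he.weight_neg, neg_sq]
  set F : ℝ → ℝ := fun y => ∫ x in (0 : ℝ)..y, k x with hF
  have hFd : ∀ x, HasDerivAt F (k x) x := fun x =>
    intervalIntegral.integral_hasDerivAt_right (hkc.intervalIntegrable _ _)
      hkc.stronglyMeasurable.stronglyMeasurableAtFilter hkc.continuousAt
  have hFc : Continuous F := continuous_iff_continuousAt.2 fun x => (hFd x).continuousAt
  have hF0 : F 0 = 0 := intervalIntegral.integral_same
  have hkz : ∀ x, k x = 0 ↔ p.eval (x ^ 2) = 0 := fun x => by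
    simp [hk, expand_eval, (weight_pos t x).ne']
  -- Distinct positive zeros of `F` give as many positive zeros of its derivative, whose squares are
  -- distinct roots of `p`.
  have hcard : ∀ Z : Finset ℝ, (∀ z ∈ Z, 0 < z ∧ F z = 0) → Z.card ≤ p.natDegree := by
    intro Z hZ
    obtain ⟨R, hRc, hR⟩ := exists_finset_deriv_zeros hFd Z hZ hF0
    have hinj : Set.InjOn (fun r : ℝ => r ^ 2) R := fun a ha b hb hab =>
      (pow_left_inj₀ (hR a ha).1.le (hR b hb).1.le two_ne_zero).1 hab
    rw [← hRc, ← Finset.card_image_of_injOn hinj]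
    refine (Finset.card_le_card ?_).trans ((Multiset.toFinset_card_le _).trans (card_roots' p))
    intro a ha
    obtain ⟨r, hr, rfl⟩ := Finset.mem_image.1 ha
    rw [Multiset.mem_toFinset, mem_roots hp.ne_zero]
    exact (hkz r).1 (hR r hr).2.1
  have hfin : {y | 0 < y ∧ F y = 0}.Finite := by
    by_contra hinf
    obtain ⟨Z, hZ, hZc⟩ := Set.Infinite.exists_subset_card_eq hinf (p.natDegree + 1)
    have := hcard Z fun z hz => hZ hz
    omega
  have hZmem : ∀ y, y ∈ hfin.toFinset ↔ 0 < y ∧ F y = 0 := fun y => by simp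
  obtain ⟨σ, hσ, Z₀, hZ₀, hsign⟩ := exists_sign_prod hFc hfin.toFinset 0 le_rfl
    (fun z hz => ((hZmem z).1 hz).1) fun y hy => by rw [hZmem]; exact ⟨fun h => ⟨hy, h⟩, And.right⟩
  -- `M` is the last positive zero of `F`, or 0; beyond it the product over `Z₀` and `F` have
  -- constant nonzero sign.
  obtain ⟨M, hM0, hMF, hMZ⟩ : ∃ M, 0 ≤ M ∧ F M = 0 ∧ ∀ z ∈ hfin.toFinset, z ≤ M := by
    rcases hfin.toFinset.eq_empty_or_nonempty with h | h
    · exact ⟨0, le_rfl, hF0, by simp [h]⟩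
    · have := (hZmem _).1 (hfin.toFinset.max'_mem h)
      exact ⟨_, this.1.le, this.2, fun z hz => Finset.le_max' _ z hz⟩
  have hprod : ∀ y, M < y → 0 < ∏ z ∈ Z₀, (y ^ 2 - z ^ 2) := fun y hy =>
    Finset.prod_pos fun z hz => by
      have h1 := hMZ z (hZ₀ hz)
      have h2 := ((hZmem z).1 (hZ₀ hz)).1
      nlinarith
  set u : ℝ[X] := ∏ z ∈ Z₀, (X - C (z ^ 2)) with hu
  have hum : u.Monic := monic_prod_of_monic _ _ fun z _ => monic_X_sub_C _
  have hud : u.natDegree = Z₀.card := by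
    rw [hu, natDegree_prod_of_monic _ _ fun z _ => monic_X_sub_C _]
    simp only [natDegree_X_sub_C, Finset.sum_const, smul_eq_mul, mul_one]
  have hZ₀c : Z₀.card ≤ p.natDegree := hcard Z₀ fun z hz => (hZmem z).1 (hZ₀ hz)
  have hueval : ∀ y, (C σ * u).eval (y ^ 2) = σ * ∏ z ∈ Z₀, (y ^ 2 - z ^ 2) := fun y => by
    simp [hu, eval_prod]
  refine ⟨C σ * u, (natDegree_C_mul_le _ _).trans (hud.trans_le hZ₀c), ?_, ?_⟩
  · rw [coeff_C_mul]
    rcases hZ₀c.lt_or_eq with hlt | heq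
    · rw [coeff_eq_zero_of_natDegree_lt (hud.trans_lt hlt), mul_zero]
    · rw [← heq, ← hud, hum.coeff_natDegree, mul_one]
      -- In full degree σ is the coefficient, so it must be 1. Here `F` has the maximal number of
      -- zeros, so every root of `p` is a squared critical point below `M`. Beyond `M` the
      -- derivative of `F` is then positive, and `F M = 0` gives `F > 0` there; hence σ = -1 would
      -- contradict the sign condition.
      have hZc : hfin.toFinset.card = p.natDegree :=
        le_antisymm (hcard _ fun z hz => (hZmem z).1 hz) (heq ▸ Finset.card_le_card hZ₀)
      obtain ⟨R, hRc, hR⟩ := exists_finset_deriv_zeros hFd hfin.toFinset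
        (fun z hz => (hZmem z).1 hz) hF0
      have hkpos : ∀ y, M < y → 0 < k y := fun y hy => by
        simp only [hk, expand_eval]
        refine mul_pos (monic_eval_sq_pos hp (M := M) (hRc.trans hZc) (fun r hr => ?_) hy)
          (weight_pos _ _)
        obtain ⟨h1, h2, z, hz, h3⟩ := hR r hr
        exact ⟨h1, (hkz r).1 h2, h3.trans_le (hMZ z hz)⟩
      have hFpos : 0 < F (M + 1) := by
        obtain ⟨c, hc, hc'⟩ := exists_hasDerivAt_eq_slope F k (show M < M + 1 by linarith)
          hFc.continuousOn fun x _ => hFd x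
        have := hkpos c hc.1
        rw [hc', hMF] at this
        simpa using this
      have h1 := hsign (M + 1) (by linarith)
      have h2 := hprod (M + 1) (by linarith)
      rcases hσ with rfl | rfl
      · norm_num
      · nlinarith [mul_pos h2 hFpos]
  · rw [he.skewProd_eq_integral (fun x => by simp [expand_eval]) (ha.integrable_eval _)
      (ha.integrable_eval _)]
    set G : ℝ → ℝ := fun y => F y * ((X * expand ℝ 2 (C σ * u)).eval y * weight t y) with hG
    have hGeq : ∀ y, G y = (σ * (∏ z ∈ Z₀, (y ^ 2 - z ^ 2)) * F y) * (y * weight t y) :=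
      fun y => by
        simp only [hG, eval_mul, eval_X, expand_eval, hueval]
        rw [← hueval, eval_mul]; ring
    -- Both `F` and the odd polynomial change sign, so nonnegativity on the positive half-line
    -- suffices.
    have hGe : ∀ y, G (-y) = G y := fun y => by
      rw [hGeq, hGeq, he.weight_neg, show F (-y) = -F y from intervalIntegral_neg_of_even hke y]
      simp only [neg_sq]
      ring
    have hGc : Continuous G := by fun_prop
    have hGpos : ∀ y, 0 < y → 0 ≤ G y := fun y hy => by
      rw [hGeq]
      exact mul_nonneg (hsign y hy) (mul_pos hy (weight_pos _ _)).le
    have hGnn : 0 ≤ G := fun y => by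
      rcases lt_trichotomy y 0 with h | rfl | h
      · rw [← hGe]; exact hGpos _ (by linarith)
      · simp [hGeq]
      · exact hGpos y h
    have hGi : Integrable G := (ha.integrable_eval _).bdd_mul (c := ∫ x, |k x|)
      hFc.aestronglyMeasurable (Eventually.of_forall fun y => abs_intervalIntegral_le hki y)
    have hGne : G (M + 1) ≠ 0 := by
      have h1 := hprod (M + 1) (by linarith)
      have h2 : F (M + 1) ≠ 0 := fun h => by
        have := hMZ (M + 1) ((hZmem _).2 ⟨by linarith, h⟩)
        linarith
      have h3 := weight_pos t (M + 1)
      rw [hGeq]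
      have h4 : M + 1 ≠ 0 := by linarith
      have h5 : σ ≠ 0 := by rcases hσ with rfl | rfl <;> norm_num
      positivity
    exact (integral_pos_iff_support_of_nonneg hGnn hGi).2
      (hGc.isOpen_support.measure_pos _ ⟨M + 1, hGne⟩)

/-! ### Existence of the Pfaff factor -/

/-- The rows of the unipotent lower triangular `P` for which `P B` is upper triangular. -/
noncomputable def orthRow (B : Matrix ℕ ℕ ℝ) : Matrix ℕ ℕ ℝ :=
  Matrix.of fun n i => if i = n then 1
    else if h : i < n then -∑ j : Fin n, B n j * (corner B n)⁻¹ j ⟨i, h⟩ else 0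

theorem orthRow_self (B : Matrix ℕ ℕ ℝ) (n : ℕ) : orthRow B n n = 1 := by simp [orthRow]

theorem band_orthRow (B : Matrix ℕ ℕ ℝ) : Band 0 (orthRow B) := fun i j hij => by
  simp only [orthRow, Matrix.of_apply]
  rw [if_neg (by omega), dif_neg (by omega)]

theorem orthRow_semiMul_apply_of_lt {B : Matrix ℕ ℕ ℝ} {n j : ℕ} (hB : (corner B n).det ≠ 0)
    (hj : j < n) : (orthRow B ⬝∞ B) n j = 0 := by
  rw [(band_orthRow B).semiMul_apply B (N := n + 1) (by omega), Finset.sum_range_succ,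
    orthRow_self, one_mul, ← Fin.sum_univ_eq_sum_range (fun p => orthRow B n p * B p j)]
  have h1 : ∀ p : Fin n, orthRow B n p * B p j =
      -∑ q : Fin n, B n q * ((corner B n)⁻¹ q p * corner B n p ⟨j, hj⟩) := fun p => by
    have hp : ¬ (p : ℕ) = n := p.2.ne
    simp only [orthRow, Matrix.of_apply]
    rw [if_neg hp, dif_pos p.2, neg_mul, Finset.sum_mul]
    simp only [mul_assoc]
    rfl
  simp only [h1, Finset.sum_neg_distrib]
  rw [Finset.sum_comm]
  simp only [← Finset.mul_sum]
  have h2 : ∀ q : Fin n, ∑ p : Fin n, (corner B n)⁻¹ q p * corner B n p ⟨j, hj⟩ =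
      if q = ⟨j, hj⟩ then 1 else 0 := fun q => by
    have := congrFun (congrFun (Matrix.nonsing_inv_mul (corner B n) hB.isUnit) q) ⟨j, hj⟩
    rwa [Matrix.mul_apply, Matrix.one_apply] at this
  simp [h2]

theorem corner_transpose (B : Matrix ℕ ℕ ℝ) (n : ℕ) :
    corner B.transpose n = (corner B n).transpose := rfl

/-- The diagonal of `P B`, the ratios of consecutive corner minors. -/
noncomputable def pivot (B : Matrix ℕ ℕ ℝ) (n : ℕ) : ℝ := (orthRow B ⬝∞ B) n n

theorem orthRow_conj_of_le {B C : Matrix ℕ ℕ ℝ} (hB : ∀ n, (corner B n).det ≠ 0) {i j : ℕ}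
    (hij : j ≤ i) : (orthRow B ⬝∞ B ⬝∞ (orthRow C).transpose) i j =
      if i = j then pivot B i else 0 := by
  have ht : Band 0 (orthRow C).transpose.transpose := by simpa using band_orthRow C
  rw [ht.semiMul_apply_right _ i (N := j + 1) (by omega), Finset.sum_range_succ,
    Finset.sum_eq_zero, zero_add, Matrix.transpose_apply, orthRow_self, mul_one]
  · split_ifs with h
    · rw [h]; rfl
    · exact orthRow_semiMul_apply_of_lt (hB i) (by omega)
  · intro p hp
    simp at hp
    rw [orthRow_semiMul_apply_of_lt (hB i) (by omega), zero_mul]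

/-- P B is upper triangular, so on and below the diagonal the unipotent right factor leaves only the
pivots. The other half is the same statement for Bᵀ. -/
theorem orthRow_conj {B : Matrix ℕ ℕ ℝ} (hB : ∀ n, (corner B n).det ≠ 0) (i j : ℕ) :
    (orthRow B ⬝∞ B ⬝∞ (orthRow B.transpose).transpose) i j =
      if i = j then pivot B i else 0 := by
  rcases le_or_gt j i with h | h
  · exact orthRow_conj_of_le hB h
  · have ht : Band 0 (orthRow B).transpose.transpose := by simpa using band_orthRow B
    have h1 := orthRow_conj_of_le (B := B.transpose) (C := B)
      (fun n => by rw [corner_transpose, Matrix.det_transpose]; exact hB n) h.le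
    rw [semiMul_assoc_mid (band_orthRow _) _ ht, ← transpose_semiMul,
      if_neg (by omega)] at h1
    rw [← Matrix.transpose_transpose (orthRow B ⬝∞ B), ← transpose_semiMul,
      Matrix.transpose_apply, h1, if_neg (by omega)]

theorem sum_range_two_mul {M : Type*} [AddCommMonoid M] (f : ℕ → M) (N : ℕ) :
    ∑ p ∈ Finset.range (2 * N), f p =
      ∑ a ∈ Finset.range N, f (2 * a) + ∑ a ∈ Finset.range N, f (2 * a + 1) := by
  induction N with
  | zero => simp
  | succ N ih =>
    rw [show 2 * (N + 1) = 2 * N + 1 + 1 by ring, Finset.sum_range_succ, Finset.sum_range_succ, ih,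
      Finset.sum_range_succ, Finset.sum_range_succ]
    abel

/-- The moments between even and odd monomials. -/
def evenOddBlock (m : Matrix ℕ ℕ ℝ) : Matrix ℕ ℕ ℝ := Matrix.of fun i j => m (2 * i) (2 * j + 1)

/-- The explicit Pfaff factor of a skew matrix that couples only indices of opposite parity. -/
noncomputable def paritySkewFactor (m : Matrix ℕ ℕ ℝ) : Matrix ℕ ℕ ℝ :=
  Matrix.of fun i j =>
    if Even i ∧ Even j then
      orthRow (evenOddBlock m) (i / 2) (j / 2) / √(pivot (evenOddBlock m) (i / 2))
    else if Odd i ∧ Odd j then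
      orthRow (evenOddBlock m).transpose (i / 2) (j / 2) / √(pivot (evenOddBlock m) (i / 2))
    else 0

section Factor

variable (m : Matrix ℕ ℕ ℝ)

theorem paritySkewFactor_even_even (a b : ℕ) : paritySkewFactor m (2 * a) (2 * b) =
    orthRow (evenOddBlock m) a b / √(pivot (evenOddBlock m) a) := by
  simp [paritySkewFactor]

theorem paritySkewFactor_odd_odd (a b : ℕ) : paritySkewFactor m (2 * a + 1) (2 * b + 1) =
    orthRow (evenOddBlock m).transpose a b / √(pivot (evenOddBlock m) a) := by
  have h1 : ¬ (Even (2 * a + 1) ∧ Even (2 * b + 1)) := by grind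
  have h2 : Odd (2 * a + 1) ∧ Odd (2 * b + 1) := by grind
  simp only [paritySkewFactor, Matrix.of_apply]
  rw [if_neg h1, if_pos h2, show (2 * a + 1) / 2 = a by omega, show (2 * b + 1) / 2 = b by omega]

theorem paritySkewFactor_of_odd {i j : ℕ} (hij : Odd (i + j)) : paritySkewFactor m i j = 0 := by
  have h1 : ¬ (Even i ∧ Even j) := by grind
  have h2 : ¬ (Odd i ∧ Odd j) := by grind
  simp only [paritySkewFactor, Matrix.of_apply]
  rw [if_neg h1, if_neg h2]

theorem band_paritySkewFactor : Band 0 (paritySkewFactor m) := by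
  intro i j hij
  rcases Nat.even_or_odd (i + j) with h | h
  swap
  · exact paritySkewFactor_of_odd m h
  obtain ⟨a, rfl | rfl⟩ := i.even_or_odd' <;> obtain ⟨b, rfl | rfl⟩ := j.even_or_odd'
  · rw [paritySkewFactor_even_even, band_orthRow _ a b (by omega), zero_div]
  · exact absurd h (by grind)
  · exact absurd h (by grind)
  · rw [paritySkewFactor_odd_odd, band_orthRow _ a b (by omega), zero_div]

variable {m}

theorem paritySkewFactor_shape (hD : ∀ n, 0 < pivot (evenOddBlock m) n) :
    PfaffShape (paritySkewFactor m) where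
  lower i j h := band_paritySkewFactor m i j (by simpa using h)
  block_off n := paritySkewFactor_of_odd m (by grind)
  block_diag n := by
    rw [paritySkewFactor_even_even, paritySkewFactor_odd_odd, orthRow_self, orthRow_self]
  pos n := by
    rw [paritySkewFactor_even_even, orthRow_self]
    exact div_pos one_pos (Real.sqrt_pos.2 (hD n))

theorem conj_apply {S : Matrix ℕ ℕ ℝ} (hS : Band 0 S) (m : Matrix ℕ ℕ ℝ) {i j N M : ℕ}
    (hi : i < N) (hj : j < M) : (S ⬝∞ m ⬝∞ S.transpose) i j =
      ∑ p ∈ Finset.range N, ∑ q ∈ Finset.range M, S i p * m p q * S j q := by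
  have ht : Band 0 S.transpose.transpose := by simpa using hS
  rw [ht.semiMul_apply_right _ i (N := M) (by omega), Finset.sum_comm]
  refine Finset.sum_congr rfl fun q _ => ?_
  rw [hS.semiMul_apply m (N := N) (by omega), Finset.sum_mul]
  rfl

theorem conj_swap {S : Matrix ℕ ℕ ℝ} (hS : Band 0 S) (hm : ∀ i j, m j i = -m i j) (i j : ℕ) :
    (S ⬝∞ m ⬝∞ S.transpose) j i = -(S ⬝∞ m ⬝∞ S.transpose) i j := by
  rw [conj_apply hS m (Nat.lt_succ_self j) (Nat.lt_succ_self i),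
    conj_apply hS m (Nat.lt_succ_self i) (Nat.lt_succ_self j), Finset.sum_comm,
    ← Finset.sum_neg_distrib]
  refine Finset.sum_congr rfl fun p _ => ?_
  rw [← Finset.sum_neg_distrib]
  refine Finset.sum_congr rfl fun q _ => ?_
  rw [hm p q]; ring

theorem eq_J_of_entries {A : Matrix ℕ ℕ ℝ} (hzero : ∀ i j, Even (i + j) → A i j = 0)
    (hmain : ∀ a b, A (2 * a) (2 * b + 1) = if a = b then 1 else 0)
    (hswap : ∀ i j, A j i = -A i j) : A = J := by
  ext i j
  obtain ⟨a, rfl | rfl⟩ := i.even_or_odd' <;> obtain ⟨b, rfl | rfl⟩ := j.even_or_odd'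
  · rw [hzero _ _ (by grind)]
    simp only [J, Matrix.of_apply]
    rw [if_neg (by omega), if_neg (by omega)]
  · rw [hmain]
    have h2 : ¬ (Even (2 * b + 1) ∧ 2 * a = 2 * b + 1 + 1) := by grind
    simp only [J, Matrix.of_apply, if_neg h2, even_two_mul, true_and]
    refine if_congr (by omega) rfl rfl
  · rw [hswap, hmain]
    have h2 : ¬ (Even (2 * a + 1) ∧ 2 * b = 2 * a + 1 + 1) := by grind
    simp only [J, Matrix.of_apply, if_neg h2, even_two_mul, true_and]
    rw [← neg_zero, ← apply_ite Neg.neg]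
    simp only [neg_zero]
    congr 1
    exact if_congr (by omega) rfl rfl
  · rw [hzero _ _ (by grind)]
    have h1 : ¬ (Even (2 * a + 1) ∧ 2 * b + 1 = 2 * a + 1 + 1) := by grind
    have h2 : ¬ (Even (2 * b + 1) ∧ 2 * a + 1 = 2 * b + 1 + 1) := by grind
    simp only [J, Matrix.of_apply, if_neg h1, if_neg h2]

/-- Since neither S nor the skew matrix pairs indices the wrong way, the even-odd block of S m Sᵀ is
the diagonalised `evenOddBlock m`, with √pivot divided out on both sides. -/
theorem paritySkewFactor_isPfaffFactor (hp : ∀ i j, Even (i + j) → m i j = 0)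
    (hm : ∀ i j, m j i = -m i j) (hB : ∀ n, (corner (evenOddBlock m) n).det ≠ 0)
    (hD : ∀ n, 0 < pivot (evenOddBlock m) n) : IsPfaffFactor m (paritySkewFactor m) := by
  refine (paritySkewFactor_shape hD).isPfaffFactor ?_
  have hS := band_paritySkewFactor m
  have hzero : ∀ i j, Even (i + j) →
      (paritySkewFactor m ⬝∞ m ⬝∞ (paritySkewFactor m).transpose) i j = 0 := fun i j hij => by
    rw [conj_apply hS m (Nat.lt_succ_self i) (Nat.lt_succ_self j)]
    refine Finset.sum_eq_zero fun p _ => Finset.sum_eq_zero fun q _ => ?_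
    rcases Nat.even_or_odd (i + p) with h1 | h1
    · rcases Nat.even_or_odd (j + q) with h2 | h2
      · rw [hp p q (by grind)]; ring
      · rw [paritySkewFactor_of_odd m h2]; ring
    · rw [paritySkewFactor_of_odd m h1]; ring
  have hmain : ∀ a b, (paritySkewFactor m ⬝∞ m ⬝∞ (paritySkewFactor m).transpose)
      (2 * a) (2 * b + 1) = if a = b then 1 else 0 := fun a b => by
    have ht : Band 0 (orthRow (evenOddBlock m).transpose).transpose.transpose := by
      simpa using band_orthRow _
    have e1 : ∀ c d : ℕ, paritySkewFactor m (2 * c) (2 * d + 1) = 0 := fun c d =>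
      paritySkewFactor_of_odd m (by grind)
    have e2 : ∀ c d : ℕ, paritySkewFactor m (2 * c + 1) (2 * d) = 0 := fun c d =>
      paritySkewFactor_of_odd m (by grind)
    have h1 := orthRow_conj hB a b
    rw [ht.semiMul_apply_right _ a (N := b + 1) (by omega)] at h1
    simp only [(band_orthRow _).semiMul_apply _ (show a + 0 < a + 1 by omega),
      Matrix.transpose_apply, Finset.sum_mul] at h1
    rw [conj_apply hS m (show 2 * a < 2 * (a + 1) by omega)
      (show 2 * b + 1 < 2 * (b + 1) by omega)]
    simp only [sum_range_two_mul, e1, e2, mul_zero, zero_mul, Finset.sum_const_zero, zero_add,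
      add_zero, paritySkewFactor_even_even, paritySkewFactor_odd_odd]
    rw [Finset.sum_comm]
    calc _ = (∑ q ∈ Finset.range (b + 1), ∑ p ∈ Finset.range (a + 1),
          orthRow (evenOddBlock m) a p * evenOddBlock m p q *
            orthRow (evenOddBlock m).transpose b q) /
          (√(pivot (evenOddBlock m) a) * √(pivot (evenOddBlock m) b)) := by
            rw [Finset.sum_div]
            refine Finset.sum_congr rfl fun q _ => ?_
            rw [Finset.sum_div]
            refine Finset.sum_congr rfl fun p _ => ?_
            simp only [evenOddBlock, Matrix.of_apply]
            ring
      _ = _ := by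
            rw [h1]
            split_ifs with h
            · subst h
              rw [Real.mul_self_sqrt (hD a).le, div_self (hD a).ne']
            · rw [zero_div]
  exact eq_J_of_entries hzero hmain (conj_swap hS hm)

end Factor

/-! ### Positivity of the pivots of the moment matrix -/

open Polynomial in
/-- The polynomial with the first `n` terms of `v` as coefficients. -/
noncomputable def truncPoly (v : ℕ → ℝ) (n : ℕ) : ℝ[X] := ∑ i ∈ Finset.range n, monomial i (v i)

theorem coeff_truncPoly (v : ℕ → ℝ) (n i : ℕ) :
    (truncPoly v n).coeff i = if i < n then v i else 0 := by
  simp [truncPoly, Polynomial.coeff_monomial]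

open Polynomial in
theorem Admissible.skewProd_expand {t : ℕ+ → ℝ} (ha : Admissible t) {p q : ℝ[X]} {N : ℕ}
    (hp : p.natDegree < N) (hq : q.natDegree < N) :
    skewProd t (fun x => (expand ℝ 2 p).eval x) (fun y => (X * expand ℝ 2 q).eval y) =
      ∑ d ∈ Finset.range N, (∑ c ∈ Finset.range N,
        p.coeff c * evenOddBlock (skewMoments t) c d) * q.coeff d := by
  have e1 : ∀ c, (expand ℝ 2 p).coeff (2 * c) = p.coeff c := fun c =>
    coeff_expand_mul' two_pos p c
  have e2 : ∀ c, (expand ℝ 2 p).coeff (2 * c + 1) = 0 := fun c => by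
    rw [coeff_expand two_pos, if_neg (by omega)]
  have e3 : ∀ d, (X * expand ℝ 2 q).coeff (2 * d + 1) = q.coeff d := fun d => by
    rw [coeff_X_mul, coeff_expand_mul' two_pos]
  have e4 : ∀ d, (X * expand ℝ 2 q).coeff (2 * d) = 0 := fun d => by
    rcases d with _ | d
    · simp
    · rw [show 2 * (d + 1) = 2 * d + 1 + 1 by ring, coeff_X_mul, coeff_expand two_pos,
        if_neg (by omega)]
  have d1 : (expand ℝ 2 p).natDegree < 2 * N := by rw [natDegree_expand]; omega
  have d2 : (X * expand ℝ 2 q).natDegree < 2 * N := by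
    refine (natDegree_mul_le).trans_lt ?_
    rw [natDegree_X, natDegree_expand]; omega
  rw [ha.skewProd_eval _ _ d1 d2]
  simp only [sum_range_two_mul, e1, e2, e3, e4, mul_zero, zero_mul, Finset.sum_const_zero,
    zero_add, add_zero]
  rw [Finset.sum_comm]
  refine Finset.sum_congr rfl fun d _ => ?_
  rw [Finset.sum_mul]
  rfl

section Moments

variable {t : ℕ+ → ℝ} (he : EvenCouplings t) (ha : Admissible t)
include he ha

-- A left null vector of the corner would be the coefficient vector of an even polynomial with zero
-- skew product against every odd polynomial of the allowed degree; after scaling it to be monic,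
-- `exists_skewProd_pos` excludes this.
open Polynomial in
theorem moments_corner_det_ne_zero (n : ℕ) :
    (corner (evenOddBlock (skewMoments t)) n).det ≠ 0 := by
  intro hdet
  obtain ⟨v, hv, hv0⟩ := Matrix.exists_vecMul_eq_zero_iff.2 hdet
  set p₀ := truncPoly (fun i => if h : i < n then v ⟨i, h⟩ else 0) n with hp₀
  have hc : ∀ i : Fin n, p₀.coeff i = v i := fun i => by
    simp [hp₀, coeff_truncPoly]
  have hdeg : ∀ i, n ≤ i → p₀.coeff i = 0 := fun i hi => by
    rw [hp₀, coeff_truncPoly, if_neg (by omega)]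
  have hne : p₀ ≠ 0 := fun h => hv (by ext i; rw [← hc, h]; rfl)
  have hnat : p₀.natDegree < n := by
    by_contra hcon
    exact hne (leadingCoeff_eq_zero.1 (hdeg _ (by omega)))
  have hmonic : (C p₀.leadingCoeff⁻¹ * p₀).Monic :=
    monic_C_mul_of_mul_leadingCoeff_eq_one (inv_mul_cancel₀ (leadingCoeff_ne_zero.2 hne))
  have hnat' : (C p₀.leadingCoeff⁻¹ * p₀).natDegree < n := (natDegree_C_mul_le _ _).trans_lt hnat
  obtain ⟨q, hq, _, hpos⟩ := exists_skewProd_pos he ha hmonic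
  rw [ha.skewProd_expand hnat' (hq.trans_lt hnat')] at hpos
  refine hpos.ne' (Finset.sum_eq_zero fun d hd => ?_)
  have h1 := congrFun hv0 ⟨d, Finset.mem_range.1 hd⟩
  simp only [Matrix.vecMul, dotProduct, Pi.zero_apply, corner, Matrix.of_apply, ← hc] at h1
  rw [Fin.sum_univ_eq_sum_range (fun c => p₀.coeff c * evenOddBlock (skewMoments t) c d)] at h1
  simp only [coeff_C_mul, mul_assoc, ← Finset.mul_sum, h1]
  ring

-- Row n of P is a monic p, orthogonal to all lower odd monomials. Its positive skew product with
-- the partner q is therefore the pivot times the top coefficient of q, which is known to be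
-- nonnegative.
open Polynomial in
theorem moments_pivot_pos (n : ℕ) : 0 < pivot (evenOddBlock (skewMoments t)) n := by
  set B := evenOddBlock (skewMoments t) with hB
  set p := truncPoly (orthRow B n) (n + 1) with hp
  have hc : ∀ i, p.coeff i = if i < n + 1 then orthRow B n i else 0 := coeff_truncPoly _ _
  have hle : p.natDegree ≤ n := natDegree_le_iff_coeff_eq_zero.2 fun i hi => by
    rw [hc, if_neg (by omega)]
  have hn : p.coeff n = 1 := by rw [hc, if_pos (by omega), orthRow_self]
  have hmonic : p.Monic := monic_of_natDegree_le_of_coeff_eq_one n hle hn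
  have hdeg : p.natDegree = n := le_antisymm hle (le_natDegree_of_ne_zero (by rw [hn]; simp))
  obtain ⟨q, hq, hq0, hpos⟩ := exists_skewProd_pos he ha hmonic
  rw [hdeg] at hq hq0
  rw [ha.skewProd_expand (N := n + 1) (by omega) (by omega)] at hpos
  have h1 : ∀ d, ∑ c ∈ Finset.range (n + 1), p.coeff c * B c d = (orthRow B ⬝∞ B) n d :=
    fun d => by
    rw [(band_orthRow B).semiMul_apply B (N := n + 1) (by omega)]
    refine Finset.sum_congr rfl fun c hcr => ?_
    rw [hc, if_pos (Finset.mem_range.1 hcr)]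
  simp only [← hB, h1] at hpos
  rw [Finset.sum_range_succ, Finset.sum_eq_zero, zero_add] at hpos
  · exact (pos_iff_pos_of_mul_pos hpos).2 (lt_of_le_of_ne hq0 fun h => by simp [← h] at hpos)
  · intro d hd
    rw [orthRow_semiMul_apply_of_lt (moments_corner_det_ne_zero he ha n) (by simpa using hd),
      zero_mul]

theorem moments_isPfaffFactor :
    IsPfaffFactor (skewMoments t) (paritySkewFactor (skewMoments t)) :=
  paritySkewFactor_isPfaffFactor (fun _ _ h => skewMoments_parity he h) (skewMoments_swap t)
    (moments_corner_det_ne_zero he ha) (moments_pivot_pos he ha)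

end Moments

/-! ### The reduced form of the Lax matrix -/

theorem semiMul_shift_zero (A : Matrix ℕ ℕ ℝ) (i : ℕ) : (A ⬝∞ shift) i 0 = 0 := by
  simp [semiMul, shift]

theorem semiMul_shift_succ (A : Matrix ℕ ℕ ℝ) (i j : ℕ) : (A ⬝∞ shift) i (j + 1) = A i j := by
  have h : Band 0 shift.transpose := fun i j hij => by
    simp only [shift, Matrix.transpose_apply, Matrix.of_apply]; rw [if_neg (by omega)]
  rw [h.semiMul_apply_right A i (N := j + 2) (by omega), Finset.sum_eq_single j]
  · simp [shift]
  · intro p _ hp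
    simp only [shift, Matrix.of_apply]
    rw [if_neg (by omega), mul_zero]
  · intro hj; simp at hj

theorem reducedLax_laxEntry {L : Matrix ℕ ℕ ℝ} (hL : Band 1 L) (hp : OddParity L)
    (h1 : ∀ a, L (2 * a) (2 * a + 1) = 1) : reducedLax (laxEntry L) = L := by
  ext i j
  rcases Nat.even_or_odd (i + j) with hij | hij
  · rw [oddParity_reducedLax _ i j hij, hp i j hij]
  rcases Nat.lt_or_ge (i + 1) j with hlt | hge
  · rw [band_reducedLax _ i j hlt, hL i j hlt]
  obtain ⟨a, rfl | rfl⟩ := i.even_or_odd' <;> obtain ⟨b, rfl | rfl⟩ := j.even_or_odd'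
  · exact absurd hij (by grind)
  · rcases Nat.lt_or_ge b a with hba | hba
    · obtain ⟨d, rfl⟩ := Nat.exists_eq_add_of_lt hba
      rw [show 2 * (b + d + 1) = 2 * (b + d) + 2 by ring, reducedLax_even_odd, laxEntry,
        if_neg (by omega), if_neg (by omega), if_neg (by omega), Int.natAbs_natCast]
      congr 1; omega
    · obtain rfl : a = b := by omega
      rw [reducedLax_even_succ, h1]
  · rcases Nat.lt_or_ge a b with hba | hba
    · obtain rfl : b = a + 1 := by omega
      rw [show 2 * (a + 1) = 2 * a + 2 by ring, reducedLax_odd_succ, laxEntry, if_neg (by omega),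
        if_pos rfl]
      congr 1
    · obtain ⟨d, rfl⟩ := Nat.exists_eq_add_of_le hba
      rw [reducedLax_odd_even, laxEntry, if_neg (by omega), if_neg (by omega), if_pos (by omega),
        Int.natAbs_neg, Int.natAbs_natCast]
      congr 1
      omega
  · exact absurd hij (by grind)

namespace PfaffShape

variable {S : Matrix ℕ ℕ ℝ} (hS : PfaffShape S)
include hS

/-- Conjugation by the signs (-1)^i fixes S, hence fixes its inverse. -/
theorem inv_parity (hp : ∀ i j, Odd (i + j) → S i j = 0) {i j : ℕ} (hij : Odd (i + j)) :
    triInv S i j = 0 := by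
  set R : Matrix ℕ ℕ ℝ := Matrix.of fun i j => (-1) ^ (i + j) * triInv S i j with hR
  have h1 : S ⬝∞ R = 1 := by
    ext i j
    rw [← hS.mul_inv, hS.band.semiMul_apply _ (Nat.lt_succ_self _)]
    have h2 : ∀ p ∈ Finset.range (i + 0 + 1), S i p * R p j =
        (-1) ^ (i + j) * (S i p * triInv S p j) := fun p _ => by
      rcases Nat.even_or_odd (i + p) with h | h
      · have h3 : (-1 : ℝ) ^ (p + j) = (-1) ^ (i + j) := by
          rw [pow_add, pow_add]
          congr 1
          exact neg_one_pow_congr (by grind)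
        simp only [hR, Matrix.of_apply, h3]; ring
      · rw [hp i p h]; ring
    rw [Finset.sum_congr rfl h2, ← Finset.mul_sum,
      ← hS.band.semiMul_apply _ (Nat.lt_succ_self _), hS.mul_inv]
    rcases eq_or_ne i j with rfl | hne
    · rw [Even.neg_one_pow (by simp), one_mul]
    · rw [Matrix.one_apply_ne hne, mul_zero]
  have h2 : R = triInv S := by
    rw [← hS.inv_mul_cancel R, h1, semiMul_one]
  have h3 : R i j = -triInv S i j := by simp [hR, hij.neg_one_pow]
  rw [h2] at h3
  linarith

theorem band_shift_conj : Band 1 (S ⬝∞ shift ⬝∞ triInv S) := by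
  have := (hS.band.semiMul band_shift).semiMul hS.band_inv
  simpa using this

theorem shift_conj_mul : S ⬝∞ shift ⬝∞ triInv S ⬝∞ S = S ⬝∞ shift :=
  hS.mul_inv_mul_cancel (hS.band.semiMul band_shift)

theorem shift_conj_parity (hp : ∀ i j, Odd (i + j) → S i j = 0) :
    OddParity (S ⬝∞ shift ⬝∞ triInv S) := by
  intro i j hij
  rw [(hS.band.semiMul band_shift).semiMul_apply _ (Nat.lt_succ_self _)]
  refine Finset.sum_eq_zero fun p _ => ?_
  rcases Nat.even_or_odd (p + j) with h | h
  · rcases p with _ | p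
    · rw [semiMul_shift_zero, zero_mul]
    · rw [semiMul_shift_succ, hp i p (by grind), zero_mul]
  · rw [hS.inv_parity hp h, mul_zero]

theorem shift_conj_succ (i : ℕ) : (S ⬝∞ shift ⬝∞ triInv S) i (i + 1) =
    S i i / S (i + 1) (i + 1) := by
  rw [(hS.band.semiMul band_shift).semiMul_apply _ (N := i + 2) (by omega),
    Finset.sum_range_succ, Finset.sum_eq_zero, zero_add, semiMul_shift_succ,
    hS.inv_apply_self, div_eq_mul_inv]
  intro p hp
  rw [hS.band_inv p (i + 1) (by simpa using hp), mul_zero]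

/-- The superdiagonal of SΛS⁻¹ consists of the ratios of consecutive diagonal entries of S, which
are 1 inside a block because the blocks are scalar. -/
theorem reducedLax_shift_conj (hp : ∀ i j, Odd (i + j) → S i j = 0) :
    reducedLax (laxEntry (S ⬝∞ shift ⬝∞ triInv S)) = S ⬝∞ shift ⬝∞ triInv S :=
  reducedLax_laxEntry hS.band_shift_conj (hS.shift_conj_parity hp) fun a => by
    rw [hS.shift_conj_succ, hS.block_diag, div_self (hS.diag_ne_zero _)]

end PfaffShape

theorem pfaffLax_eq {t : ℕ+ → ℝ} {S : Matrix ℕ ℕ ℝ} (h : IsPfaffFactor (skewMoments t) S) :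
    pfaffLax t = S ⬝∞ shift ⬝∞ triInv S := by
  rw [pfaffLax, h.pfaffFactor_eq]

theorem pfaffLax_eq_reducedLax {t : ℕ+ → ℝ} (he : EvenCouplings t) (ha : Admissible t) :
    pfaffLax t = reducedLax (latticeVar t) := by
  have h := moments_isPfaffFactor he ha
  have : latticeVar t = laxEntry (pfaffLax t) := rfl
  rw [this, pfaffLax_eq h, h.shape.reducedLax_shift_conj fun _ _ => paritySkewFactor_of_odd _]

/-! ### The projection `A_𝔱` -/

/-- The reflection X ↦ J Xᵀ J preserves diagonal blocks and exchanges the parts above and below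
them, so the cuts can be made after reflecting the whole matrix. -/
theorem projT_apply' (A : Matrix ℕ ℕ ℝ) (i j : ℕ) : projT A i j =
    if j / 2 < i / 2 then A i j - (J ⬝∞ A.transpose ⬝∞ J) i j
    else if i / 2 = j / 2 then (1 / 2) * (A i j - (J ⬝∞ A.transpose ⬝∞ J) i j) else 0 := by
  have hu : (J ⬝∞ (blockUpper A).transpose ⬝∞ J) i j =
      if j / 2 < i / 2 then (J ⬝∞ A.transpose ⬝∞ J) i j else 0 := by
    simp only [J_semiMul_J_apply, blockUpper, Matrix.transpose_apply, Matrix.of_apply]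
    obtain ⟨a, rfl | rfl⟩ := i.even_or_odd' <;> obtain ⟨b, rfl | rfl⟩ := j.even_or_odd' <;>
    · have q1 : (2 * a + 1) / 2 = a := by omega
      have q2 : (2 * b + 1) / 2 = b := by omega
      have q3 : 2 * a / 2 = a := by omega
      have q4 : 2 * b / 2 = b := by omega
      have q5 : ∀ c : ℕ, ¬ Even (2 * c + 1) := fun c => by grind
      simp only [q1, q2, q3, q4, q5, even_two_mul, if_true, if_false, Nat.add_sub_cancel]
        <;> split_ifs <;> simp
  have hd : (J ⬝∞ (blockDiag A).transpose ⬝∞ J) i j =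
      if i / 2 = j / 2 then (J ⬝∞ A.transpose ⬝∞ J) i j else 0 := by
    simp only [J_semiMul_J_apply, blockDiag, Matrix.transpose_apply, Matrix.of_apply]
    obtain ⟨a, rfl | rfl⟩ := i.even_or_odd' <;> obtain ⟨b, rfl | rfl⟩ := j.even_or_odd' <;>
    · have q1 : (2 * a + 1) / 2 = a := by omega
      have q2 : (2 * b + 1) / 2 = b := by omega
      have q3 : 2 * a / 2 = a := by omega
      have q4 : 2 * b / 2 = b := by omega
      have q5 : ∀ c : ℕ, ¬ Even (2 * c + 1) := fun c => by grind
      simp only [q1, q2, q3, q4, q5, even_two_mul, if_true, if_false, Nat.add_sub_cancel,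
        eq_comm (a := a)]
        <;> split_ifs <;> simp
  rw [projT_apply, hu, hd]
  split_ifs <;> first | omega | ring

/-- If `A` is lower triangular with scalar diagonal blocks and `A + Q` is fixed by
`X ↦ J Xᵀ J`, then `A = -Q_𝔱`. -/
theorem eq_neg_projT {A Q : Matrix ℕ ℕ ℝ} (hA : Band 0 A)
    (hoff : ∀ n, A (2 * n + 1) (2 * n) = 0)
    (hdiag : ∀ n, A (2 * n + 1) (2 * n + 1) = A (2 * n) (2 * n))
    (hX : J ⬝∞ (A + Q).transpose ⬝∞ J = A + Q) : A = -projT Q := by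
  ext i j
  have h1 : (J ⬝∞ A.transpose ⬝∞ J) i j + (J ⬝∞ Q.transpose ⬝∞ J) i j = A i j + Q i j := by
    rw [← Matrix.add_apply A Q, ← hX]
    simp only [J_semiMul_J_apply, Matrix.transpose_apply, Matrix.add_apply]
    split_ifs <;> ring
  rw [Matrix.neg_apply, projT_apply']
  have hz : ∀ i j, i < j → A i j = 0 := fun i j h => hA i j (by simpa using h)
  split_ifs with hlt heq
  -- Below the blocks the reflection of A vanishes, so the fixed point equation gives A outright.
  · have h2 : (J ⬝∞ A.transpose ⬝∞ J) i j = 0 := by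
      simp only [J_semiMul_J_apply, Matrix.transpose_apply]
      split_ifs with hi hj hj
      · rw [hz _ _ (by grind), neg_zero]
      · rw [hz _ _ (by grind)]
      · rw [hz _ _ (by grind)]
      · rw [hz _ _ (by grind), neg_zero]
    linarith
  -- On a scalar block the reflection is -1, so the equation gives 2A; this is the factor ½ in the
  -- projection.
  · have h2 : (J ⬝∞ A.transpose ⬝∞ J) i j = -A i j := by
      simp only [J_semiMul_J_apply, Matrix.transpose_apply]
      obtain ⟨a, rfl | rfl⟩ := i.even_or_odd' <;> obtain ⟨b, rfl | rfl⟩ := j.even_or_odd'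
      · obtain rfl : a = b := by omega
        simp [hdiag]
      · obtain rfl : a = b := by omega
        have q5 : ¬ Even (2 * a + 1) := by grind
        simp [q5, hz (2 * a) (2 * a + 1) (by omega)]
      · obtain rfl : a = b := by omega
        have q5 : ¬ Even (2 * a + 1) := by grind
        simp [q5, hoff]
      · obtain rfl : a = b := by omega
        have q5 : ¬ Even (2 * a + 1) := by grind
        simp [q5, hdiag]
    linarith
  · rw [hz i j (by omega), neg_zero]

/-! ### The Lax equation -/

/-- Entrywise derivatives of curves of semi-infinite matrices. -/
def HasEntryDeriv (A : ℝ → Matrix ℕ ℕ ℝ) (A' : Matrix ℕ ℕ ℝ) (s : ℝ) : Prop :=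
  ∀ i j, HasDerivAt (fun r => A r i j) (A' i j) s

namespace HasEntryDeriv

variable {A B : ℝ → Matrix ℕ ℕ ℝ} {A' B' : Matrix ℕ ℕ ℝ} {s : ℝ}

theorem const (A : Matrix ℕ ℕ ℝ) (s : ℝ) : HasEntryDeriv (fun _ => A) 0 s :=
  fun _ _ => hasDerivAt_const _ _

theorem transpose (h : HasEntryDeriv A A' s) :
    HasEntryDeriv (fun r => (A r).transpose) A'.transpose s := fun i j => h j i

theorem congr (h : HasEntryDeriv A A' s) (hAB : B =ᶠ[𝓝 s] A) : HasEntryDeriv B A' s :=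
  fun i j => (h i j).congr_of_eventuallyEq (hAB.mono fun _ hr => congrFun (congrFun hr i) j)

theorem unique (h : HasEntryDeriv A A' s) (h' : HasEntryDeriv A B' s) : A' = B' := by
  ext i j; exact (h i j).unique (h' i j)

theorem band {b : ℕ} (h : HasEntryDeriv A A' s) (hA : ∀ᶠ r in 𝓝 s, Band b (A r)) : Band b A' :=
  fun i j hij => (h i j).unique ((hasDerivAt_const s (0 : ℝ)).congr_of_eventuallyEq
    (hA.mono fun _ hr => hr i j hij))

theorem semiMul {b : ℕ} (hA : HasEntryDeriv A A' s) (hB : HasEntryDeriv B B' s)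
    (hb : ∀ᶠ r in 𝓝 s, Band b (A r)) :
    HasEntryDeriv (fun r => A r ⬝∞ B r) (A' ⬝∞ B s + A s ⬝∞ B') s := by
  intro i j
  rw [Matrix.add_apply, (hA.band hb).semiMul_apply _ (Nat.lt_succ_self _),
    hb.self_of_nhds.semiMul_apply _ (Nat.lt_succ_self _), ← Finset.sum_add_distrib]
  refine HasDerivAt.congr_of_eventuallyEq (f := fun r => ∑ p ∈ Finset.range (i + b).succ,
    A r i p * B r p j) ?_ (hb.mono fun r hr => hr.semiMul_apply _ (Nat.lt_succ_self _) j)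
  exact HasDerivAt.fun_sum fun p _ => (hA i p).mul (hB p j)

theorem semiMul_right {b : ℕ} (hA : HasEntryDeriv A A' s) (hB : HasEntryDeriv B B' s)
    (hb : ∀ᶠ r in 𝓝 s, Band b (B r).transpose) :
    HasEntryDeriv (fun r => A r ⬝∞ B r) (A' ⬝∞ B s + A s ⬝∞ B') s := by
  have h := (hB.transpose.semiMul hA.transpose hb).transpose
  simp only [transpose_semiMul, Matrix.transpose_add, Matrix.transpose_transpose] at h
  rwa [add_comm] at h

end HasEntryDeriv

/-- The Lax equation from the evolution `m' = Λ² m + m (Λ²)ᵀ` of the moment matrix. -/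
theorem hasEntryDeriv_shift_conj {m S : ℝ → Matrix ℕ ℕ ℝ} {S' R' m' : Matrix ℕ ℕ ℝ} {s : ℝ}
    (hfac : ∀ᶠ r in 𝓝 s, IsPfaffFactor (m r) (S r)) (hS : HasEntryDeriv S S' s)
    (hR : HasEntryDeriv (fun r => triInv (S r)) R' s)
    (hm : HasEntryDeriv m m' s)
    (hm' : m' = shift ⬝∞ shift ⬝∞ m s + m s ⬝∞ (shift ⬝∞ shift).transpose) :
    let L := fun r => S r ⬝∞ shift ⬝∞ triInv (S r)
    HasEntryDeriv L (comm (-projT (L s ⬝∞ L s)) (L s)) s := by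
  intro L
  have hf := hfac.self_of_nhds
  have hsh := hf.shape
  have hband : ∀ᶠ r in 𝓝 s, Band 0 (S r) := hfac.mono fun _ hr => hr.shape.band
  have hS'b : Band 0 S' := hS.band hband
  have ht : Band 0 (S s).transpose.transpose := by simpa using hsh.band
  have ht' : Band 0 S'.transpose.transpose := by simpa using hS'b
  set A := S' ⬝∞ triInv (S s) with hAdef
  have hAb : Band 0 A := hS'b.semiMul hsh.band_inv
  have hAt : Band 0 A.transpose.transpose := by simpa using hAb
  have hAS : A ⬝∞ S s = S' := hsh.mul_inv_mul_cancel hS'b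
  have hLb : Band 1 (L s) := hsh.band_shift_conj
  have hLS : L s ⬝∞ S s = S s ⬝∞ shift := hsh.shift_conj_mul
  have hQb : Band 2 (L s ⬝∞ L s) := hLb.semiMul hLb
  have hQt : Band 2 (L s ⬝∞ L s).transpose.transpose := by simpa using hQb
  have hΛb : Band 2 (shift ⬝∞ shift) := band_shift.semiMul band_shift
  have hΛt : Band 2 (shift ⬝∞ shift).transpose.transpose := by simpa using hΛb
  have hQS : L s ⬝∞ L s ⬝∞ S s = S s ⬝∞ (shift ⬝∞ shift) := by
    rw [semiMul_assoc_left hLb hLb, hLS, ← semiMul_assoc_left hLb hsh.band, hLS,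
      semiMul_assoc_left hsh.band band_shift]
  have hoff' : ∀ n, S' (2 * n + 1) (2 * n) = 0 := fun n =>
    (hS _ _).unique ((hasDerivAt_const s (0 : ℝ)).congr_of_eventuallyEq
      (hfac.mono fun _ hr => hr.block_off n))
  have hdiag' : ∀ n, S' (2 * n + 1) (2 * n + 1) = S' (2 * n) (2 * n) := fun n =>
    (hS _ _).unique ((hS _ _).congr_of_eventuallyEq (hfac.mono fun _ hr => hr.block_diag n))
  have hJ := hf.conj_eq
  -- This is the derivative of S m Sᵀ = J, with S' = A S and S Λ² = L² S used to express every term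
  -- through J.
  have hderiv : A ⬝∞ J + (L s ⬝∞ L s) ⬝∞ J + J ⬝∞ (L s ⬝∞ L s).transpose +
      J ⬝∞ A.transpose = 0 := by
    have h1 := (hS.semiMul hm hband).semiMul_right hS.transpose (b := 0)
      (hband.mono fun _ hr => by simpa using hr)
    have h2 : HasEntryDeriv (fun r => S r ⬝∞ m r ⬝∞ (S r).transpose) 0 s :=
      (HasEntryDeriv.const J s).congr (hfac.mono fun _ hr => hr.conj_eq)
    have h3 := h1.unique h2
    have e0 : ∀ B C : Matrix ℕ ℕ ℝ, (B + C) ⬝∞ (S s).transpose =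
        B ⬝∞ (S s).transpose + C ⬝∞ (S s).transpose := fun B C => by
      apply Matrix.transpose_injective
      simp only [transpose_semiMul, Matrix.transpose_add]
      exact semiMul_add_of_band ht _ _
    have e1 : S' ⬝∞ m s ⬝∞ (S s).transpose = A ⬝∞ J := by
      rw [← hAS, semiMul_assoc_left hAb hsh.band, semiMul_assoc_mid hAb _ ht, hJ]
    have e2 : S s ⬝∞ m s ⬝∞ S'.transpose = J ⬝∞ A.transpose := by
      rw [← hAS, transpose_semiMul, ← semiMul_assoc_right _ ht hAt, hJ]
    have e3 : S s ⬝∞ (shift ⬝∞ shift ⬝∞ m s) ⬝∞ (S s).transpose = (L s ⬝∞ L s) ⬝∞ J := by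
      rw [← semiMul_assoc_left hsh.band hΛb, ← hQS, semiMul_assoc_left hQb hsh.band,
        semiMul_assoc_mid hQb _ ht, hJ]
    have e4 : S s ⬝∞ (m s ⬝∞ (shift ⬝∞ shift).transpose) ⬝∞ (S s).transpose =
        J ⬝∞ (L s ⬝∞ L s).transpose := by
      rw [← semiMul_assoc_mid hsh.band _ hΛt, semiMul_assoc_right _ hΛt ht, ← transpose_semiMul,
        ← hQS, transpose_semiMul, ← semiMul_assoc_right _ ht hQt, hJ]
    rw [e0, e1, e2, hm', semiMul_add_of_band hsh.band, e0, e3, e4] at h3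
    rw [← h3]; abel
  have hA : A = -projT (L s ⬝∞ L s) := by
    refine eq_neg_projT hAb ?_ ?_ ?_
    · intro n
      rw [hAdef, hS'b.semiMul_apply_succ_self hsh.band_inv, hoff', hsh.inv.block_off]; ring
    · intro n
      rw [hAdef, hS'b.semiMul_apply_self hsh.band_inv, hS'b.semiMul_apply_self hsh.band_inv,
        hdiag', hsh.inv.block_diag]
    · have hX : (A + L s ⬝∞ L s) ⬝∞ J = -(J ⬝∞ (A + L s ⬝∞ L s).transpose) := by
        rw [add_semiMul (hAb.mono (Nat.zero_le 2)) hQb, Matrix.transpose_add,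
          semiMul_add_of_band band_J, eq_neg_iff_add_eq_zero, ← hderiv]
        abel
      have hXb : Band 2 (A + L s ⬝∞ L s) := (hAb.mono (Nat.zero_le 2)).add hQb
      have h2 : (A + L s ⬝∞ L s) ⬝∞ J ⬝∞ J = -(A + L s ⬝∞ L s) := by
        rw [semiMul_assoc_left hXb band_J, J_semiMul_J, semiMul_neg, semiMul_one]
      rw [hX, neg_semiMul] at h2
      exact neg_injective h2
  have hLd := (hS.semiMul (HasEntryDeriv.const shift s) hband).semiMul (b := 1) hR
    (hband.mono fun _ hr => by simpa using hr.semiMul band_shift)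
  set L' := (S' ⬝∞ shift + S s ⬝∞ 0) ⬝∞ triInv (S s) + S s ⬝∞ shift ⬝∞ R' with hL'
  have hLband : ∀ᶠ r in 𝓝 s, Band 1 (L r) := hfac.mono fun _ hr => hr.shape.band_shift_conj
  have hLd' : HasEntryDeriv L L' s := hLd
  have h1 := (hLd'.semiMul hS hLband).unique
    ((hS.semiMul (HasEntryDeriv.const shift s) hband).congr
      (hfac.mono fun _ hr => hr.shape.shift_conj_mul))
  have hL'b : Band 1 L' := hLd'.band hLband
  have hzero : S s ⬝∞ 0 = 0 := by
    ext i j; rw [hsh.band.semiMul_apply _ (Nat.lt_succ_self _)]; simp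
  -- Differentiating L S = S Λ gives L'S + L A S = A S Λ = A L S, so the derivative of the inverse
  -- is never computed.
  have h2 : L' ⬝∞ S s = comm A (L s) ⬝∞ S s := by
    rw [comm, sub_semiMul (a := 1) (by simpa using hAb.semiMul hLb)
      (by simpa using hLb.semiMul hAb), semiMul_assoc_left hAb hLb, semiMul_assoc_left hLb hAb,
      hAS, hLS, ← semiMul_assoc_left hAb hsh.band, hAS, eq_sub_iff_add_eq, h1, hzero, add_zero]
  have h3 : L' = comm A (L s) := by
    have hcb : Band 1 (comm A (L s)) :=
      Band.sub (by simpa using hAb.semiMul hLb) (by simpa using hLb.semiMul hAb)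
    rw [← hsh.mul_mul_inv_cancel hL'b, h2, hsh.mul_mul_inv_cancel hcb]
  rw [← hA, ← h3]
  exact hLd'

/-! ### Differentiability of the Pfaff factor -/

section Differentiable

variable {s : ℝ}

theorem differentiableAt_det {n : ℕ} {M : ℝ → Matrix (Fin n) (Fin n) ℝ}
    (hM : ∀ i j, DifferentiableAt ℝ (fun r => M r i j) s) :
    DifferentiableAt ℝ (fun r => (M r).det) s := by
  simp only [Matrix.det_apply']
  refine DifferentiableAt.fun_sum fun σ _ => DifferentiableAt.const_mul ?_ _
  exact DifferentiableAt.fun_finsetProd fun i _ => hM _ _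

/-- By Cramer's rule the entries are quotients of determinants, and the cofactors are determinants
with one row replaced by a constant vector. -/
theorem differentiableAt_inv {n : ℕ} {M : ℝ → Matrix (Fin n) (Fin n) ℝ}
    (hM : ∀ i j, DifferentiableAt ℝ (fun r => M r i j) s) (hdet : (M s).det ≠ 0) (i j : Fin n) :
    DifferentiableAt ℝ (fun r => (M r)⁻¹ i j) s := by
  simp only [Matrix.inv_def, Matrix.smul_apply, Matrix.adjugate_apply, Ring.inverse_eq_inv',
    smul_eq_mul]
  refine ((differentiableAt_det hM).inv hdet).mul (differentiableAt_det fun a b => ?_)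
  simp only [Matrix.updateRow_apply]
  split_ifs
  · exact differentiableAt_const _
  · exact hM a b

variable {B S m : ℝ → Matrix ℕ ℕ ℝ}

theorem differentiableAt_triInv (hS : ∀ i j, DifferentiableAt ℝ (fun r => S r i j) s)
    (hb : Band 0 (S s)) (hd : ∀ i, S s i i ≠ 0) (i j : ℕ) :
    DifferentiableAt ℝ (fun r => triInv (S r) i j) s :=
  differentiableAt_inv (M := fun r => corner (S r) (max i j + 1)) (fun _ _ => hS _ _)
    (corner_det_ne_zero hb hd _) _ _

theorem differentiableAt_orthRow (hB : ∀ i j, DifferentiableAt ℝ (fun r => B r i j) s)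
    (hdet : ∀ n, (corner (B s) n).det ≠ 0) (n i : ℕ) :
    DifferentiableAt ℝ (fun r => orthRow (B r) n i) s := by
  simp only [orthRow, Matrix.of_apply]
  split_ifs with h1 h2
  · exact differentiableAt_const _
  · have h : ∀ j : Fin n, DifferentiableAt ℝ
        (fun r => B r n j * (corner (B r) n)⁻¹ j ⟨i, h2⟩) s := fun j =>
      (hB n j).mul (differentiableAt_inv (M := fun r => corner (B r) n)
        (fun _ _ => hB _ _) (hdet n) _ _)
    exact (DifferentiableAt.fun_sum fun j _ => h j).fun_neg
  · exact differentiableAt_const _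

theorem differentiableAt_pivot (hB : ∀ i j, DifferentiableAt ℝ (fun r => B r i j) s)
    (hdet : ∀ n, (corner (B s) n).det ≠ 0) (n : ℕ) :
    DifferentiableAt ℝ (fun r => pivot (B r) n) s := by
  simp only [pivot, (band_orthRow _).semiMul_apply _ (Nat.lt_succ_self _)]
  exact DifferentiableAt.fun_sum fun p _ => (differentiableAt_orthRow hB hdet n p).mul (hB p n)

/-- The factor is built from the moments by rational operations and square roots of pivots; nonzero
minors and positive pivots keep these smooth. -/
theorem differentiableAt_paritySkewFactor
    (hm : ∀ i j, DifferentiableAt ℝ (fun r => m r i j) s)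
    (hdet : ∀ n, (corner (evenOddBlock (m s)) n).det ≠ 0)
    (hD : ∀ n, 0 < pivot (evenOddBlock (m s)) n) (i j : ℕ) :
    DifferentiableAt ℝ (fun r => paritySkewFactor (m r) i j) s := by
  have hB : ∀ i j, DifferentiableAt ℝ (fun r => evenOddBlock (m r) i j) s := fun i j => hm _ _
  have hsq : ∀ n, DifferentiableAt ℝ (fun r => √(pivot (evenOddBlock (m r)) n)) s := fun n =>
    (differentiableAt_pivot hB hdet n).sqrt (hD n).ne'
  have hne : ∀ n, √(pivot (evenOddBlock (m s)) n) ≠ 0 := fun n => (Real.sqrt_pos.2 (hD n)).ne'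
  simp only [paritySkewFactor, Matrix.of_apply]
  split_ifs
  · exact (differentiableAt_orthRow hB hdet _ _).div (hsq _) (hne _)
  · refine (differentiableAt_orthRow (B := fun r => (evenOddBlock (m r)).transpose)
      (fun i j => hB j i) (fun n => ?_) _ _).div (hsq _) (hne _)
    rw [corner_transpose, Matrix.det_transpose]
    exact hdet n
  · exact differentiableAt_const _

end Differentiable

/-! ### The flow of the moments in `t₂` -/

section Flow

variable {t : ℕ+ → ℝ}

theorem EvenCouplings.update (he : EvenCouplings t) (s : ℝ) :
    EvenCouplings (Function.update t 2 s) := fun k hk => by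
  have h2 : k ≠ 2 := by
    rintro rfl
    revert hk; decide
  rw [Function.update_of_ne h2, he k hk]

/-- Only one term of a convergent series changes, so this holds for every `s`, admissible or not,
and makes the dependence on `s` explicit. -/
theorem Admissible.weight_update (ha : Admissible t) (s z : ℝ) :
    weight (Function.update t 2 s) z = weight t z * Real.exp ((s - t 2) * z ^ 2) := by
  have h1 : (fun k : ℕ+ => Function.update t 2 s k * z ^ (k : ℕ)) =
      Function.update (fun k : ℕ+ => t k * z ^ (k : ℕ)) 2 (s * z ^ 2) := by
    ext k
    rcases eq_or_ne k 2 with rfl | hk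
    · simp
    · rw [Function.update_of_ne hk, Function.update_of_ne hk]
  have h2 := ((ha.1 z).hasSum.update 2 (s * z ^ 2)).tsum_eq
  unfold weight
  rw [h1, h2, ← Real.exp_add]
  congr 1
  simp only [PNat.val_ofNat]
  ring

/-- The derivative in t₂ brings down x² + y² from the two weights. Differentiation under the
integral is dominated by the moments at some admissible `u` slightly above t₂, since the integrands
increase in `s` in absolute value. -/
theorem hasDerivAt_skewMoments (hev : ∀ᶠ s in 𝓝 (t 2), Admissible (Function.update t 2 s))
    (i j : ℕ) : HasDerivAt (fun s => skewMoments (Function.update t 2 s) i j)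
      (skewMoments t (i + 2) j + skewMoments t i (j + 2)) (t 2) := by
  have ha : Admissible t := by simpa using hev.self_of_nhds
  obtain ⟨u, hu, hau⟩ : ∃ u, t 2 < u ∧ Admissible (Function.update t 2 u) :=
    ((eventually_mem_nhdsWithin (a := t 2) (s := Set.Ioi (t 2))).and
      (hev.filter_mono nhdsWithin_le_nhds)).exists
  set G : ℕ → ℕ → ℝ → ℝ × ℝ → ℝ := fun i j s p =>
    p.1 ^ i * p.2 ^ j * Real.sign (p.2 - p.1) * weight (Function.update t 2 s) p.1 *
      weight (Function.update t 2 s) p.2 with hG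
  have hGexp : ∀ i j s p, G i j s p = p.1 ^ i * p.2 ^ j * Real.sign (p.2 - p.1) * weight t p.1 *
      weight t p.2 * Real.exp ((s - t 2) * (p.1 ^ 2 + p.2 ^ 2)) := fun i j s p => by
    simp only [hG]
    rw [ha.weight_update, ha.weight_update, mul_add, Real.exp_add]
    ring
  have hcont := ha.continuous_weight
  have hmeas : ∀ i j s, Measurable (G i j s) := fun i j s => by
    have : G i j s = fun p => p.1 ^ i * p.2 ^ j * Real.sign (p.2 - p.1) * weight t p.1 *
      weight t p.2 * Real.exp ((s - t 2) * (p.1 ^ 2 + p.2 ^ 2)) := funext fun p => hGexp i j s p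
    rw [this]
    have hs : Measurable fun p : ℝ × ℝ => Real.sign (p.2 - p.1) :=
      measurable_sign.comp (by fun_prop)
    have hw := hcont.measurable
    fun_prop
  have hint : ∀ i j s, Admissible (Function.update t 2 s) → Integrable (G i j s) := fun i j s h =>
    integrable_skew (h.2 i) (h.2 j)
  have ha' : Admissible (Function.update t 2 (t 2)) := by simpa using ha
  have hmono : ∀ i j s p, s ≤ u → |G i j s p| ≤ |G i j u p| := fun i j s p hs => by
    rw [hGexp, hGexp, abs_mul, abs_mul _ (Real.exp _)]
    refine mul_le_mul_of_nonneg_left ?_ (abs_nonneg _)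
    rw [Real.abs_exp, Real.abs_exp, Real.exp_le_exp]
    gcongr
  have key := hasDerivAt_integral_of_dominated_loc_of_deriv_le (μ := (volume : Measure (ℝ × ℝ)))
    (F := fun s p => G i j s p) (F' := fun s p => G (i + 2) j s p + G i (j + 2) s p)
    (x₀ := t 2) (s := Set.Iio u) (bound := fun p => |G (i + 2) j u p| + |G i (j + 2) u p|)
    (Iio_mem_nhds hu) (Eventually.of_forall fun s => (hmeas i j s).aestronglyMeasurable)
    (hint i j _ ha')
    ((hmeas (i + 2) j _).add (hmeas i (j + 2) _)).aestronglyMeasurable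
    (Eventually.of_forall fun p s hs => (abs_add_le _ _).trans
      (add_le_add (hmono _ _ s p (le_of_lt hs)) (hmono _ _ s p (le_of_lt hs))))
    ((hint _ _ _ hau).abs.add (hint _ _ _ hau).abs)
    (Eventually.of_forall fun p s _ => by
      simp only [hGexp]
      have h1 : HasDerivAt (fun s => (s - t 2) * (p.1 ^ 2 + p.2 ^ 2)) (p.1 ^ 2 + p.2 ^ 2) s := by
        simpa using ((hasDerivAt_id s).sub_const (t 2)).mul_const (p.1 ^ 2 + p.2 ^ 2)
      refine (h1.exp.const_mul _).congr_deriv ?_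
      ring)
  have h := key.2.const_mul (1 / 2 : ℝ)
  rw [integral_add (hint _ _ _ ha') (hint _ _ _ ha'), mul_add] at h
  simp only [hG, Function.update_eq_self] at h
  exact h

theorem hasEntryDeriv_skewMoments (hev : ∀ᶠ s in 𝓝 (t 2), Admissible (Function.update t 2 s)) :
    HasEntryDeriv (fun s => skewMoments (Function.update t 2 s))
      (shift ⬝∞ shift ⬝∞ skewMoments t + skewMoments t ⬝∞ (shift ⬝∞ shift).transpose) (t 2) := by
  have hl : ∀ (A : Matrix ℕ ℕ ℝ) i j, (shift ⬝∞ A) i j = A (i + 1) j := fun A i j => by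
    rw [band_shift.semiMul_apply A (N := i + 2) (by omega), Finset.sum_eq_single (i + 1)]
    · simp [shift]
    · intro p _ hp
      simp only [shift, Matrix.of_apply]
      rw [if_neg hp, zero_mul]
    · intro h; simp at h
  have h1 : ∀ i j, (shift ⬝∞ shift ⬝∞ skewMoments t) i j = skewMoments t (i + 2) j := fun i j => by
    rw [semiMul_assoc_left band_shift band_shift, hl, hl]
  have h2 : ∀ i j, (skewMoments t ⬝∞ (shift ⬝∞ shift).transpose) i j = skewMoments t i (j + 2) :=
    fun i j => by
    have h3 : skewMoments t ⬝∞ (shift ⬝∞ shift).transpose =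
        (shift ⬝∞ shift ⬝∞ (skewMoments t).transpose).transpose := by
      rw [transpose_semiMul (shift ⬝∞ shift), Matrix.transpose_transpose]
    rw [h3, Matrix.transpose_apply, semiMul_assoc_left band_shift band_shift, hl, hl]
    rfl
  intro i j
  rw [Matrix.add_apply, h1, h2]
  exact hasDerivAt_skewMoments hev i j

theorem solvesLaxAt_pfaffLax (he : EvenCouplings t)
    (hev : ∀ᶠ s in 𝓝 (t 2), Admissible (Function.update t 2 s)) :
    SolvesLaxAt (fun s => pfaffLax (Function.update t 2 s)) (t 2) := by
  have ha : Admissible t := by simpa using hev.self_of_nhds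
  have hfac : ∀ᶠ s in 𝓝 (t 2), IsPfaffFactor (skewMoments (Function.update t 2 s))
      (paritySkewFactor (skewMoments (Function.update t 2 s))) :=
    hev.mono fun s hs => moments_isPfaffFactor (he.update s) hs
  have hm := hasEntryDeriv_skewMoments hev
  have hSd := fun i j => differentiableAt_paritySkewFactor
    (m := fun s => skewMoments (Function.update t 2 s)) (fun i j => (hm i j).differentiableAt)
    (by simpa using moments_corner_det_ne_zero he ha) (by simpa using moments_pivot_pos he ha) i j
  have hsh := hfac.self_of_nhds.shape
  have hRd := fun i j => differentiableAt_triInv hSd hsh.band hsh.diag_ne_zero i j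
  have h := hasEntryDeriv_shift_conj hfac (fun i j => (hSd i j).hasDerivAt)
    (fun i j => (hRd i j).hasDerivAt) hm (by simp)
  have hL := hfac.mono fun s hs => pfaffLax_eq hs
  have h2 := HasEntryDeriv.congr h hL
  simp only at h2
  rw [← pfaffLax_eq hfac.self_of_nhds] at h2
  exact h2

theorem solvesChainAt_latticeVar (he : EvenCouplings t)
    (hev : ∀ᶠ s in 𝓝 (t 2), Admissible (Function.update t 2 s)) :
    SolvesChainAt (fun s => latticeVar (Function.update t 2 s)) (t 2) := by
  refine (solvesLaxAt_reducedLax_iff _ _ (by simp [latticeVar, laxEntry])).1 ?_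
  have hL : (fun s => reducedLax (latticeVar (Function.update t 2 s))) =ᶠ[𝓝 (t 2)]
      fun s => pfaffLax (Function.update t 2 s) :=
    hev.mono fun s hs => (pfaffLax_eq_reducedLax (he.update s) hs).symm
  have h := HasEntryDeriv.congr (solvesLaxAt_pfaffLax he hev) hL
  rw [← hL.self_of_nhds] at h
  exact h

end Flow

/-! ### Hermite polynomials -/

section Hermite

open Polynomial

/-- The Hermite polynomials orthogonal for `exp (-x ^ 2)`. -/
noncomputable def hermitePhys : ℕ → ℝ[X]
  | 0 => 1
  | n + 1 => 2 * X * hermitePhys n - derivative (hermitePhys n)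

theorem hermitePhys_succ (n : ℕ) :
    hermitePhys (n + 1) = 2 * X * hermitePhys n - derivative (hermitePhys n) := rfl

theorem derivative_hermitePhys_succ (n : ℕ) :
    derivative (hermitePhys (n + 1)) = 2 * ((n : ℝ[X]) + 1) * hermitePhys n := by
  induction n with
  | zero => simp [hermitePhys]
  | succ n ih =>
    rw [hermitePhys_succ (n + 1), derivative_sub, derivative_mul, ih, hermitePhys_succ n]
    simp only [derivative_mul, derivative_ofNat, derivative_X, derivative_add, derivative_natCast,
      derivative_one, Nat.cast_add, Nat.cast_one]
    ring

theorem coeff_hermitePhys_succ (n i : ℕ) : (hermitePhys (n + 1)).coeff (i + 1) =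
    2 * (hermitePhys n).coeff i - (hermitePhys n).coeff (i + 2) * (i + 2) := by
  rw [hermitePhys_succ, coeff_sub, coeff_derivative, mul_assoc, coeff_ofNat_mul, coeff_X_mul]
  push_cast; ring

theorem coeff_hermitePhys_of_lt {n i : ℕ} (h : n < i) : (hermitePhys n).coeff i = 0 := by
  induction n generalizing i with
  | zero => rw [hermitePhys, coeff_one, if_neg (by omega)]
  | succ n ih =>
    obtain ⟨i, rfl⟩ := Nat.exists_eq_add_of_lt (Nat.zero_lt_of_lt h)
    rw [zero_add, coeff_hermitePhys_succ, ih (by omega), ih (by omega)]; ring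

theorem coeff_hermitePhys_self (n : ℕ) : (hermitePhys n).coeff n = 2 ^ n := by
  induction n with
  | zero => simp [hermitePhys]
  | succ n ih =>
    rw [coeff_hermitePhys_succ, ih, coeff_hermitePhys_of_lt (by omega)]; ring

theorem coeff_hermitePhys_of_odd {n i : ℕ} (h : Odd (n + i)) : (hermitePhys n).coeff i = 0 := by
  induction n generalizing i with
  | zero => rw [hermitePhys, coeff_one, if_neg (by grind)]
  | succ n ih =>
    rcases i with _ | i
    · rw [hermitePhys_succ, coeff_sub, coeff_derivative, mul_assoc, coeff_ofNat_mul,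
        ih (i := 0 + 1) (by grind)]
      simp
    · rw [coeff_hermitePhys_succ, ih (by grind), ih (by grind)]; ring

theorem eval_hermitePhys_two_mul_neg (n : ℕ) (x : ℝ) :
    (hermitePhys (2 * n)).eval (-x) = (hermitePhys (2 * n)).eval x := by
  rw [eval_eq_sum_range, eval_eq_sum_range]
  refine Finset.sum_congr rfl fun i _ => ?_
  rcases Nat.even_or_odd i with h | h
  · rw [h.neg_pow]
  · rw [coeff_hermitePhys_of_odd (by grind), zero_mul, zero_mul]

theorem integrable_eval_mul_exp {b : ℝ} (hb : 0 < b) (P : ℝ[X]) :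
    Integrable fun x => P.eval x * Real.exp (-b * x ^ 2) := by
  simp only [eval_eq_sum_range, Finset.sum_mul, mul_assoc]
  refine integrable_finsetSum _ fun i _ => Integrable.const_mul ?_ _
  have h := integrable_rpow_mul_exp_neg_mul_sq hb (s := i)
    (by linarith [Nat.cast_nonneg (α := ℝ) i])
  simpa only [Real.rpow_natCast] using h

/-- The integral of a polynomial against `exp (-x ^ 2)`. -/
noncomputable def gaussInt (P : ℝ[X]) : ℝ := ∫ x, P.eval x * Real.exp (-1 * x ^ 2)

/-- The recursion defining the Hermite polynomials says that H_{n+1} e^{-x²} = -(H_n e^{-x²})'; the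
rest is integration by parts. -/
theorem gaussInt_hermitePhys_succ (P : ℝ[X]) (n : ℕ) :
    gaussInt (P * hermitePhys (n + 1)) = gaussInt (derivative P * hermitePhys n) := by
  have hv : ∀ x, HasDerivAt (fun x => (hermitePhys n).eval x * Real.exp (-1 * x ^ 2))
      (-((hermitePhys (n + 1)).eval x * Real.exp (-1 * x ^ 2))) x := fun x => by
    have h1 : HasDerivAt (fun x : ℝ => -1 * x ^ 2) (-1 * (2 * x)) x := by
      simpa using (hasDerivAt_pow 2 x).const_mul (-1)
    refine (((hermitePhys n).hasDerivAt x).mul h1.exp).congr_deriv ?_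
    rw [hermitePhys_succ]
    simp only [eval_sub, eval_mul, eval_ofNat, eval_X]
    ring
  have h := integral_mul_deriv_eq_deriv_mul_of_integrable (u := fun x => P.eval x)
    (fun x _ => P.hasDerivAt x) (fun x _ => hv x)
    ((integrable_eval_mul_exp one_pos (-(P * hermitePhys (n + 1)))).congr
      (Eventually.of_forall fun x => by simp; ring))
    ((integrable_eval_mul_exp one_pos (derivative P * hermitePhys n)).congr
      (Eventually.of_forall fun x => by simp; ring))
    ((integrable_eval_mul_exp one_pos (P * hermitePhys n)).congr
      (Eventually.of_forall fun x => by simp; ring))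
  simp only [mul_neg, integral_neg, neg_inj, ← mul_assoc] at h
  simpa only [gaussInt, eval_mul] using h

theorem gaussInt_hermitePhys (m n : ℕ) : gaussInt (hermitePhys m * hermitePhys n) =
    if m = n then √Real.pi * 2 ^ n * (n.factorial : ℝ) else 0 := by
  induction n generalizing m with
  | zero =>
    rcases m with _ | m
    · have := integral_gaussian 1
      simp only [div_one] at this
      simp [hermitePhys, gaussInt] at this ⊢
      exact this
    · rw [mul_comm, gaussInt_hermitePhys_succ]
      simp [hermitePhys, gaussInt]
  | succ n ih =>
    rw [gaussInt_hermitePhys_succ]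
    rcases m with _ | m
    · simp [hermitePhys, gaussInt]
    · have h1 : derivative (hermitePhys (m + 1)) * hermitePhys n =
          C (2 * ((m : ℝ) + 1)) * (hermitePhys m * hermitePhys n) := by
        rw [derivative_hermitePhys_succ]
        simp only [C_mul, C_add, C_1, C_ofNat, map_natCast]
        ring
      have h2 : gaussInt (C (2 * ((m : ℝ) + 1)) * (hermitePhys m * hermitePhys n)) =
          2 * ((m : ℝ) + 1) * gaussInt (hermitePhys m * hermitePhys n) := by
        simp only [gaussInt]
        rw [← integral_const_mul]
        refine integral_congr_ae (Eventually.of_forall fun x => ?_)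
        simp only [eval_mul, eval_C]
        ring
      rw [h1, h2, ih]
      rcases eq_or_ne m n with rfl | hmn
      · rw [if_pos rfl, if_pos rfl, Nat.factorial_succ]
        push_cast; ring
      · rw [if_neg hmn, if_neg (by omega), mul_zero]

end Hermite

/-! ### The Gaussian orthogonal ensemble -/

section Gaussian

open Polynomial

theorem weight_zero (z : ℝ) : weight 0 z = Real.exp (-(1 / 2) * z ^ 2) := by
  simp only [weight, Pi.zero_apply, zero_mul, tsum_zero, add_zero]
  congr 1; ring

theorem evenCouplings_zero : EvenCouplings 0 := fun _ _ => rfl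

theorem admissible_zero : Admissible 0 := by
  refine ⟨fun z => by simp, fun j => ?_⟩
  have h := integrable_eval_mul_exp (b := 1 / 2) (by norm_num) (X ^ j : ℝ[X])
  simpa only [eval_pow, eval_X, weight_zero] using h

/-- The odd skew-orthogonal polynomials of the GOE, up to normalisation. -/
noncomputable def oddPoly (n : ℕ) : ℝ[X] :=
  X * hermitePhys (2 * n) - derivative (hermitePhys (2 * n))

/-- The odd polynomial times ρ is -(H_{2n}ρ)'. Integrating by parts against the primitive of H_{2m}ρ
leaves ∫ H_{2m}H_{2n}ρ², and ρ² is the Hermite weight e^{-x²}. -/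
theorem skewProd_hermitePhys_oddPoly (m n : ℕ) :
    skewProd 0 (fun x => (hermitePhys (2 * m)).eval x) (fun y => (oddPoly n).eval y) =
      if m = n then √Real.pi * 2 ^ (2 * n) * ((2 * n).factorial : ℝ) else 0 := by
  have ha := admissible_zero
  have hki := ha.integrable_eval (hermitePhys (2 * m))
  have hkc : Continuous fun x => (hermitePhys (2 * m)).eval x * weight 0 x := by
    have := ha.continuous_weight
    fun_prop
  rw [evenCouplings_zero.skewProd_eq_integral (eval_hermitePhys_two_mul_neg m) hki
    (ha.integrable_eval _)]
  set F : ℝ → ℝ := fun y => ∫ x in (0 : ℝ)..y, (hermitePhys (2 * m)).eval x * weight 0 x with hF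
  have hFd : ∀ x, HasDerivAt F ((hermitePhys (2 * m)).eval x * weight 0 x) x := fun x =>
    intervalIntegral.integral_hasDerivAt_right (hkc.intervalIntegrable _ _)
      hkc.stronglyMeasurable.stronglyMeasurableAtFilter hkc.continuousAt
  have hFc : Continuous F := continuous_iff_continuousAt.2 fun x => (hFd x).continuousAt
  have hFb : ∀ {g : ℝ → ℝ}, Integrable g → Integrable (fun x => F x * g x) := fun hg =>
    hg.bdd_mul hFc.aestronglyMeasurable
      (Eventually.of_forall fun y => abs_intervalIntegral_le hki y)
  have hv : ∀ x, HasDerivAt (fun x => (hermitePhys (2 * n)).eval x * weight 0 x)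
      (-((oddPoly n).eval x * weight 0 x)) x := fun x => by
    have h1 : HasDerivAt (fun x : ℝ => -(1 / 2) * x ^ 2) (-(1 / 2) * (2 * x)) x := by
      exact ((hasDerivAt_pow 2 x).const_mul (-(1 / 2))).congr_deriv (by norm_num)
    simp only [weight_zero]
    refine (((hermitePhys (2 * n)).hasDerivAt x).mul h1.exp).congr_deriv ?_
    simp only [oddPoly, eval_sub, eval_mul, eval_X]
    ring
  have hww : ∀ x, weight 0 x * weight 0 x = Real.exp (-1 * x ^ 2) := fun x => by
    rw [weight_zero, ← Real.exp_add]; congr 1; ring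
  have hprod : ∀ x, (hermitePhys (2 * m)).eval x * weight 0 x *
      ((hermitePhys (2 * n)).eval x * weight 0 x) =
      (hermitePhys (2 * m) * hermitePhys (2 * n)).eval x * Real.exp (-1 * x ^ 2) := fun x => by
    rw [← hww, eval_mul]; ring
  have h := integral_mul_deriv_eq_deriv_mul_of_integrable (fun x _ => hFd x) (fun x _ => hv x)
    (hFb (ha.integrable_eval (oddPoly n)).neg)
    ((integrable_eval_mul_exp one_pos (hermitePhys (2 * m) * hermitePhys (2 * n))).congr
      (Eventually.of_forall fun x => (hprod x).symm))
    (hFb (ha.integrable_eval (hermitePhys (2 * n))))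
  simp only [mul_neg, integral_neg, neg_inj, hprod] at h
  rw [h]
  refine (gaussInt_hermitePhys _ _).trans (if_congr (by omega) rfl rfl)

/-- The normalisation of the skew-orthogonal polynomials of the GOE. -/
noncomputable def goeNorm (n : ℕ) : ℝ := (√√Real.pi * 2 ^ n * √((2 * n).factorial : ℝ))⁻¹

theorem sqrt_sqrt_pi_pos : 0 < √√Real.pi := Real.sqrt_pos.2 (Real.sqrt_pos.2 Real.pi_pos)

theorem sqrt_factorial_pos (n : ℕ) : 0 < √(n.factorial : ℝ) :=
  Real.sqrt_pos.2 (Nat.cast_pos.2 n.factorial_pos)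

theorem goeNorm_pos (n : ℕ) : 0 < goeNorm n := by
  have h1 := sqrt_sqrt_pi_pos
  have h2 := sqrt_factorial_pos (2 * n)
  unfold goeNorm
  positivity

theorem goeNorm_sq (n : ℕ) :
    goeNorm n * goeNorm n * (√Real.pi * 2 ^ (2 * n) * ((2 * n).factorial : ℝ)) = 1 := by
  have h1 := sqrt_sqrt_pi_pos
  have h2 := sqrt_factorial_pos (2 * n)
  have e1 : √√Real.pi * √√Real.pi = √Real.pi := Real.mul_self_sqrt (Real.sqrt_nonneg _)
  have e2 := Real.mul_self_sqrt (Nat.cast_nonneg (α := ℝ) (2 * n).factorial)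
  rw [← e1, ← e2, goeNorm, pow_mul', sq]
  field_simp

/-- This ratio of norms is the source of the square roots in w⁰ and w⁻². -/
theorem goeNorm_succ (n : ℕ) :
    goeNorm (n + 1) * (2 * √((2 * (n : ℝ) + 2) * (2 * n + 1))) = goeNorm n := by
  have h1 := sqrt_sqrt_pi_pos
  have h2 := sqrt_factorial_pos (2 * n)
  have h3 : (0 : ℝ) < (2 * (n : ℝ) + 2) * (2 * n + 1) := by positivity
  have h4 := Real.sqrt_pos.2 h3
  have e : √((2 * (n + 1)).factorial : ℝ) =
      √((2 * (n : ℝ) + 2) * (2 * n + 1)) * √((2 * n).factorial : ℝ) := by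
    rw [← Real.sqrt_mul h3.le, show 2 * (n + 1) = 2 * n + 1 + 1 by ring, Nat.factorial_succ,
      Nat.factorial_succ]
    push_cast
    congr 1; ring
  rw [goeNorm, goeNorm, e, pow_succ]
  field_simp

/-- The skew-orthonormal polynomials of the GOE. -/
noncomputable def goePoly (i : ℕ) : ℝ[X] :=
  C (goeNorm (i / 2)) * if Even i then hermitePhys (2 * (i / 2)) else oddPoly (i / 2)

theorem goePoly_even (n : ℕ) : goePoly (2 * n) = C (goeNorm n) * hermitePhys (2 * n) := by
  simp [goePoly]

theorem goePoly_odd (n : ℕ) : goePoly (2 * n + 1) = C (goeNorm n) * oddPoly n := by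
  have h : ¬ Even (2 * n + 1) := by grind
  rw [goePoly, if_neg h, show (2 * n + 1) / 2 = n by omega]

theorem coeff_oddPoly_succ (n i : ℕ) : (oddPoly n).coeff (i + 1) =
    (hermitePhys (2 * n)).coeff i - (hermitePhys (2 * n)).coeff (i + 2) * (i + 2) := by
  rw [oddPoly, coeff_sub, coeff_X_mul, coeff_derivative]
  push_cast; ring

theorem coeff_oddPoly_of_even {n i : ℕ} (h : Even i) : (oddPoly n).coeff i = 0 := by
  rcases i with _ | i
  · rw [oddPoly, coeff_sub, coeff_derivative, coeff_hermitePhys_of_odd (i := 0 + 1) (by grind)]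
    simp
  · rw [coeff_oddPoly_succ, coeff_hermitePhys_of_odd (by grind),
      coeff_hermitePhys_of_odd (by grind)]
    ring

theorem coeff_goePoly_of_lt {i j : ℕ} (h : i < j) : (goePoly i).coeff j = 0 := by
  obtain ⟨n, rfl | rfl⟩ := i.even_or_odd'
  · rw [goePoly_even, coeff_C_mul, coeff_hermitePhys_of_lt h, mul_zero]
  · obtain ⟨j, rfl⟩ := Nat.exists_eq_add_of_lt (Nat.zero_lt_of_lt h)
    rw [zero_add, goePoly_odd, coeff_C_mul, coeff_oddPoly_succ, coeff_hermitePhys_of_lt (by omega),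
      coeff_hermitePhys_of_lt (by omega)]
    ring

/-- The Pfaff factor of the GOE. -/
noncomputable def goeFactor : Matrix ℕ ℕ ℝ := Matrix.of fun i j => (goePoly i).coeff j

theorem goeFactor_shape : PfaffShape goeFactor where
  lower i j h := coeff_goePoly_of_lt h
  block_off n := by
    simp only [goeFactor, Matrix.of_apply]
    rw [goePoly_odd, coeff_C_mul, coeff_oddPoly_of_even (even_two_mul n), mul_zero]
  block_diag n := by
    simp only [goeFactor, Matrix.of_apply]
    rw [goePoly_odd, goePoly_even, coeff_C_mul, coeff_C_mul, coeff_oddPoly_succ,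
      coeff_hermitePhys_of_lt (i := 2 * n + 2) (by omega)]
    ring
  pos n := by
    simp only [goeFactor, Matrix.of_apply]
    rw [goePoly_even, coeff_C_mul, coeff_hermitePhys_self]
    have := goeNorm_pos n
    positivity

theorem natDegree_goePoly_lt (i : ℕ) : (goePoly i).natDegree < i + 1 :=
  Nat.lt_succ_of_le (natDegree_le_iff_coeff_eq_zero.2 fun _ h => coeff_goePoly_of_lt h)

theorem goeFactor_conj_apply (i j : ℕ) :
    (goeFactor ⬝∞ skewMoments 0 ⬝∞ goeFactor.transpose) i j =
      skewProd 0 (fun x => (goePoly i).eval x) (fun y => (goePoly j).eval y) := by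
  rw [conj_apply goeFactor_shape.band _ (Nat.lt_succ_self i) (Nat.lt_succ_self j),
    admissible_zero.skewProd_eval _ _ (natDegree_goePoly_lt i) (natDegree_goePoly_lt j)]
  rfl

theorem coeff_goePoly_of_odd {i j : ℕ} (h : Odd (i + j)) : (goePoly i).coeff j = 0 := by
  obtain ⟨n, rfl | rfl⟩ := i.even_or_odd'
  · rw [goePoly_even, coeff_C_mul, coeff_hermitePhys_of_odd (by grind), mul_zero]
  · rw [goePoly_odd, coeff_C_mul, coeff_oddPoly_of_even (by grind), mul_zero]

theorem goeFactor_conj_even_odd (m n : ℕ) :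
    (goeFactor ⬝∞ skewMoments 0 ⬝∞ goeFactor.transpose) (2 * m) (2 * n + 1) =
      if m = n then 1 else 0 := by
  have h : skewProd 0 (fun x => (goePoly (2 * m)).eval x) (fun y => (goePoly (2 * n + 1)).eval y) =
      goeNorm m * goeNorm n *
        skewProd 0 (fun x => (hermitePhys (2 * m)).eval x) (fun y => (oddPoly n).eval y) := by
    simp only [skewProd, goePoly_even, goePoly_odd, eval_mul, eval_C]
    rw [mul_left_comm (goeNorm m * goeNorm n), ← integral_const_mul (goeNorm m * goeNorm n)]
    congr 1
    refine integral_congr_ae (Eventually.of_forall fun p => ?_)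
    simp only
    ring
  rw [goeFactor_conj_apply, h, skewProd_hermitePhys_oddPoly]
  split_ifs with hmn
  · rw [hmn, goeNorm_sq]
  · rw [mul_zero]

theorem goeFactor_isPfaffFactor : IsPfaffFactor (skewMoments 0) goeFactor := by
  refine goeFactor_shape.isPfaffFactor (eq_J_of_entries (fun i j hij => ?_)
    goeFactor_conj_even_odd (conj_swap goeFactor_shape.band (skewMoments_swap 0)))
  rw [conj_apply goeFactor_shape.band _ (Nat.lt_succ_self i) (Nat.lt_succ_self j)]
  refine Finset.sum_eq_zero fun p _ => Finset.sum_eq_zero fun q _ => ?_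
  rcases Nat.even_or_odd (i + p) with h1 | h1
  · rcases Nat.even_or_odd (j + q) with h2 | h2
    · rw [skewMoments_parity evenCouplings_zero (by grind)]; ring
    · simp only [goeFactor, Matrix.of_apply, coeff_goePoly_of_odd h2]; ring
  · simp only [goeFactor, Matrix.of_apply, coeff_goePoly_of_odd h1]; ring

/-! ### The recursion of the skew-orthogonal polynomials -/

theorem X_mul_hermitePhys_succ (n : ℕ) : X * hermitePhys (n + 1) =
    C (1 / 2 : ℝ) * hermitePhys (n + 2) + C ((n : ℝ) + 1) * hermitePhys n := by
  rw [hermitePhys_succ (n + 1), derivative_hermitePhys_succ]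
  have h : C (1 / 2 : ℝ) * 2 = 1 := by
    rw [← C_ofNat, ← C_mul]; norm_num
  simp only [C_add, C_1, map_natCast]
  linear_combination (-(X * hermitePhys (n + 1)) + ((n : ℝ[X]) + 1) * hermitePhys n) * h

theorem X_mul_oddPoly_zero : X * oddPoly 0 =
    C (1 / 4 : ℝ) * hermitePhys 2 + C (1 / 2 : ℝ) * hermitePhys 0 := by
  have h0 : oddPoly 0 = X := by simp [oddPoly, hermitePhys]
  have h1 : hermitePhys 2 = C 4 * (X * X) - C 2 := by
    have c4 : C (4 : ℝ) = 4 := C_ofNat 4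
    have c2 : C (2 : ℝ) = 2 := C_ofNat 2
    simp [hermitePhys, c4, c2]; ring
  have h2 : C (1 / 4 : ℝ) * C 4 = 1 := by rw [← C_mul]; norm_num
  have h3 : C (1 / 4 : ℝ) * C 2 = C (1 / 2) := by rw [← C_mul]; norm_num
  rw [h0, h1, mul_sub, ← mul_assoc, h2, h3]
  simp [hermitePhys]

theorem oddPoly_succ (n : ℕ) : oddPoly (n + 1) =
    C (1 / 2 : ℝ) * hermitePhys (2 * n + 3) - C (2 * (n : ℝ) + 2) * hermitePhys (2 * n + 1) := by
  rw [oddPoly, show 2 * (n + 1) = 2 * n + 1 + 1 by ring, X_mul_hermitePhys_succ,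
    derivative_hermitePhys_succ]
  simp only [C_add, C_mul, C_1, map_natCast, C_ofNat, Nat.cast_add, Nat.cast_mul, Nat.cast_one,
    Nat.cast_ofNat]
  ring

theorem X_mul_oddPoly_succ (n : ℕ) : X * oddPoly (n + 1) =
    C (1 / 4 : ℝ) * hermitePhys (2 * (n + 2)) + C (1 / 2 : ℝ) * hermitePhys (2 * (n + 1))
      - C ((2 * (n : ℝ) + 2) * (2 * n + 1)) * hermitePhys (2 * n) := by
  have h4 : C (1 / 4 : ℝ) = C (1 / 2 : ℝ) * C (1 / 2 : ℝ) := by rw [← C_mul]; norm_num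
  rw [oddPoly_succ, mul_sub, mul_left_comm, mul_left_comm X, X_mul_hermitePhys_succ,
    X_mul_hermitePhys_succ, h4, show 2 * (n + 2) = 2 * n + 2 + 2 by ring,
    show 2 * (n + 1) = 2 * n + 2 by ring]
  simp only [C_add, C_mul, C_1, map_natCast, C_ofNat, Nat.cast_add, Nat.cast_mul,
    Nat.cast_ofNat]
  ring

theorem derivative_hermitePhys_even_succ (n : ℕ) :
    derivative (hermitePhys (2 * (n + 1))) =
      C (4 * ((n : ℝ) + 1)) * (2 * oddPoly n + derivative (hermitePhys (2 * n))) := by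
  rw [show 2 * (n + 1) = 2 * n + 1 + 1 by ring, derivative_hermitePhys_succ, hermitePhys_succ,
    oddPoly]
  simp only [C_add, C_mul, C_1, map_natCast, C_ofNat, Nat.cast_add, Nat.cast_mul, Nat.cast_one,
    Nat.cast_ofNat]
  ring

/-- Iterating H_{2n+2}' = 4(n+1)(2 oddPoly n + H_{2n}') expands the derivative in all lower odd
polynomials. This is why every w^k with k > 0 is nonzero, and where its factorials come from. -/
theorem derivative_hermitePhys_even (n : ℕ) : derivative (hermitePhys (2 * n)) =
    ∑ l ∈ Finset.range n,
      C (2 * 4 ^ (n - l) * ((n.factorial : ℝ) / (l.factorial : ℝ))) * oddPoly l := by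
  induction n with
  | zero => simp [hermitePhys]
  | succ n ih =>
    rw [derivative_hermitePhys_even_succ, ih, Finset.sum_range_succ, mul_add, add_comm,
      Finset.mul_sum]
    congr 1
    · refine Finset.sum_congr rfl fun l hl => ?_
      rw [Finset.mem_range] at hl
      rw [← mul_assoc, ← C_mul, Nat.succ_sub hl.le, Nat.factorial_succ, pow_succ]
      push_cast
      congr 2; ring
    · have hn : (n.factorial : ℝ) ≠ 0 := Nat.cast_ne_zero.2 n.factorial_ne_zero
      rw [← mul_assoc, ← C_ofNat, ← C_mul, Nat.factorial_succ, Nat.succ_sub le_rfl, Nat.sub_self]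
      push_cast
      congr 2
      field_simp

/-- The entries of the Lax matrix of the GOE. -/
noncomputable def goeVar (l : ℤ) (n : ℕ) : ℝ :=
  if l = 0 then 1 / 2 * √(2 * n * (2 * n - 1))
  else if l = -1 then 1 / 2
  else if l = -2 then -(1 / 2) * √(2 * n * (2 * n - 1))
  else if l < 0 then 0
  else 2 ^ (l.natAbs + 1) * (((l.natAbs + n - 1).factorial : ℝ) / ((n - 1).factorial : ℝ)) *
    √(((2 * n - 2).factorial : ℝ) / ((2 * l.natAbs + 2 * n - 2).factorial : ℝ))

theorem goeVar_zero_succ (n : ℕ) :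
    goeVar 0 (n + 1) = 1 / 2 * √((2 * (n : ℝ) + 2) * (2 * n + 1)) := by
  rw [goeVar, if_pos rfl]
  push_cast
  congr 2; ring

theorem goeVar_neg_one (n : ℕ) : goeVar (-(0 + 1 : ℕ)) n = 1 / 2 := by
  simp [goeVar]

theorem goeVar_neg_two_succ (n : ℕ) :
    goeVar (-(1 + 1 : ℕ)) (n + 1) = -(1 / 2) * √((2 * (n : ℝ) + 2) * (2 * n + 1)) := by
  rw [goeVar, if_neg (by omega), if_neg (by omega), if_pos (by norm_num)]
  push_cast
  congr 2; ring

theorem goeVar_neg (d n : ℕ) : goeVar (-(d + 2 + 1 : ℕ)) n = 0 := by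
  rw [goeVar, if_neg (by omega), if_neg (by omega), if_neg (by omega), if_pos (by omega)]

/-- The square root in w^k is the ratio of the two norms up to powers of 2; the rest is the
coefficient in the expansion of H_{2n}'. -/
theorem goeVar_pos_mul_goeNorm (d n : ℕ) : goeVar (d + 1 : ℕ) (n + 1) * goeNorm n =
    2 * 4 ^ (d + 1) * (((n + d + 1).factorial : ℝ) / (n.factorial : ℝ)) * goeNorm (n + d + 1) := by
  have h1 := sqrt_sqrt_pi_pos
  have h2 := sqrt_factorial_pos (2 * n)
  have h3 := sqrt_factorial_pos (2 * (n + d + 1))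
  rw [goeVar, if_neg (by omega), if_neg (by omega), if_neg (by omega), if_neg (by omega),
    Int.natAbs_natCast, show d + 1 + (n + 1) - 1 = n + d + 1 by omega,
    show 2 * (n + 1) - 2 = 2 * n by omega,
    show 2 * (d + 1) + 2 * (n + 1) - 2 = 2 * (n + d + 1) by omega, Nat.add_sub_cancel,
    Real.sqrt_div (Nat.cast_nonneg _), goeNorm, goeNorm, show (4 : ℝ) = 2 * 2 by norm_num, mul_pow,
    show n + d + 1 = n + (d + 1) by ring, pow_add 2 n, pow_succ 2 (d + 1)]
  rw [show n + d + 1 = n + (d + 1) by ring] at h3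
  have hn : (n.factorial : ℝ) ≠ 0 := Nat.cast_ne_zero.2 n.factorial_ne_zero
  field_simp

/-- By definition x H_{2n} = oddPoly n + H_{2n}': the first term is the entry 1, the second the
whole row of w^k. -/
theorem X_mul_goePoly_even (n : ℕ) : X * goePoly (2 * n) =
    ∑ p ∈ Finset.range (2 * n + 2), C (reducedLax goeVar (2 * n) p) * goePoly p := by
  have hev : ∀ b, reducedLax goeVar (2 * n) (2 * b) = 0 := fun b =>
    oddParity_reducedLax _ _ _ (by grind)
  rw [show 2 * n + 2 = 2 * (n + 1) by ring, sum_range_two_mul]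
  simp only [hev, C_0, zero_mul, Finset.sum_const_zero, zero_add]
  rw [Finset.sum_range_succ, reducedLax_even_succ, C_1, one_mul, goePoly_even, goePoly_odd,
    oddPoly, derivative_hermitePhys_even]
  have hsum : ∑ b ∈ Finset.range n, C (reducedLax goeVar (2 * n) (2 * b + 1)) * goePoly (2 * b + 1)
      = C (goeNorm n) * ∑ l ∈ Finset.range n,
        C (2 * 4 ^ (n - l) * ((n.factorial : ℝ) / (l.factorial : ℝ))) * oddPoly l := by
    rw [Finset.mul_sum]
    refine Finset.sum_congr rfl fun b hb => ?_
    obtain ⟨d, rfl⟩ := Nat.exists_eq_add_of_lt (Finset.mem_range.1 hb)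
    rw [show 2 * (b + d + 1) = 2 * (b + d) + 2 by ring, reducedLax_even_odd, goePoly_odd,
      ← mul_assoc, ← C_mul, goeVar_pos_mul_goeNorm, ← mul_assoc, ← C_mul,
      show b + d + 1 - b = d + 1 by omega]
    congr 2; ring
  rw [hsum]
  ring

/-- Two uses of the three-term recursion leave only H_{2n+2}, H_{2n} and H_{2n-2}, that is w⁰, w⁻¹
and w⁻². For n = 0 the last is absent. -/
theorem X_mul_goePoly_odd (n : ℕ) : X * goePoly (2 * n + 1) =
    ∑ p ∈ Finset.range (2 * n + 3), C (reducedLax goeVar (2 * n + 1) p) * goePoly p := by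
  have hodd : ∀ b, reducedLax goeVar (2 * n + 1) (2 * b + 1) = 0 := fun b =>
    oddParity_reducedLax _ _ _ (by grind)
  have hrec : ∀ k, C (goeVar 0 (k + 1)) * C (goeNorm (k + 1)) = C (1 / 4) * C (goeNorm k) :=
    fun k => by
    rw [← C_mul, ← C_mul, goeVar_zero_succ, ← goeNorm_succ k]
    congr 1; ring
  have hd : C (reducedLax goeVar (2 * n + 1) (2 * n)) = C (1 / 2) := by
    have := reducedLax_odd_even goeVar n 0
    rw [add_zero, goeVar_neg_one] at this
    rw [this]
  rw [show 2 * n + 3 = 2 * (n + 1) + 1 by ring, Finset.sum_range_succ, sum_range_two_mul]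
  simp only [hodd, C_0, zero_mul, Finset.sum_const_zero, add_zero]
  rw [Finset.sum_range_succ,
    show reducedLax goeVar (2 * n + 1) (2 * (n + 1)) = goeVar 0 (n + 1) from
    reducedLax_odd_succ _ _, hd, goePoly_even, goePoly_odd, goePoly_even]
  rcases n with _ | n
  · rw [Finset.sum_range_zero, mul_left_comm, X_mul_oddPoly_zero]
    linear_combination (-hermitePhys 2) * hrec 0
  · have h2 : C (reducedLax goeVar (2 * (n + 1) + 1) (2 * n)) * C (goeNorm n) =
        -(C ((2 * (n : ℝ) + 2) * (2 * n + 1)) * C (goeNorm (n + 1))) := by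
      rw [reducedLax_odd_even goeVar n 1, goeVar_neg_two_succ, ← goeNorm_succ n, ← C_mul, ← C_mul,
        ← C_neg]
      have := Real.mul_self_sqrt (show (0 : ℝ) ≤ (2 * (n : ℝ) + 2) * (2 * n + 1) by positivity)
      congr 1
      linear_combination (-goeNorm (n + 1)) * this
    rw [Finset.sum_range_succ, Finset.sum_eq_zero, mul_left_comm, X_mul_oddPoly_succ, goePoly_even]
    · linear_combination (-hermitePhys (2 * (n + 2))) * hrec (n + 1)
        - hermitePhys (2 * n) * h2
    · intro b hb
      obtain ⟨d, rfl⟩ := Nat.exists_eq_add_of_lt (Finset.mem_range.1 hb)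
      rw [show b + d + 1 + 1 = b + (d + 2) by ring, reducedLax_odd_even, goeVar_neg, C_0, zero_mul]

/-- Multiplying a polynomial by x shifts its coefficient row, so the expansions of x times the
skew-orthonormal polynomials are the rows of L S = S Λ. -/
theorem reducedLax_goeVar_mul : reducedLax goeVar ⬝∞ goeFactor = goeFactor ⬝∞ shift := by
  have hX : ∀ i, X * goePoly i =
      ∑ p ∈ Finset.range (i + 2), C (reducedLax goeVar i p) * goePoly p := fun i => by
    obtain ⟨n, rfl | rfl⟩ := i.even_or_odd'
    · exact X_mul_goePoly_even n
    · exact X_mul_goePoly_odd n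
  ext i j
  rw [(band_reducedLax _).semiMul_apply _ (N := i + 2) (by omega)]
  have h := congrArg (fun P => P.coeff j) (hX i)
  simp only [finsetSum_coeff, coeff_C_mul] at h
  refine h.symm.trans ?_
  rcases j with _ | j
  · rw [semiMul_shift_zero, coeff_X_mul_zero]
  · rw [semiMul_shift_succ, coeff_X_mul]; rfl

theorem pfaffLax_zero : pfaffLax 0 = reducedLax goeVar := by
  rw [pfaffLax_eq goeFactor_isPfaffFactor, ← reducedLax_goeVar_mul,
    goeFactor_shape.mul_mul_inv_cancel (band_reducedLax _)]

end Gaussian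

/-! ### Reading off the entries, and the theorem -/

theorem laxEntry_reducedLax (w : ℤ → ℕ → ℝ) (l : ℤ) (n : ℕ) :
    laxEntry (reducedLax w) l (n + 1) = w l (n + 1) := by
  rw [laxEntry, if_neg (by omega)]
  split_ifs with h0 hneg
  · subst h0
    exact reducedLax_odd_succ w n
  · obtain ⟨d, hd⟩ : ∃ d : ℕ, l = -((d + 1 : ℕ) : ℤ) := ⟨l.natAbs - 1, by omega⟩
    subst hd
    rw [Int.natAbs_neg, Int.natAbs_natCast, ← reducedLax_odd_even w n d]
    congr 1; omega
  · obtain ⟨d, hd⟩ : ∃ d : ℕ, l = ((d + 1 : ℕ) : ℤ) := ⟨l.natAbs - 1, by omega⟩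
    subst hd
    rw [Int.natAbs_natCast, ← reducedLax_even_odd w n d]
    congr 1; omega

theorem latticeVar_zero (l : ℤ) {n : ℕ} (hn : 1 ≤ n) : latticeVar 0 l n = goeVar l n := by
  obtain ⟨n, rfl⟩ := Nat.exists_eq_add_of_le' hn
  rw [latticeVar, pfaffLax_zero, laxEntry_reducedLax]

end PfaffLattice

open PfaffLattice in
theorem mainTheorem1 :
    -- for vanishing odd couplings the Lax matrix is well defined and has the reduced form
    (∀ t : ℕ+ → ℝ, EvenCouplings t → Admissible t →
      (∃! S : Matrix ℕ ℕ ℝ, IsPfaffFactor (skewMoments t) S) ∧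
      pfaffLax t = reducedLax (latticeVar t)) ∧
    -- (i) its entries satisfy the Lax equation and the chain
    (∀ t : ℕ+ → ℝ, EvenCouplings t →
      (∀ᶠ s in 𝓝 (t 2), Admissible (Function.update t 2 s)) →
      SolvesLaxAt (fun s => pfaffLax (Function.update t 2 s)) (t 2) ∧
      SolvesChainAt (fun s => latticeVar (Function.update t 2 s)) (t 2)) ∧
    -- (i) for matrices of the reduced form the Lax equation is equivalent to the chain
    (∀ (w : ℝ → ℤ → ℕ → ℝ) (s : ℝ), w s 0 0 = 0 →
      (SolvesLaxAt (fun r => reducedLax (w r)) s ↔ SolvesChainAt w s)) ∧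
    -- (ii) the entries at `t = 0`
    (∀ n : ℕ, 1 ≤ n →
      (∀ k : ℕ, 2 < k → latticeVar 0 (-k) n = 0) ∧
      latticeVar 0 (-2) n = -(1 / 2) * √(2 * n * (2 * n - 1)) ∧
      latticeVar 0 (-1) n = 1 / 2 ∧
      latticeVar 0 0 n = 1 / 2 * √(2 * n * (2 * n - 1)) ∧
      ∀ k : ℕ, 0 < k →
        latticeVar 0 k n =
          2 ^ (k + 1) * (((k + n - 1).factorial : ℝ) / ((n - 1).factorial : ℝ)) *
            √(((2 * n - 2).factorial : ℝ) / ((2 * k + 2 * n - 2).factorial : ℝ))) := by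
  refine ⟨fun t he ha => ⟨⟨_, moments_isPfaffFactor he ha,
      fun _ h => (moments_isPfaffFactor he ha).unique h⟩, pfaffLax_eq_reducedLax he ha⟩,
    fun t he hev => ⟨solvesLaxAt_pfaffLax he hev, solvesChainAt_latticeVar he hev⟩,
    solvesLaxAt_reducedLax_iff, fun n hn => ?_⟩
  simp only [latticeVar_zero _ hn]
  refine ⟨fun k hk => ?_, ?_, ?_, ?_, fun k hk => ?_⟩
  · rw [goeVar, if_neg (by omega), if_neg (by omega), if_neg (by omega), if_pos (by omega)]
  · rw [goeVar, if_neg (by omega), if_neg (by omega), if_pos rfl]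
  · rw [goeVar, if_neg (by omega), if_pos rfl]
  · rw [goeVar, if_pos rfl]
  · rw [goeVar, if_neg (by omega), if_neg (by omega), if_neg (by omega), if_neg (by omega),
      Int.natAbs_natCast]
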